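/- **Setting.** All trees are finite, and uniqueness is up to isomorphism. The boundary of a tree $T$ is its set of leaves (vertices of degree one). A real $\lambda\ge 0$ is a Steklov eigenvalue of $T$ if there is a nonzero $f:V(T)\to\mathbb R$ with $\sum_{w\sim v}(f(v)-f(w))=0$ at every non-leaf $v$ and $f(\omega)-f(\omega')=\lambda f(\omega)$ at every leaf $\omega$ with neighbour $\omega'$. Let $\lambda_2(T)$ be the smallest nonzero Steklov eigenvalue of $T$. An extremizer is a tree that maximizes $\lambda_2$ among all trees with $n$ vertices and diameter $2r+1$. The spider $S(\ell_1,\dots,\ell_b)$ is obtained by gluing together one endpoint of each of $b$ paths of lengths $\ell_1,\dots,\ell_b$. For $b\ge2$, $c\ge 1$ and $0\le t\le b-2$ let $\mathrm{AS}(r,b,c,t)$ be the spider with branch lengths $r+1$, $r$, $t$ copies of $c+1$ and $b-2-t$ copies of $c$. **Theorem 4.3.** Let $r\ge 2$, $s=\lceil r/2\rceil$, $n\ge 2r+2$ and $M=n-2r-2$. Put $q_-=\max\{1,\lfloor M/s\rfloor\}$ and $q_+=\lceil M/s\rceil$ and, for $M\ge 1$, write $M=q_\pm c_\pm+t_\pm$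 with $0\le t_\pm<q_\pm$. Let $I_r=\left(\frac1{r+1},\frac1r\right)$. 1. If $M=0$, then the unique extremizer is the path $P_{2r+2}$ on $2r+2$ vertices. 2. If $1\le M<s$, then $q_-=q_+=1$, and the unique extremizer is $\mathrm{AS}(r,3,M,0)=S(r+1,r,M)$. 3. If $M\ge 1$ and $s\mid M$, then $q_-=q_+=M/s$, and the unique extremizer is $\mathrm{AS}(r,\frac Ms+2,s,0)$. 4. Suppose $M=ks+t$ with $1\le t\le s-1$ and $k\ge s$. Put $A_{k,t}=\mathrm{AS}(r,k+2,s,t)$ and $B_{k,t}=\mathrm{AS}(r,k+3,s-1,k+t-s+1)$. Every extremizer is $A_{k,t}$ or $B_{k,t}$. More precisely: - (a) if $r=2s$ and $2t\le s-1$, the unique extremizer is $A_{k,t}$; - (b) if $r=2s-1$ and $2t\ge s-1$, the unique extremizer is $B_{k,t}$; - (c) in the remaining cases ($r=2s$ and $2t\ge s$, or $r=2s-1$ and $2t\le s-2$) the polynomial $P_{s,t}(\lambda)=1-3s\lambda+(2s^2+s-2t-1)\lambda^2$ has a unique root $\zeta=\zeta_{s,t}$ in $I_r$. With $$\kappa_{r,t}=-(1-s\zeta)\left(\frac1{1-(r+1)\zeta}+\frac1{1-r\zeta}+\frac{t-s+1}{1-s\zeta}+\frac{s-t}{1-(s-1)\zeta}\right),$$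 the unique extremizer is $A_{k,t}$ if $k>\kappa_{r,t}$, the unique extremizer is $B_{k,t}$ if $k<\kappa_{r,t}$, and both are extremizers if $k=\kappa_{r,t}$. 5. Suppose $M=ks+t$ with $1\le k\le s-1$ and $1\le t\le s-1$. Every extremizer is $T_-=\mathrm{AS}(r,q_-+2,c_-,t_-)$ or $T_+=\mathrm{AS}(r,q_++2,c_+,t_+)$. For each sign, $\lambda_2(T_\pm)$ is the unique root in $I_r$ of $$\frac1{1-(r+1)\lambda}+\frac1{1-r\lambda}+\frac{t_\pm}{1-(c_\pm+1)\lambda}+\frac{q_\pm-t_\pm}{1-c_\pm\lambda}=0.$$ The tree with the larger root is the unique extremizer; if the two roots are equal, both trees are extremizers. For fixed $r$, only finitely many orders $n$ fall into this case. -/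

import Mathlib

namespace SteklovTree

section Steklov

variable {V : Type*} [Fintype V]

/-- A leaf is a vertex of degree one; the leaves form the boundary. -/
def IsLeaf (G : SimpleGraph V) (v : V) : Prop :=
  (G.neighborSet v).ncard = 1

open scoped Classical in
/-- The combinatorial Laplacian `Δ f (v) = ∑_{w ∼ v} (f v - f w)`. -/
noncomputable def laplacian (G : SimpleGraph V) (f : V → ℝ) (v : V) : ℝ :=
  ∑ w : V, if G.Adj v w then f v - f w else 0

/-- `μ ≥ 0` is a Steklov eigenvalue of `G` with leaf boundary: some nonzero `f` is harmonic off the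
leaves and satisfies `f ω - f ω' = μ f ω` at each leaf `ω`, where `ω'` is its neighbour. -/
def IsSteklovEigenvalue (G : SimpleGraph V) (μ : ℝ) : Prop :=
  0 ≤ μ ∧ ∃ f : V → ℝ, f ≠ 0 ∧
    (∀ v, ¬ IsLeaf G v → laplacian G f v = 0) ∧
    (∀ ω ω', IsLeaf G ω → G.Adj ω ω' → f ω - f ω' = μ * f ω)

/-- The first nonzero Steklov eigenvalue. For a finite tree with at least two vertices the set below
is finite and nonempty, so that the infimum is its least element. -/
noncomputable def lambda2 (G : SimpleGraph V) : ℝ :=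
  sInf {μ : ℝ | μ ≠ 0 ∧ IsSteklovEigenvalue G μ}

/-- `G` is a tree of order `n` and diameter `D`. -/
def IsAdmissible (n D : ℕ) (G : SimpleGraph V) : Prop :=
  G.IsTree ∧ Fintype.card V = n ∧ G.diam = D

/-- `G` maximizes `lambda2` among the trees of order `n` and diameter `D`. Up to isomorphism every
graph of order `n` has vertex set `Fin n`, so the competitors are taken there. -/
def IsExtremizer (n D : ℕ) (G : SimpleGraph V) : Prop :=
  IsAdmissible n D G ∧
    ∀ H : SimpleGraph (Fin n), IsAdmissible n D H → lambda2 H ≤ lambda2 G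

/-- `S` is an extremizer, and it is the only one up to isomorphism. -/
def IsUniqueExtremizer (n D : ℕ) (S : SimpleGraph V) : Prop :=
  IsExtremizer n D S ∧
    ∀ G : SimpleGraph (Fin n), IsExtremizer n D G → Nonempty (G ≃g S)

end Steklov

/-- Every extremizer is isomorphic to `A` or to `B`. -/
def OnlyCandidates {V W : Type*} (n D : ℕ) (A : SimpleGraph V) (B : SimpleGraph W) : Prop :=
  ∀ G : SimpleGraph (Fin n), IsExtremizer n D G → Nonempty (G ≃g A) ∨ Nonempty (G ≃g B)

/-- The spider with branch lengths `ℓ i`: the center is `none`, and `some ⟨i, j⟩` is the vertex of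
the `i`-th branch at distance `j + 1` from the center. -/
def spider {ι : Type*} (ℓ : ι → ℕ) : SimpleGraph (Option (Σ i, Fin (ℓ i))) :=
  SimpleGraph.fromRel fun x y =>
    match x, y with
    | none, some v => (v.2 : ℕ) = 0
    | some v, some w => v.1 = w.1 ∧ (v.2 : ℕ) + 1 = (w.2 : ℕ)
    | _, none => False

/-- Branch lengths of the generalized almost seesaw tree: `r + 1`, `r`, then `t` copies of `c + 1`
and `b - 2 - t` copies of `c`. -/
def asLengths (r b c t : ℕ) (i : Fin b) : ℕ :=
  if (i : ℕ) = 0 then r + 1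
  else if (i : ℕ) = 1 then r
  else if (i : ℕ) < t + 2 then c + 1
  else c

/-- The generalized almost seesaw tree `AS(r, b, c, t)` (used for `2 ≤ b`, `1 ≤ c`, `t ≤ b - 2`). -/
abbrev almostSeesaw (r b c t : ℕ) :
    SimpleGraph (Option (Σ i : Fin b, Fin (asLengths r b c t i))) :=
  spider (asLengths r b c t)

/-- `q₋ = max {1, ⌊M / s⌋}`. -/
def qMinus (s M : ℕ) : ℕ := max 1 (M / s)

/-- `q₊ = ⌈M / s⌉`. -/
def qPlus (s M : ℕ) : ℕ := ⌈(M : ℚ) / (s : ℚ)⌉₊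

/-- The candidate `AS(r, q + 2, c, t)` with `q` lateral branches of total length `M`, where
`M = q c + t` and `0 ≤ t < q`. -/
abbrev candidate (r M q : ℕ) :
    SimpleGraph (Option (Σ i : Fin (q + 2), Fin (asLengths r (q + 2) (M / q) (M % q) i))) :=
  almostSeesaw r (q + 2) (M / q) (M % q)

/-- The left-hand side of the root equation of `AS(r, q + 2, c, t)`. -/
noncomputable def rootFunction (r q c t : ℕ) (x : ℝ) : ℝ :=
  1 / (1 - ((r : ℝ) + 1) * x) + 1 / (1 - (r : ℝ) * x)
    + (t : ℝ) / (1 - ((c : ℝ) + 1) * x) + ((q : ℝ) - (t : ℝ)) / (1 - (c : ℝ) * x)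

/-- The interval `I_r = (1 / (r + 1), 1 / r)`. -/
def rootInterval (r : ℕ) : Set ℝ := Set.Ioo (1 / ((r : ℝ) + 1)) (1 / (r : ℝ))

/-- `x` is the unique zero of `F` in `I`. -/
def IsUniqueRoot (F : ℝ → ℝ) (I : Set ℝ) (x : ℝ) : Prop :=
  x ∈ I ∧ F x = 0 ∧ ∀ y ∈ I, F y = 0 → y = x

/-- `P_{s,t}(x) = 1 - 3 s x + (2 s² + s - 2 t - 1) x²`. -/
def thresholdPoly (s t : ℕ) (x : ℝ) : ℝ :=
  1 - 3 * (s : ℝ) * x + (2 * (s : ℝ) ^ 2 + (s : ℝ) - 2 * (t : ℝ) - 1) * x ^ 2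

/-- The threshold `κ_{r,t}`, as a function of the root `z` of `P_{s,t}` in `I_r`. -/
noncomputable def kappa (r s t : ℕ) (z : ℝ) : ℝ :=
  -(1 - (s : ℝ) * z) *
    (1 / (1 - ((r : ℝ) + 1) * z) + 1 / (1 - (r : ℝ) * z)
      + ((t : ℝ) - (s : ℝ) + 1) / (1 - (s : ℝ) * z)
      + ((s : ℝ) - (t : ℝ)) / (1 - ((s : ℝ) - 1) * z))

/-- `A_{k,t} = AS(r, k + 2, s, t)`. -/
abbrev treeA (r s k t : ℕ) := almostSeesaw r (k + 2) s t

/-- `B_{k,t} = AS(r, k + 3, s - 1, k + t - s + 1)` (used for `1 ≤ s ≤ k`). -/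
abbrev treeB (r s k t : ℕ) := almostSeesaw r (k + 3) (s - 1) (k + t + 1 - s)

end SteklovTree

open SteklovTree

/-!
Every charge `q` on the leaves of total charge zero bounds `lambda2` from above by
`‖q‖² / ‖flow of q‖²`. A tree of diameter `2 r + 1` has a central edge. For `x ∈ I_r` we send one
unit of flow through it, split on either side among the leaves in proportion to their responses
`1 / (1 - ℓ x)`, where `ℓ` is the distance to the central edge. If the responses of all leaves other
than the two ends of a diametral path sum to at least `-(1 / (1 - (r + 1) x) + 1 / (1 - r x))`, then
this bound is at most `x`, and `lambda2 = x` forces the tree to be a spider. For the spiders in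
question the sum of all leg responses vanishes exactly at `x = lambda2`, so at this `x` the lateral
branch lengths `ℓ` of an extremizer minimize the sum of `1 / (1 - ℓ x)` for given total length.
Convexity makes these lengths balanced, and since `1 / x` lies strictly between `r` and `r + 1`,
comparison with the chord between two consecutive lengths leaves at most two numbers of branches.
-/

namespace SteklovTree

open scoped Classical

section Rooted

variable {V : Type*} {G : SimpleGraph V} {o : V} {p : V → V} {d : V → ℕ}

/-- `G` is a tree rooted at `o` with parent function `p` and depth function `d`; the root is its own
parent. -/
structure IsRooted (G : SimpleGraph V) (o : V) (p : V → V) (d : V → ℕ) : Prop where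
  adj_iff : ∀ x y, G.Adj x y ↔ (x ≠ o ∧ p x = y) ∨ (y ≠ o ∧ p y = x)
  parent_root : p o = o
  depth_root : d o = 0
  depth_parent : ∀ x, x ≠ o → d x = d (p x) + 1

/-- `x` is an ancestor of `z` for the parent function `p`; every vertex is its own ancestor. -/
def IsAncestor (p : V → V) (x z : V) : Prop := ∃ j, p^[j] z = x

theorem IsAncestor.refl (p : V → V) (x : V) : IsAncestor p x x := ⟨0, rfl⟩

theorem IsAncestor.trans {x y z : V} (hxy : IsAncestor p x y) (hyz : IsAncestor p y z) :
    IsAncestor p x z := by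
  obtain ⟨i, rfl⟩ := hxy
  obtain ⟨j, rfl⟩ := hyz
  exact ⟨i + j, Function.iterate_add_apply p i j z⟩

theorem isAncestor_parent (p : V → V) (z : V) : IsAncestor p (p z) z := ⟨1, rfl⟩

theorem isAncestor_iff_eq_or_isAncestor_parent {x z : V} :
    IsAncestor p x z ↔ x = z ∨ IsAncestor p x (p z) := by
  constructor
  · rintro ⟨_ | j, rfl⟩
    · exact Or.inl rfl
    · exact Or.inr ⟨j, (Function.iterate_succ_apply p j z).symm⟩
  · rintro (rfl | hx)
    · exact .refl p x
    · exact hx.trans (isAncestor_parent p z)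

namespace IsRooted

theorem depth_eq_zero (h : IsRooted G o p d) {x : V} : d x = 0 ↔ x = o := by
  refine ⟨fun hx => ?_, fun hx => hx ▸ h.depth_root⟩
  by_contra hne
  have := h.depth_parent x hne
  omega

theorem ne_root_of_depth_pos (h : IsRooted G o p d) {x : V} (hx : 0 < d x) : x ≠ o :=
  fun hxo => hx.ne' (h.depth_eq_zero.2 hxo)

theorem adj_parent (h : IsRooted G o p d) {x : V} (hx : x ≠ o) : G.Adj x (p x) :=
  (h.adj_iff x (p x)).2 (Or.inl ⟨hx, rfl⟩)

theorem depth_iterate (h : IsRooted G o p d) (j : ℕ) (z : V) : d (p^[j] z) = d z - j := by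
  induction j generalizing z with
  | zero => rfl
  | succ j ih =>
    rw [Function.iterate_succ_apply, ih]
    by_cases hz : z = o
    · simp [hz, h.parent_root, h.depth_root]
    · have := h.depth_parent z hz
      omega

theorem isAncestor_root (h : IsRooted G o p d) (z : V) : IsAncestor p o z :=
  ⟨d z, h.depth_eq_zero.1 (by rw [h.depth_iterate, Nat.sub_self])⟩

theorem isAncestor_iff (h : IsRooted G o p d) {x z : V} :
    IsAncestor p x z ↔ d x ≤ d z ∧ p^[d z - d x] z = x := by
  refine ⟨?_, fun hx => ⟨_, hx.2⟩⟩
  rintro ⟨j, rfl⟩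
  have hd := h.depth_iterate j z
  refine ⟨by omega, ?_⟩
  by_cases hj : j ≤ d z
  · rw [hd, Nat.sub_sub_self hj]
  · have hroot : p^[j] z = o := h.depth_eq_zero.1 (by omega)
    rw [hroot, h.depth_root]
    exact h.depth_eq_zero.1 (by rw [h.depth_iterate]; omega)

theorem depth_le_of_isAncestor (h : IsRooted G o p d) {x z : V} (hx : IsAncestor p x z) :
    d x ≤ d z :=
  (h.isAncestor_iff.1 hx).1

theorem eq_of_isAncestor_of_depth_eq (h : IsRooted G o p d) {x y z : V} (hx : IsAncestor p x z)
    (hy : IsAncestor p y z) (hd : d x = d y) : x = y := by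
  rw [← (h.isAncestor_iff.1 hx).2, ← (h.isAncestor_iff.1 hy).2, hd]

theorem isAncestor_of_depth_le (h : IsRooted G o p d) {x y z : V} (hx : IsAncestor p x z)
    (hy : IsAncestor p y z) (hd : d x ≤ d y) : IsAncestor p x y := by
  obtain ⟨hyz, hzy⟩ := h.isAncestor_iff.1 hy
  refine ⟨d y - d x, ?_⟩
  calc p^[d y - d x] y = p^[d y - d x + (d z - d y)] z := by
        rw [Function.iterate_add_apply, hzy]
    _ = p^[d z - d x] z := by congr 1; omega
    _ = x := (h.isAncestor_iff.1 hx).2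

theorem not_isAncestor_parent (h : IsRooted G o p d) {z : V} (hz : z ≠ o) :
    ¬ IsAncestor p z (p z) := fun hb => by
  have := h.depth_le_of_isAncestor hb
  have := h.depth_parent z hz
  omega

theorem not_isAncestor_of_ne_root (h : IsRooted G o p d) {x : V} (hx : x ≠ o) :
    ¬ IsAncestor p x o := fun hb => by
  have := h.depth_le_of_isAncestor hb
  rw [h.depth_root] at this
  exact hx (h.depth_eq_zero.1 (by omega))

theorem exists_child (h : IsRooted G o p d) {x z : V} (hb : IsAncestor p x z) (hne : z ≠ x) :
    ∃ c, c ≠ o ∧ p c = x ∧ IsAncestor p c z := by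
  obtain ⟨hd, hx⟩ := h.isAncestor_iff.1 hb
  obtain ⟨k, hk⟩ : ∃ k, d z - d x = k + 1 := Nat.exists_eq_succ_of_ne_zero fun h0 =>
    hne (by rw [h0] at hx; exact hx)
  refine ⟨p^[k] z, h.ne_root_of_depth_pos ?_, ?_, k, rfl⟩
  · rw [h.depth_iterate]
    omega
  · rw [← Function.iterate_succ_apply' p k z, Nat.succ_eq_add_one, ← hk, hx]

theorem connected (h : IsRooted G o p d) : G.Connected := by
  have reachable_root (x : V) : G.Reachable x o := by
    induction hn : d x generalizing x with
    | zero => rw [h.depth_eq_zero.1 hn]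
    | succ n ih =>
      have hx : x ≠ o := h.ne_root_of_depth_pos (by omega)
      have := h.depth_parent x hx
      exact (h.adj_parent hx).reachable.trans (ih (p x) (by omega))
  exact { preconnected := fun x y => (reachable_root x).trans (reachable_root y).symm
          nonempty := ⟨o⟩ }

theorem parent_edge_injective (h : IsRooted G o p d) {x y : V} (hx : x ≠ o) (hy : y ≠ o)
    (he : s(x, p x) = s(y, p y)) : x = y := by
  rcases Sym2.eq_iff.1 he with ⟨hxy, -⟩ | ⟨hxy, hyx⟩
  · exact hxy
  · have hdx := h.depth_parent x hx
    have hdy := h.depth_parent y hy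
    rw [hyx] at hdx
    rw [← hxy] at hdy
    omega

theorem isTree [Finite V] (h : IsRooted G o p d) : G.IsTree := by
  refine SimpleGraph.isTree_iff_connected_and_card.2 ⟨h.connected, ?_⟩
  have hbij : Function.Bijective
      (fun x : {x // x ≠ o} => (⟨s(x.1, p x.1), h.adj_parent x.2⟩ : G.edgeSet)) := by
    refine ⟨fun x y hxy => Subtype.ext (h.parent_edge_injective x.2 y.2 (congrArg Subtype.val hxy)),
      ?_⟩
    rintro ⟨⟨x, y⟩, he⟩
    rcases (h.adj_iff x y).1 he with ⟨hx, rfl⟩ | ⟨hy, rfl⟩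
    · exact ⟨⟨x, hx⟩, rfl⟩
    · exact ⟨⟨y, hy⟩, Subtype.ext Sym2.eq_swap⟩
  have := Fintype.ofFinite V
  rw [← Nat.card_congr (Equiv.ofBijective _ hbij), Nat.card_eq_fintype_card,
    Nat.card_eq_fintype_card, Fintype.card_subtype_compl, Fintype.card_subtype_eq]
  have : 0 < Fintype.card V := Fintype.card_pos_iff.2 ⟨o⟩
  omega

theorem isLeaf_iff (h : IsRooted G o p d) {x : V} (hx : x ≠ o) :
    IsLeaf G x ↔ ∀ c, c ≠ o → p c ≠ x := by
  have hN : G.neighborSet x = insert (p x) {c | c ≠ o ∧ p c = x} := by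
    ext y
    simp only [SimpleGraph.mem_neighborSet, h.adj_iff, Set.mem_insert_iff, Set.mem_ofPred_eq, hx,
      ne_eq, not_false_eq_true, true_and, eq_comm]
  rw [IsLeaf, hN, Set.ncard_eq_one]
  constructor
  · rintro ⟨a, ha⟩ c hc hcx
    have hpx : p x ∈ ({a} : Set V) := ha ▸ Set.mem_insert _ _
    have hca : c ∈ ({a} : Set V) := ha ▸ Set.mem_insert_of_mem _ ⟨hc, hcx⟩
    have hdx := h.depth_parent x hx
    have hdc := h.depth_parent c hc
    rw [hcx, show c = p x by rw [hpx, hca]] at hdc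
    omega
  · intro hc
    have hempty : {c | c ≠ o ∧ p c = x} = ∅ := Set.eq_empty_of_forall_notMem fun c hcx =>
      hc c hcx.1 hcx.2
    exact ⟨p x, by rw [hempty, insert_empty_eq]⟩

theorem exists_isLeaf_of_ne_root [Finite V] (h : IsRooted G o p d) {x : V} (hx : x ≠ o) :
    ∃ z, z ≠ o ∧ IsLeaf G z ∧ IsAncestor p x z := by
  obtain ⟨z, hz, hmax⟩ := Set.exists_max_image {z | IsAncestor p x z} d (Set.toFinite _)
    ⟨x, .refl p x⟩
  have hzo : z ≠ o := by
    rintro rfl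
    exact h.not_isAncestor_of_ne_root hx hz
  refine ⟨z, hzo, (h.isLeaf_iff hzo).2 ?_, hz⟩
  rintro c hc rfl
  have hle := hmax c (IsAncestor.trans hz (isAncestor_parent p c))
  have hdc := h.depth_parent c hc
  omega

theorem dist_root (h : IsRooted G o p d) (x : V) : G.dist o x = d x := by
  refine le_antisymm ?_ ?_
  · induction hn : d x generalizing x with
    | zero => rw [h.depth_eq_zero.1 hn, SimpleGraph.dist_self]
    | succ n ih =>
      have hx : x ≠ o := h.ne_root_of_depth_pos (by omega)
      have hdx := h.depth_parent x hx
      have hstep : G.dist (p x) x = 1 :=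
        SimpleGraph.dist_eq_one_iff_adj.2 (h.adj_parent hx).symm
      have hpar := ih (p x) (by omega)
      have htri := h.connected.dist_triangle (u := o) (v := p x) (w := x)
      omega
  · have depth_le {a b : V} (w : G.Walk a b) : d b ≤ d a + w.length := by
      induction w with
      | nil => simp
      | cons hadj w ih =>
        rw [SimpleGraph.Walk.length_cons]
        rcases (h.adj_iff _ _).1 hadj with ⟨ha, rfl⟩ | ⟨hc, rfl⟩
        · have := h.depth_parent _ ha; omega
        · have := h.depth_parent _ hc; omega
    obtain ⟨w, hw⟩ := h.connected.exists_walk_length_eq_dist o x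
    simpa [h.depth_root, hw] using depth_le w

end IsRooted

theorem eq_of_adj_of_dist_eq_add_one (hG : G.IsTree) {x y z : V} (hy : G.Adj y x) (hz : G.Adj z x)
    (hdy : G.dist o x = G.dist o y + 1) (hdz : G.dist o x = G.dist o z + 1) : y = z := by
  obtain ⟨v, hv⟩ := hG.connected.exists_walk_length_eq_dist o y
  obtain ⟨w, hw⟩ := hG.connected.exists_walk_length_eq_dist o z
  have hpv : (v.concat hy).IsPath := SimpleGraph.Walk.isPath_of_length_eq_dist _ (by
    rw [SimpleGraph.Walk.length_concat, hv, hdy])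
  have hpw : (w.concat hz).IsPath := SimpleGraph.Walk.isPath_of_length_eq_dist _ (by
    rw [SimpleGraph.Walk.length_concat, hw, hdz])
  have hvw : v.concat hy = w.concat hz := congrArg Subtype.val
    ((hG.isAcyclic.subsingleton_path o x).elim ⟨_, hpv⟩ ⟨_, hpw⟩)
  rw [← SimpleGraph.Walk.penultimate_concat v hy, ← SimpleGraph.Walk.penultimate_concat w hz, hvw]

theorem exists_isRooted (hG : G.IsTree) (o : V) : ∃ p : V → V, IsRooted G o p (G.dist o) := by
  have closer (x : V) (hx : x ≠ o) : ∃ y, G.Adj y x ∧ G.dist o x = G.dist o y + 1 := by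
    obtain ⟨w, hw⟩ := hG.connected.exists_walk_length_eq_dist x o
    cases w with
    | nil => exact absurd rfl hx
    | @cons _ y _ hadj w =>
      refine ⟨y, hadj.symm, (hG.dist_eq_dist_add_one_of_adj o hadj).resolve_right fun hlt => ?_⟩
      have := SimpleGraph.dist_le w
      simp only [SimpleGraph.Walk.length_cons, SimpleGraph.dist_comm (v := o)] at hw this
      omega
  choose! p hp hdist using closer
  refine ⟨Function.update p o o, ⟨fun x y => ⟨fun hadj => ?_, ?_⟩, Function.update_self _ _ _,
    SimpleGraph.dist_self, fun x hx => by rw [Function.update_of_ne hx, hdist x hx]⟩⟩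
  · rcases hG.dist_eq_dist_add_one_of_adj o hadj with hd | hd
    · have hx : x ≠ o := by rintro rfl; rw [SimpleGraph.dist_self] at hd; omega
      exact Or.inl ⟨hx, by rw [Function.update_of_ne hx,
        eq_of_adj_of_dist_eq_add_one hG (hp x hx) hadj.symm (hdist x hx) hd]⟩
    · have hy : y ≠ o := by rintro rfl; rw [SimpleGraph.dist_self] at hd; omega
      exact Or.inr ⟨hy, by rw [Function.update_of_ne hy,
        eq_of_adj_of_dist_eq_add_one hG (hp y hy) hadj (hdist y hy) hd]⟩
  · rintro (⟨hx, rfl⟩ | ⟨hy, rfl⟩)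
    · exact Function.update_of_ne hx o p ▸ (hp x hx).symm
    · exact Function.update_of_ne hy o p ▸ hp y hy

end Rooted

section Flow

variable {V : Type*} [Fintype V] {G : SimpleGraph V} {o : V} {p : V → V} {d : V → ℕ}

/-- The current through the edge from `x` to its parent when every vertex `z` injects the charge
`q z` and the root absorbs the total: the charge carried by the descendants of `x`. -/
noncomputable def flow (p : V → V) (q : V → ℝ) (x : V) : ℝ := ∑ z with IsAncestor p x z, q z

/-- The potential whose drop from `x` to its parent is `θ x`, for every vertex `x` other than the
root. -/
noncomputable def potential (p : V → V) (θ : V → ℝ) (z : V) : ℝ := ∑ x with IsAncestor p x z, θ x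

theorem sum_potential_mul (p : V → V) (θ q : V → ℝ) :
    ∑ z, potential p θ z * q z = ∑ x, θ x * flow p q x := by
  simp only [potential, flow, Finset.sum_mul, Finset.mul_sum, Finset.sum_filter, ite_mul,
    zero_mul, mul_ite, mul_zero]
  rw [Finset.sum_comm]

theorem laplacian_eq_sub_of_isLeaf (f : V → ℝ) {ω ω' : V} (hω : IsLeaf G ω) (hadj : G.Adj ω ω') :
    laplacian G f ω = f ω - f ω' := by
  obtain ⟨a, ha⟩ := Set.ncard_eq_one.1 hω
  have adj_iff (w : V) : G.Adj ω w ↔ w = a := Set.ext_iff.1 ha w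
  obtain rfl := (adj_iff ω').1 hadj
  simp only [laplacian, adj_iff, Finset.sum_ite_eq', Finset.mem_univ, if_true]

theorem isSteklovEigenvalue_of_laplacian_eq {f q : V → ℝ} {Λ c : ℝ} (hΛ : 0 < Λ) (hq : q ≠ 0)
    (hqleaf : ∀ z, ¬ IsLeaf G z → q z = 0) (hf : ∀ z, laplacian G f z = q z)
    (hfleaf : ∀ ω, IsLeaf G ω → f ω - c = Λ * q ω) : IsSteklovEigenvalue G (1 / Λ) := by
  have hshift (z : V) : laplacian G (fun z => f z - c) z = q z := by
    simp only [← hf, laplacian, sub_sub_sub_cancel_right]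
  refine ⟨by positivity, fun z => f z - c, fun hzero => hq ?_, fun z hz => ?_, ?_⟩
  · ext z
    rw [← hshift, hzero]
    simp only [laplacian, Pi.zero_apply, sub_self, ite_self, Finset.sum_const_zero]
  · rw [hshift, hqleaf z hz]
  · intro ω ω' hω hadj
    rw [← laplacian_eq_sub_of_isLeaf (fun z => f z - c) hω hadj, hshift]
    simp only [hfleaf ω hω]
    field_simp

namespace IsRooted

theorem potential_eq_add_parent (h : IsRooted G o p d) (θ : V → ℝ) {z : V} (hz : z ≠ o) :
    potential p θ z = θ z + potential p θ (p z) := by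
  have hset : ({x | IsAncestor p x z} : Finset V)
      = insert z ({x | IsAncestor p x (p z)} : Finset V) := by
    ext x
    simp only [Finset.mem_filter_univ, Finset.mem_insert, isAncestor_iff_eq_or_isAncestor_parent
      (z := z)]
  rw [potential, hset, Finset.sum_insert]
  · rfl
  · simpa only [Finset.mem_filter_univ] using h.not_isAncestor_parent hz

theorem potential_root (h : IsRooted G o p d) (θ : V → ℝ) : potential p θ o = θ o := by
  have hset : ({x | IsAncestor p x o} : Finset V) = {o} := by
    ext x
    simp only [Finset.mem_filter_univ, Finset.mem_singleton]
    refine ⟨fun hx => by_contra fun hxo => h.not_isAncestor_of_ne_root hxo hx, ?_⟩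
    rintro rfl
    exact .refl p x
  rw [potential, hset, Finset.sum_singleton]

theorem flow_root (h : IsRooted G o p d) (q : V → ℝ) : flow p q o = ∑ z, q z := by
  simp only [flow, h.isAncestor_root, Finset.filter_true]

theorem flow_eq_add_children (h : IsRooted G o p d) (q : V → ℝ) (x : V) :
    flow p q x = q x + ∑ c with c ≠ o ∧ p c = x, flow p q c := by
  have hset : ({z | IsAncestor p x z} : Finset V) = insert x
      (({c | c ≠ o ∧ p c = x} : Finset V).biUnion fun c => {z | IsAncestor p c z}) := by
    ext z
    simp only [Finset.mem_filter_univ, Finset.mem_insert, Finset.mem_biUnion]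
    constructor
    · refine fun hz => or_iff_not_imp_left.2 fun hzx => ?_
      obtain ⟨c, hc, hcx, hcz⟩ := h.exists_child hz hzx
      exact ⟨c, ⟨hc, hcx⟩, hcz⟩
    · rintro (rfl | ⟨c, ⟨-, rfl⟩, hcz⟩)
      · exact .refl p z
      · exact (isAncestor_parent p c).trans hcz
  rw [flow, hset, Finset.sum_insert, Finset.sum_biUnion]
  · rfl
  · intro c hc c' hc' hne
    simp only [Finset.coe_filter_univ, Set.mem_ofPred_eq] at hc hc'
    refine Finset.disjoint_left.2 fun z hz hz' => hne ?_
    simp only [Finset.mem_filter_univ] at hz hz'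
    refine h.eq_of_isAncestor_of_depth_eq hz hz' ?_
    have hdepth := h.depth_parent c hc.1
    rw [hdepth, h.depth_parent c' hc'.1, hc.2, hc'.2]
  · simp only [Finset.mem_biUnion, Finset.mem_filter_univ, not_exists, not_and]
    rintro c ⟨hc, rfl⟩
    exact h.not_isAncestor_parent hc

theorem laplacian_eq (h : IsRooted G o p d) (f : V → ℝ) (x : V) :
    laplacian G f x = (f x - f (p x)) - ∑ c with c ≠ o ∧ p c = x, (f c - f (p c)) := by
  have hparent : f x - f (p x) = ∑ w, if w = p x then f x - f w else 0 := by
    rw [Finset.sum_ite_eq' Finset.univ, if_pos (Finset.mem_univ _)]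
  rw [laplacian, hparent, Finset.sum_filter, ← Finset.sum_sub_distrib]
  refine Finset.sum_congr rfl fun w _ => ?_
  by_cases hc : w ≠ o ∧ p w = x
  · have hwx : w ≠ p x := by
      rintro rfl
      have hx : x ≠ o := fun hxo => hc.1 (by rw [hxo, h.parent_root])
      have := h.depth_parent x hx
      have := h.depth_parent _ hc.1
      rw [hc.2] at this
      omega
    rw [if_pos ((h.adj_iff x w).2 (Or.inr hc)), if_neg hwx, if_pos hc, hc.2]
    ring
  · rw [if_neg hc, sub_zero]
    by_cases hx : x = o
    · have hnadj : ¬ G.Adj x w := fun hadj =>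
        ((h.adj_iff x w).1 hadj).elim (fun hxw => hxw.1 hx) hc
      rw [if_neg hnadj]
      split_ifs with hw
      · rw [hw, hx, h.parent_root, sub_self]
      · rfl
    · have hadj : G.Adj x w ↔ w = p x := by
        rw [h.adj_iff, or_iff_left hc, and_iff_right hx, eq_comm]
      simp only [hadj]

theorem laplacian_potential_flow (h : IsRooted G o p d) {q : V → ℝ} (hq : ∑ z, q z = 0) (x : V) :
    laplacian G (potential p (flow p q)) x = q x := by
  have hchildren : ∑ c with c ≠ o ∧ p c = x,
      (potential p (flow p q) c - potential p (flow p q) (p c))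
        = ∑ c with c ≠ o ∧ p c = x, flow p q c := by
    refine Finset.sum_congr rfl fun c hc => ?_
    rw [h.potential_eq_add_parent _ (Finset.mem_filter_univ _ |>.1 hc).1, add_sub_cancel_right]
  have hdrop : potential p (flow p q) x - potential p (flow p q) (p x) = flow p q x := by
    by_cases hx : x = o
    · rw [hx, h.parent_root, sub_self, h.flow_root, hq]
    · rw [h.potential_eq_add_parent _ hx, add_sub_cancel_right]
  rw [h.laplacian_eq, hchildren, hdrop, h.flow_eq_add_children q x, add_sub_cancel_right]

end IsRooted

end Flow

section Thomson

theorem exists_max_singular_vector {W E : Type*} [NormedAddCommGroup W] [InnerProductSpace ℝ W]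
    [FiniteDimensional ℝ W] [Nontrivial W] [NormedAddCommGroup E] [InnerProductSpace ℝ E]
    [FiniteDimensional ℝ E] (Θ : W →ₗ[ℝ] E) :
    ∃ (Λ : ℝ) (w : W), w ≠ 0 ∧ (∀ w', ‖Θ w'‖ ^ 2 ≤ Λ * ‖w'‖ ^ 2) ∧
      ∀ w', inner ℝ (Θ w) (Θ w') = Λ * inner ℝ w w' := by
  let T : W →ₗ[ℝ] W := Θ.adjoint ∘ₗ Θ
  have inner_T (a b : W) : inner ℝ (T a) b = inner ℝ (Θ a) (Θ b) :=
    LinearMap.adjoint_inner_left Θ b (Θ a)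
  have hsymm : T.IsSymmetric := fun a b => by
    rw [inner_T, real_inner_comm (T b) a, inner_T, real_inner_comm]
  obtain ⟨w, hw⟩ := hsymm.hasEigenvalue_iSup_of_finiteDimensional.exists_hasEigenvector
  have hbdd : BddAbove (Set.range fun x : {x : W // x ≠ 0} =>
      RCLike.re (inner ℝ (T x) (x : W)) / ‖(x : W)‖ ^ 2) := by
    refine ⟨‖LinearMap.toContinuousLinearMap T‖, ?_⟩
    rintro _ ⟨x, rfl⟩
    exact (le_abs_self _).trans
      ((LinearMap.toContinuousLinearMap T).rayleighQuotient_le_norm (x : W))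
  refine ⟨⨆ x : {x : W // x ≠ 0}, RCLike.re (inner ℝ (T x) (x : W)) / ‖(x : W)‖ ^ 2, w, hw.2,
    fun w' => ?_, fun w' => ?_⟩
  · by_cases hw' : w' = 0
    · simp [hw']
    · rw [← div_le_iff₀ (by positivity)]
      simpa [inner_T] using le_ciSup hbdd ⟨w', hw'⟩
  · rw [← inner_T, hw.apply_eq_smul]
    exact real_inner_smul_left w w' _

variable {V : Type*} [Fintype V] {G : SimpleGraph V} {o : V} {p : V → V} {d : V → ℕ}

/-- The balanced leaf charges: charge distributions supported on the leaves of `G`, of total charge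
zero. -/
def leafCharges (G : SimpleGraph V) : Submodule ℝ (EuclideanSpace ℝ V) where
  carrier := {q | (∀ z, ¬ IsLeaf G z → q z = 0) ∧ ∑ z, q z = 0}
  add_mem' := by
    rintro a b ⟨ha, ha'⟩ ⟨hb, hb'⟩
    refine ⟨fun z hz => by rw [PiLp.add_apply, ha z hz, hb z hz, add_zero], ?_⟩
    simp only [PiLp.add_apply, Finset.sum_add_distrib, ha', hb', add_zero]
  zero_mem' := ⟨fun _ _ => rfl, Finset.sum_const_zero⟩
  smul_mem' := by
    rintro c a ⟨ha, ha'⟩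
    refine ⟨fun z hz => by rw [PiLp.smul_apply, ha z hz, smul_zero], ?_⟩
    simp only [PiLp.smul_apply, ← Finset.smul_sum, ha', smul_zero]

/-- The map sending a charge distribution to its flow, between Euclidean spaces. -/
noncomputable def flowMap (p : V → V) : EuclideanSpace ℝ V →ₗ[ℝ] EuclideanSpace ℝ V where
  toFun q := WithLp.toLp 2 (flow p q)
  map_add' a b := by ext x; simp only [flow, PiLp.add_apply, Finset.sum_add_distrib]
  map_smul' c a := by
    ext x
    simp only [flow, PiLp.smul_apply, Finset.smul_sum, RingHom.id_apply]

theorem exists_isLeaf_of_mem_leafCharges {q : EuclideanSpace ℝ V} (hq : q ∈ leafCharges G)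
    (hne : q ≠ 0) : ∃ ω, IsLeaf G ω := by
  by_contra! hnoleaf
  exact hne (by ext z; exact hq.1 z (hnoleaf z))

theorem eq_of_isLeaf_of_forall_mem_leafCharges {g : V → ℝ}
    (hg : ∀ q ∈ leafCharges G, ∑ z, g z * q z = 0) {a b : V} (ha : IsLeaf G a) (hb : IsLeaf G b) :
    g a = g b := by
  have hdipole : WithLp.toLp 2 (Pi.single a 1 - Pi.single b 1) ∈ leafCharges G := by
    refine ⟨fun z hz => ?_, ?_⟩
    · have hza : z ≠ a := by rintro rfl; exact hz ha
      have hzb : z ≠ b := by rintro rfl; exact hz hb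
      simp [hza, hzb]
    · simp
  have := hg _ hdipole
  simpa [mul_sub, Pi.single_apply, sub_eq_zero] using this

theorem lambda2_le_of_isSteklovEigenvalue {μ : ℝ} (hμ : IsSteklovEigenvalue G μ) (hμ0 : μ ≠ 0) :
    lambda2 G ≤ μ :=
  csInf_le ⟨0, fun _ hμ => hμ.2.1⟩ ⟨hμ0, hμ⟩

-- By duality, a balanced leaf charge of maximal flow energy relative to its norm is the boundary
-- Laplacian of a Steklov eigenfunction.
theorem IsRooted.lambda2_mul_sum_flow_sq_le (h : IsRooted G o p d) {q : V → ℝ}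
    (hqleaf : ∀ z, ¬ IsLeaf G z → q z = 0) (hqsum : ∑ z, q z = 0) :
    lambda2 G * ∑ x, flow p q x ^ 2 ≤ ∑ z, q z ^ 2 := by
  rcases (Finset.sum_nonneg fun x _ => sq_nonneg (flow p q x)).eq_or_lt with hflow | hflow
  · rw [← hflow, mul_zero]
    positivity
  let q₀ : leafCharges G := ⟨WithLp.toLp 2 q, hqleaf, hqsum⟩
  have hq₀ : ‖q₀‖ ^ 2 = ∑ z, q z ^ 2 := EuclideanSpace.real_norm_sq_eq _
  have hflow₀ : ‖flowMap p q₀‖ ^ 2 = ∑ x, flow p q x ^ 2 := EuclideanSpace.real_norm_sq_eq _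
  have : Nontrivial (leafCharges G) := ⟨q₀, 0, fun hzero => hflow.ne' (by
    rw [← hflow₀, hzero, ZeroMemClass.coe_zero, map_zero, norm_zero, sq, zero_mul])⟩
  obtain ⟨Λ, w, hw, hmax, hstat⟩ :=
    exists_max_singular_vector (flowMap p ∘ₗ (leafCharges G).subtype)
  have hle : ∑ x, flow p q x ^ 2 ≤ Λ * ∑ z, q z ^ 2 := by
    rw [← hflow₀, ← hq₀]
    exact hmax q₀
  have hΛ : 0 < Λ := pos_of_mul_pos_left (hflow.trans_le hle) (by positivity)
  have hpair (q' : EuclideanSpace ℝ V) (hq' : q' ∈ leafCharges G) :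
      ∑ z, (potential p (flow p w.1) z - Λ * w.1 z) * q' z = 0 := by
    have hinner : ∑ x, flow p w.1 x * flow p q' x = Λ * ∑ z, w.1 z * q' z := by
      simpa [PiLp.inner_apply, flowMap, mul_comm] using hstat ⟨q', hq'⟩
    simp only [sub_mul, Finset.sum_sub_distrib, sum_potential_mul, hinner, mul_assoc,
      ← Finset.mul_sum, sub_self]
  have hwne : w.1 ≠ 0 := fun hzero => hw (Subtype.ext hzero)
  obtain ⟨ω₀, hω₀⟩ := exists_isLeaf_of_mem_leafCharges w.2 hwne
  have heig : IsSteklovEigenvalue G (1 / Λ) := isSteklovEigenvalue_of_laplacian_eq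
    (c := potential p (flow p w.1) ω₀ - Λ * w.1 ω₀) hΛ
    (fun hzero => hwne (by ext z; exact congrFun hzero z)) w.2.1
    (h.laplacian_potential_flow w.2.2) fun ω hω => by
      rw [← eq_of_isLeaf_of_forall_mem_leafCharges hpair hω hω₀, sub_sub_cancel]
  calc lambda2 G * ∑ x, flow p q x ^ 2 ≤ 1 / Λ * ∑ x, flow p q x ^ 2 := by
        gcongr
        exact lambda2_le_of_isSteklovEigenvalue heig (by positivity)
    _ ≤ 1 / Λ * (Λ * ∑ z, q z ^ 2) := by gcongr
    _ = ∑ z, q z ^ 2 := by field_simp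

end Thomson

section Center

variable {V : Type*} {G : SimpleGraph V} {r : ℕ} {u v x₀ y₀ : V}

theorem sub_le_dist (hG : G.Connected) (f : V → ℤ) (hf : ∀ x y, G.Adj x y → f x - f y ≤ 1)
    (x y : V) : f x - f y ≤ G.dist x y := by
  obtain ⟨w, hw⟩ := hG.exists_walk_length_eq_dist x y
  rw [← hw]
  clear hw
  induction w with
  | nil => simp
  | cons hadj w ih =>
    have := hf _ _ hadj
    rw [SimpleGraph.Walk.length_cons]
    push_cast
    linarith

namespace IsRooted

variable {p : V → V} {d : V → ℕ}

theorem depth_add_dist_of_isAncestor (h : IsRooted G u p d) {x z : V} (hx : IsAncestor p x z) :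
    d x + G.dist x z = d z := by
  obtain ⟨hle, hj⟩ := h.isAncestor_iff.1 hx
  have dist_iterate_le (j : ℕ) : ∀ z, j ≤ d z → G.dist (p^[j] z) z ≤ j := by
    induction j with
    | zero => simp
    | succ j ih =>
      intro z hj
      have hz : z ≠ u := h.ne_root_of_depth_pos (by omega)
      have hdz := h.depth_parent z hz
      have hstep : G.dist (p z) z = 1 := SimpleGraph.dist_eq_one_iff_adj.2 (h.adj_parent hz).symm
      calc G.dist (p^[j] (p z)) z ≤ G.dist (p^[j] (p z)) (p z) + G.dist (p z) z :=
            h.connected.dist_triangle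
        _ ≤ j + 1 := by rw [hstep]; exact Nat.add_le_add_right (ih _ (by omega)) 1
  have hle' := dist_iterate_le (d z - d x) z (by omega)
  have htri := h.connected.dist_triangle (u := u) (v := x) (w := z)
  rw [h.dist_root, h.dist_root] at htri
  rw [hj] at hle'
  omega

theorem add_le_dist_of_separated (h : IsRooted G u p d) {z w : V} (hpv : p v = u)
    (hz : IsAncestor p v z) (hw : ¬ IsAncestor p v w) : d z + d w ≤ G.dist z w := by
  -- The depth, counted negatively outside the branch of `v`, changes by at most one along edges.
  let σ : V → ℤ := fun x => if IsAncestor p v x then d x else -d x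
  have hσ (x : V) (hx : x ≠ u) : |σ x - σ (p x)| ≤ 1 := by
    have hdx : (d x : ℤ) = d (p x) + 1 := by exact_mod_cast h.depth_parent x hx
    by_cases hvx : v = x
    · have h0 : d (p v) = 0 := by rw [hpv, h.depth_root]
      subst hvx
      simp [σ, IsAncestor.refl, h0, hdx]
    · have hiff : IsAncestor p v x ↔ IsAncestor p v (p x) := by
        rw [isAncestor_iff_eq_or_isAncestor_parent, or_iff_right hvx]
      simp only [σ, hiff, hdx]
      split_ifs <;> simp
  have hσadj (x y : V) (hxy : G.Adj x y) : σ x - σ y ≤ 1 := by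
    rcases (h.adj_iff x y).1 hxy with ⟨hx, rfl⟩ | ⟨hy, rfl⟩
    · exact (abs_le.1 (hσ x hx)).2
    · linarith [(abs_le.1 (hσ y hy)).1]
  have hzw := sub_le_dist h.connected σ hσadj z w
  simp only [σ, if_pos hz, if_neg hw, sub_neg_eq_add] at hzw
  exact_mod_cast hzw

theorem parent_of_adj (h : IsRooted G u p d) (huv : G.Adj u v) : v ≠ u ∧ p v = u := by
  rcases (h.adj_iff u v).1 huv with ⟨hu, -⟩ | hv
  · exact absurd rfl hu
  · exact hv

theorem isAncestor_iff_dist_lt_dist (h : IsRooted G u p (G.dist u)) (huv : G.Adj u v) {w : V} :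
    IsAncestor p v w ↔ G.dist v w < G.dist u w := by
  obtain ⟨-, hpv⟩ := h.parent_of_adj huv
  have hdist : G.dist u v = 1 := SimpleGraph.dist_eq_one_iff_adj.2 huv
  refine ⟨fun hw => ?_, fun hlt => ?_⟩
  · have := h.depth_add_dist_of_isAncestor hw
    omega
  · by_contra hw
    have := h.add_le_dist_of_separated hpv (.refl p v) hw
    omega

end IsRooted

theorem add_one_add_le_dist_of_dist_lt_dist (hG : G.IsTree) (huv : G.Adj u v) {z w : V}
    (hz : G.dist v z < G.dist u z) (hw : G.dist u w < G.dist v w) :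
    G.dist v z + 1 + G.dist u w ≤ G.dist z w := by
  obtain ⟨p, hp⟩ := exists_isRooted hG u
  have hsep := hp.add_le_dist_of_separated (hp.parent_of_adj huv).2
    ((hp.isAncestor_iff_dist_lt_dist huv).2 hz)
    (mt (hp.isAncestor_iff_dist_lt_dist huv).1 hw.not_gt)
  omega

/-- The edge `u v` is the center of the tree `G` of diameter `2 r + 1`, and `x₀`, `y₀` are the
ends of a diametral path, on the sides of `v` and `u` respectively. -/
structure IsCenterEdge (G : SimpleGraph V) (r : ℕ) (u v x₀ y₀ : V) : Prop where
  adj : G.Adj u v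
  dist_vx : G.dist v x₀ = r
  dist_ux : G.dist u x₀ = r + 1
  dist_uy : G.dist u y₀ = r
  dist_vy : G.dist v y₀ = r + 1
  le_of_v : ∀ w, G.dist v w < G.dist u w → G.dist v w ≤ r
  le_of_u : ∀ w, G.dist u w < G.dist v w → G.dist u w ≤ r

theorem IsCenterEdge.symm (h : IsCenterEdge G r u v x₀ y₀) : IsCenterEdge G r v u y₀ x₀ :=
  ⟨h.adj.symm, h.dist_uy, h.dist_vy, h.dist_vx, h.dist_ux, h.le_of_u, h.le_of_v⟩

theorem exists_isCenterEdge [Finite V] (hG : G.IsTree) (hd : G.diam = 2 * r + 1) :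
    ∃ u v x₀ y₀, IsCenterEdge G r u v x₀ y₀ := by
  have := hG.connected.nonempty
  obtain ⟨y₀, x₀, hxy⟩ := G.exists_dist_eq_diam
  have hle (a b : V) : G.dist a b ≤ 2 * r + 1 :=
    hd ▸ SimpleGraph.dist_le_diam (SimpleGraph.connected_iff_ediam_ne_top.1 hG.connected)
  obtain ⟨p, hp⟩ := exists_isRooted hG y₀
  let v := p^[r] x₀
  have hyv : G.dist y₀ v = r + 1 := by rw [hp.depth_iterate, hxy, hd]; omega
  have hv : v ≠ y₀ := hp.ne_root_of_depth_pos (by omega)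
  have hyu := hp.depth_parent v hv
  have hvx := hp.depth_add_dist_of_isAncestor (x := v) (z := x₀) ⟨r, rfl⟩
  have hux := hp.depth_add_dist_of_isAncestor (x := p v) (z := x₀)
    ((isAncestor_parent p v).trans ⟨r, rfl⟩)
  have huv : G.Adj (p v) v := (hp.adj_parent hv).symm
  have hyu' : G.dist (p v) y₀ = r := by rw [SimpleGraph.dist_comm]; omega
  have hyv' : G.dist v y₀ = r + 1 := by rw [SimpleGraph.dist_comm, hyv]
  refine ⟨p v, v, x₀, y₀, huv, by omega, by omega, hyu', hyv', fun w hw => ?_, fun w hw => ?_⟩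
  · have := add_one_add_le_dist_of_dist_lt_dist hG huv hw (by omega : G.dist (p v) y₀ < _)
    have := hle w y₀
    omega
  · have := add_one_add_le_dist_of_dist_lt_dist hG huv (by omega : G.dist v x₀ < _) hw
    have := hle x₀ w
    omega

end Center

section Response

variable {r ℓ : ℕ} {x : ℝ}

/-- The boundary value of the eigenfunction for `x` on the leaf of a leg of length `ℓ`, normalized
to take the value one at the inner end of the leg: the function is affine along the leg, and its
slope is `x` times the boundary value. -/
noncomputable def legResponse (x : ℝ) (ℓ : ℕ) : ℝ := 1 / (1 - ℓ * x)

theorem pos_of_mem (hx : x ∈ rootInterval r) : 0 < x :=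
  lt_trans (by positivity) hx.1

theorem one_le_of_mem (hx : x ∈ rootInterval r) : 1 ≤ r := by
  rw [Nat.one_le_iff_ne_zero]
  rintro rfl
  have := (pos_of_mem hx).trans hx.2
  simp at this

theorem one_sub_pos_of_mem (hx : x ∈ rootInterval r) (hℓ : ℓ ≤ r) : 0 < 1 - (ℓ : ℝ) * x := by
  have hr : (0 : ℝ) < r := by exact_mod_cast one_le_of_mem hx
  have hrx : x * r < 1 := (lt_div_iff₀ hr).1 hx.2
  have hℓ' : (ℓ : ℝ) ≤ r := by exact_mod_cast hℓ
  nlinarith [pos_of_mem hx]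

theorem legResponse_pos (hx : x ∈ rootInterval r) (hℓ : ℓ ≤ r) : 0 < legResponse x ℓ :=
  one_div_pos.2 (one_sub_pos_of_mem hx hℓ)

theorem one_sub_succ_neg (hx : x ∈ rootInterval r) : 1 - ((r : ℝ) + 1) * x < 0 := by
  have : 1 < x * ((r : ℝ) + 1) := (div_lt_iff₀ (by positivity)).1 hx.1
  linarith

theorem legResponse_succ_neg (hx : x ∈ rootInterval r) : legResponse x (r + 1) < 0 := by
  rw [legResponse, Nat.cast_add_one]
  exact one_div_neg.2 (one_sub_succ_neg hx)

theorem sum_sq_le_sq_sum_of_mul_nonneg {ι : Type*} {s : Finset ι} {a : ι → ℝ}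
    (ha : ∀ i ∈ s, ∀ j ∈ s, 0 ≤ a i * a j) : ∑ i ∈ s, a i ^ 2 ≤ (∑ i ∈ s, a i) ^ 2 := by
  rw [pow_two (∑ i ∈ s, a i), Finset.sum_mul_sum]
  refine Finset.sum_le_sum fun i hi => ?_
  rw [pow_two]
  exact Finset.single_le_sum (f := fun j => a i * a j) (ha i hi) hi

theorem sum_sq_lt_sq_sum_of_mul_nonneg {ι : Type*} {s : Finset ι} {a : ι → ℝ}
    (ha : ∀ i ∈ s, ∀ j ∈ s, 0 ≤ a i * a j) {i j : ι} (hi : i ∈ s) (hj : j ∈ s) (hij : i ≠ j)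
    (hpos : 0 < a i * a j) : ∑ k ∈ s, a k ^ 2 < (∑ k ∈ s, a k) ^ 2 := by
  rw [pow_two (∑ k ∈ s, a k), Finset.sum_mul_sum]
  refine Finset.sum_lt_sum (fun k hk => ?_) ⟨i, hi, ?_⟩
  · rw [pow_two]
    exact Finset.single_le_sum (f := fun l => a k * a l) (ha k hk) hk
  · rw [pow_two]
    exact Finset.single_lt_sum (f := fun l => a i * a l) hij.symm hi hj hpos
      fun k hk _ => ha i hi k hk

theorem one_div_add_one_div_le {g A B : ℝ} (hg : 0 < g) (hA : 0 ≤ A) (hB : 0 ≤ B) :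
    1 / (g + A) + 1 / (g + B) ≤ 1 / g + 1 / (g + A + B) := by
  rw [div_add_div _ _ (by positivity) (by positivity), div_add_div _ _ (by positivity)
    (by positivity), div_le_div_iff₀ (by positivity) (by positivity)]
  nlinarith [mul_nonneg (mul_nonneg hA hB) (by positivity : 0 ≤ 2 * g + A + B)]

theorem one_div_add_one_div_lt {g A B : ℝ} (hg : 0 < g) (hA : 0 < A) (hB : 0 < B) :
    1 / (g + A) + 1 / (g + B) < 1 / g + 1 / (g + A + B) := by
  rw [div_add_div _ _ (by positivity) (by positivity), div_add_div _ _ (by positivity)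
    (by positivity), div_lt_div_iff₀ (by positivity) (by positivity)]
  nlinarith [mul_pos (mul_pos hA hB) (by positivity : 0 < 2 * g + A + B)]

theorem one_div_legResponse_sub (x : ℝ) (r : ℕ) :
    1 / legResponse x r - 1 / legResponse x (r + 1) = x := by
  rw [legResponse, legResponse, one_div_one_div, one_div_one_div, Nat.cast_add_one]
  ring

theorem one_div_add_one_div_le_of_legResponse {A B : ℝ} (hx : x ∈ rootInterval r) (hA : 0 ≤ A)
    (hB : 0 ≤ B) (hAB : -(legResponse x (r + 1) + legResponse x r) ≤ A + B) :
    1 / (legResponse x r + A) + 1 / (legResponse x r + B) ≤ x := by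
  have hg := legResponse_pos hx le_rfl
  have hC := legResponse_succ_neg hx
  calc 1 / (legResponse x r + A) + 1 / (legResponse x r + B)
      ≤ 1 / legResponse x r + 1 / (legResponse x r + A + B) := one_div_add_one_div_le hg hA hB
    _ ≤ 1 / legResponse x r + 1 / -legResponse x (r + 1) := by
        gcongr
        · linarith
        · linarith
    _ = x := by rw [one_div_neg_eq_neg_one_div, ← sub_eq_add_neg, one_div_legResponse_sub]

theorem eq_zero_or_eq_zero_of_le_one_div_add_one_div {A B : ℝ} (hx : x ∈ rootInterval r)
    (hA : 0 ≤ A) (hB : 0 ≤ B) (hAB : -(legResponse x (r + 1) + legResponse x r) ≤ A + B)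
    (hle : x ≤ 1 / (legResponse x r + A) + 1 / (legResponse x r + B)) :
    (A = 0 ∨ B = 0) ∧ A + B = -(legResponse x (r + 1) + legResponse x r) := by
  have hg := legResponse_pos hx le_rfl
  have hC := legResponse_succ_neg hx
  have hCx := one_div_legResponse_sub x r
  have hCAB : 1 / (legResponse x r + A + B) ≤ -(1 / legResponse x (r + 1)) := by
    rw [← one_div_neg_eq_neg_one_div]
    exact one_div_le_one_div_of_le (by linarith) (by linarith)
  constructor
  · by_contra! hne
    have := one_div_add_one_div_lt hg (hA.lt_of_ne' hne.1) (hB.lt_of_ne' hne.2)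
    linarith
  · have hle' : 1 / -legResponse x (r + 1) ≤ 1 / (legResponse x r + A + B) := by
      rw [one_div_neg_eq_neg_one_div]
      linarith [one_div_add_one_div_le hg hA hB]
    linarith [(one_div_le_one_div (by linarith) (by linarith)).1 hle']

end Response

section CenterEdge

variable {V : Type*} {G : SimpleGraph V} {r : ℕ} {u v x₀ y₀ : V} {p : V → V} {x : ℝ}

theorem isAncestor_iff_of_isAncestor {d : V → ℕ} (h : IsRooted G u p d) (huv : G.Adj u v) {y z : V}
    (hyu : y ≠ u) (hyz : IsAncestor p y z) : IsAncestor p v z ↔ IsAncestor p v y := by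
  refine ⟨fun hvz => h.isAncestor_of_depth_le hvz hyz ?_, fun hvy => hvy.trans hyz⟩
  obtain ⟨hvu, hpv⟩ := h.parent_of_adj huv
  rw [h.depth_parent v hvu, hpv, h.depth_root, zero_add]
  exact Nat.one_le_iff_ne_zero.2 fun hdy => hyu (h.depth_eq_zero.1 hdy)

/-- The distance from `z` to the edge `u v`. -/
noncomputable def edgeDist (G : SimpleGraph V) (u v z : V) : ℕ := min (G.dist u z) (G.dist v z)

theorem edgeDist_comm (G : SimpleGraph V) (u v z : V) : edgeDist G u v z = edgeDist G v u z :=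
  min_comm _ _

theorem edgeDist_of_lt {z : V} (hz : G.dist u z < G.dist v z) : edgeDist G u v z = G.dist u z :=
  min_eq_left hz.le

theorem dist_lt_dist_or_dist_lt_dist (hG : G.IsTree) (huv : G.Adj u v) (z : V) :
    G.dist u z < G.dist v z ∨ G.dist v z < G.dist u z := by
  have := hG.dist_eq_dist_add_one_of_adj z huv
  rw [SimpleGraph.dist_comm, SimpleGraph.dist_comm (u := z)] at this
  omega

theorem IsRooted.edgeDist_eq_edgeDist_parent (h : IsRooted G u p (G.dist u)) (huv : G.Adj u v)
    {z : V} (hzu : z ≠ u) (hzv : z ≠ v) : edgeDist G u v z = edgeDist G u v (p z) + 1 := by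
  have hdz := h.depth_parent z hzu
  have huv1 : G.dist u v = 1 := SimpleGraph.dist_eq_one_iff_adj.2 huv
  have hiff : IsAncestor p v z ↔ IsAncestor p v (p z) := by
    rw [isAncestor_iff_eq_or_isAncestor_parent, or_iff_right (Ne.symm hzv)]
  rw [edgeDist, edgeDist]
  by_cases hz : IsAncestor p v (p z)
  · have hvz := h.depth_add_dist_of_isAncestor (hiff.2 hz)
    have hvpz := h.depth_add_dist_of_isAncestor hz
    omega
  · have hvz := mt (h.isAncestor_iff_dist_lt_dist huv).2 (mt hiff.1 hz)
    have hvpz := mt (h.isAncestor_iff_dist_lt_dist huv).2 hz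
    omega

namespace IsCenterEdge

theorem ne (hc : IsCenterEdge G r u v x₀ y₀) : x₀ ≠ y₀ := by
  rintro rfl
  have := hc.dist_ux
  have := hc.dist_uy
  omega

theorem edgeDist_le (hc : IsCenterEdge G r u v x₀ y₀) (hG : G.IsTree) (z : V) :
    edgeDist G u v z ≤ r := by
  rcases dist_lt_dist_or_dist_lt_dist hG hc.adj z with hz | hz
  · exact edgeDist_of_lt hz ▸ hc.le_of_u z hz
  · exact edgeDist_comm G u v z ▸ edgeDist_of_lt hz ▸ hc.le_of_v z hz

theorem edgeDist_left_end (hc : IsCenterEdge G r u v x₀ y₀) : edgeDist G u v y₀ = r := by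
  rw [edgeDist, hc.dist_uy, hc.dist_vy, min_eq_left r.le_succ]

theorem edgeDist_right_end (hc : IsCenterEdge G r u v x₀ y₀) : edgeDist G u v x₀ = r :=
  edgeDist_comm G u v x₀ ▸ hc.symm.edgeDist_left_end

theorem not_isLeaf_left (hc : IsCenterEdge G r u v x₀ y₀) (hG : G.IsTree) (hr : 1 ≤ r) :
    ¬ IsLeaf G u := by
  obtain ⟨p, h⟩ := exists_isRooted hG v
  have hy₀ : y₀ ≠ u := fun hyu => by
    have := hc.dist_uy
    rw [hyu, SimpleGraph.dist_self] at this
    omega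
  have hancestor : IsAncestor p u y₀ := (h.isAncestor_iff_dist_lt_dist hc.adj.symm).2
    (by rw [hc.dist_uy, hc.dist_vy]; exact r.lt_succ_self)
  obtain ⟨c, hcv, hpc, -⟩ := h.exists_child hancestor hy₀
  exact fun hu => (h.isLeaf_iff hc.adj.ne).1 hu c hcv hpc

theorem isLeaf_right_end (hc : IsCenterEdge G r u v x₀ y₀) (hG : G.IsTree) : IsLeaf G x₀ := by
  obtain ⟨p, h⟩ := exists_isRooted hG u
  have hancestor : IsAncestor p v x₀ := (h.isAncestor_iff_dist_lt_dist hc.adj).2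
    (by rw [hc.dist_ux, hc.dist_vx]; exact r.lt_succ_self)
  rw [h.isLeaf_iff (h.ne_root_of_depth_pos (by rw [hc.dist_ux]; exact r.succ_pos))]
  rintro c hcu rfl
  have hcv : IsAncestor p v c := hancestor.trans (isAncestor_parent p c)
  have hlt := (h.isAncestor_iff_dist_lt_dist hc.adj).1 hcv
  have hle := hc.le_of_v c hlt
  have hdepth := h.depth_parent c hcu
  have hadd := h.depth_add_dist_of_isAncestor hcv
  have huv : G.dist u v = 1 := SimpleGraph.dist_eq_one_iff_adj.2 hc.adj
  have hx₀ := hc.dist_ux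
  omega

theorem edgeDist_pos (hc : IsCenterEdge G r u v x₀ y₀) (hG : G.IsTree) (hr : 1 ≤ r) {z : V}
    (hz : IsLeaf G z) : 1 ≤ edgeDist G u v z := by
  have hu : u ≠ z := fun h => hc.not_isLeaf_left hG hr (h ▸ hz)
  have hv : v ≠ z := fun h => hc.symm.not_isLeaf_left hG hr (h ▸ hz)
  exact le_min (hG.connected.pos_dist_of_ne hu) (hG.connected.pos_dist_of_ne hv)

end IsCenterEdge

variable [Fintype V]

theorem IsRooted.potential_compl_edge (h : IsRooted G u p (G.dist u)) (huv : G.Adj u v) (z : V) :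
    potential p (fun y => if y ∈ ({u, v} : Finset V)ᶜ then 1 else 0) z = edgeDist G u v z := by
  obtain ⟨hvu, hpv⟩ := h.parent_of_adj huv
  induction hn : G.dist u z generalizing z with
  | zero =>
    obtain rfl := h.depth_eq_zero.1 hn
    simp [h.potential_root, edgeDist]
  | succ n ih =>
    have hzu : z ≠ u := h.ne_root_of_depth_pos (by omega)
    have hparent := ih (p z) (by have := h.depth_parent z hzu; omega)
    rw [h.potential_eq_add_parent _ hzu, hparent]
    by_cases hzv : z = v
    · simp [hzv, hpv, edgeDist]
    · rw [h.edgeDist_eq_edgeDist_parent huv hzu hzv]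
      simp [hzu, hzv, add_comm]

theorem IsRooted.sum_edgeDist_mul (h : IsRooted G u p (G.dist u)) (huv : G.Adj u v) (q : V → ℝ) :
    ∑ z, edgeDist G u v z * q z = ∑ y ∈ {u, v}ᶜ, flow p q y := by
  simp only [← h.potential_compl_edge huv, sum_potential_mul, ite_mul, one_mul, zero_mul,
    Finset.sum_ite_mem, Finset.univ_inter]

/-- The leaves other than the two ends of the diametral path. -/
noncomputable def extraLeaves (G : SimpleGraph V) (x₀ y₀ : V) : Finset V :=
  {z | IsLeaf G z ∧ z ≠ x₀ ∧ z ≠ y₀}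

/-- The distances of the extra leaves to the central edge. -/
noncomputable def extraLengths (G : SimpleGraph V) (u v x₀ y₀ : V) : Multiset ℕ :=
  (extraLeaves G x₀ y₀).val.map (edgeDist G u v)

theorem extraLeaves_comm (G : SimpleGraph V) (x₀ y₀ : V) :
    extraLeaves G x₀ y₀ = extraLeaves G y₀ x₀ := by
  simp only [extraLeaves, and_comm]

theorem extraLengths_comm (G : SimpleGraph V) (u v x₀ y₀ : V) :
    extraLengths G u v x₀ y₀ = extraLengths G v u y₀ x₀ := by
  rw [extraLengths, extraLengths, extraLeaves_comm]
  exact Multiset.map_congr rfl fun z _ => edgeDist_comm G u v z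

namespace IsCenterEdge

theorem leaves_val (hc : IsCenterEdge G r u v x₀ y₀) (hG : G.IsTree) :
    ({z | IsLeaf G z} : Finset V).val = x₀ ::ₘ y₀ ::ₘ (extraLeaves G x₀ y₀).val := by
  have hset : ({z | IsLeaf G z} : Finset V) = insert x₀ (insert y₀ (extraLeaves G x₀ y₀)) := by
    ext z
    have hx₀ := hc.isLeaf_right_end hG
    have hy₀ := hc.symm.isLeaf_right_end hG
    simp only [extraLeaves, Finset.mem_filter_univ, Finset.mem_insert]
    grind
  rw [hset, Finset.insert_val_of_notMem, Finset.insert_val_of_notMem]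
  · simp [extraLeaves]
  · simp [extraLeaves, hc.ne]

theorem sum_leaves (hc : IsCenterEdge G r u v x₀ y₀) (hG : G.IsTree) (f : V → ℝ) :
    ∑ z with IsLeaf G z, f z = f x₀ + (f y₀ + ∑ z ∈ extraLeaves G x₀ y₀, f z) := by
  rw [Finset.sum, hc.leaves_val hG, Multiset.map_cons, Multiset.sum_cons, Multiset.map_cons,
    Multiset.sum_cons]
  rfl

theorem card_compl_edge (hc : IsCenterEdge G r u v x₀ y₀) {M : ℕ}
    (hM : Fintype.card V = 2 * r + 2 + M) : ({u, v} : Finset V)ᶜ.card = 2 * r + M := by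
  rw [Finset.card_compl, Finset.card_pair hc.adj.ne]
  omega

theorem le_sum_extraLengths (hc : IsCenterEdge G r u v x₀ y₀) (hG : G.IsTree) {M : ℕ}
    (hM : Fintype.card V = 2 * r + 2 + M) : M ≤ (extraLengths G u v x₀ y₀).sum := by
  obtain ⟨p, h⟩ := exists_isRooted hG u
  let q : V → ℝ := fun z => if IsLeaf G z then 1 else 0
  have hflow (y : V) (hy : y ∈ ({u, v} : Finset V)ᶜ) : 1 ≤ flow p q y := by
    have hyu : y ≠ u := by rintro rfl; simp at hy
    obtain ⟨z, -, hz, hyz⟩ := h.exists_isLeaf_of_ne_root hyu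
    calc (1 : ℝ) = q z := (if_pos hz).symm
      _ ≤ flow p q y := Finset.single_le_sum (f := q)
        (fun z _ => by simp only [q]; split_ifs <;> norm_num) (by simpa using hyz)
  have hle : ((2 * r + M : ℕ) : ℝ) ≤ r + (r + ∑ z ∈ extraLeaves G x₀ y₀, edgeDist G u v z) :=
    calc ((2 * r + M : ℕ) : ℝ) = ∑ y ∈ ({u, v} : Finset V)ᶜ, 1 := by
          rw [Finset.sum_const, hc.card_compl_edge hM, nsmul_one]
      _ ≤ ∑ y ∈ ({u, v} : Finset V)ᶜ, flow p q y := Finset.sum_le_sum hflow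
      _ = ∑ z with IsLeaf G z, (edgeDist G u v z : ℝ) := by
          rw [← h.sum_edgeDist_mul hc.adj]
          simp only [q, mul_ite, mul_one, mul_zero, Finset.sum_filter]
      _ = _ := by rw [hc.sum_leaves hG, hc.edgeDist_left_end, hc.edgeDist_right_end,
          Nat.cast_sum]
  have hle' : 2 * r + M ≤ r + (r + ∑ z ∈ extraLeaves G x₀ y₀, edgeDist G u v z) := by
    exact_mod_cast hle
  change M ≤ ∑ z ∈ extraLeaves G x₀ y₀, edgeDist G u v z
  omega

end IsCenterEdge

end CenterEdge

section CentralCharge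

variable {V : Type*} {G : SimpleGraph V} {r : ℕ} {u v x₀ y₀ : V} {p : V → V} {x : ℝ}

/-- The response of the leaf `z` if it lies on the side of `u` of the edge `u v`; zero at the other
vertices. -/
noncomputable def leafResponse (G : SimpleGraph V) (x : ℝ) (u v z : V) : ℝ :=
  if IsLeaf G z ∧ G.dist u z < G.dist v z then legResponse x (G.dist u z) else 0

theorem leafResponse_of_not_isLeaf {z : V} (hz : ¬ IsLeaf G z) : leafResponse G x u v z = 0 :=
  if_neg (mt And.left hz)

theorem leafResponse_of_le {z : V} (hz : G.dist v z ≤ G.dist u z) : leafResponse G x u v z = 0 :=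
  if_neg (mt And.right hz.not_gt)

theorem leafResponse_mul_swap (G : SimpleGraph V) (x : ℝ) (u v z : V) :
    leafResponse G x u v z * leafResponse G x v u z = 0 := by
  rcases le_total (G.dist u z) (G.dist v z) with hz | hz
  · rw [leafResponse_of_le hz, mul_zero]
  · rw [leafResponse_of_le hz, zero_mul]

theorem leafResponse_add_swap (hG : G.IsTree) (huv : G.Adj u v) {z : V} (hz : IsLeaf G z) :
    leafResponse G x u v z + leafResponse G x v u z = legResponse x (edgeDist G u v z) := by
  rcases dist_lt_dist_or_dist_lt_dist hG huv z with hlt | hlt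
  · rw [leafResponse_of_le hlt.le, add_zero, leafResponse, if_pos ⟨hz, hlt⟩, edgeDist_of_lt hlt]
  · rw [leafResponse_of_le hlt.le, zero_add, leafResponse, if_pos ⟨hz, hlt⟩, edgeDist_comm,
      edgeDist_of_lt hlt]

namespace IsCenterEdge

theorem leafResponse_pos (hc : IsCenterEdge G r u v x₀ y₀) (hx : x ∈ rootInterval r) {z : V}
    (hz : IsLeaf G z) (hlt : G.dist u z < G.dist v z) : 0 < leafResponse G x u v z := by
  rw [leafResponse, if_pos ⟨hz, hlt⟩]
  exact legResponse_pos hx (hc.le_of_u z hlt)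

theorem leafResponse_nonneg (hc : IsCenterEdge G r u v x₀ y₀) (hx : x ∈ rootInterval r) (z : V) :
    0 ≤ leafResponse G x u v z := by
  by_cases hz : IsLeaf G z ∧ G.dist u z < G.dist v z
  · exact (hc.leafResponse_pos hx hz.1 hz.2).le
  · exact (if_neg hz).ge

theorem leafResponse_sq (hc : IsCenterEdge G r u v x₀ y₀) (hx : x ∈ rootInterval r) (z : V) :
    leafResponse G x u v z ^ 2
      = leafResponse G x u v z + x * (edgeDist G u v z * leafResponse G x u v z ^ 2) := by
  by_cases hz : IsLeaf G z ∧ G.dist u z < G.dist v z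
  · have := one_sub_pos_of_mem hx (hc.le_of_u z hz.2)
    rw [leafResponse, if_pos hz, edgeDist_of_lt hz.2, legResponse]
    field_simp
    ring
  · simp [leafResponse, hz]

end IsCenterEdge

variable [Fintype V]

/-- The total response of the leaves on the side of `u` of the edge `u v`. -/
noncomputable def sideResponse (G : SimpleGraph V) (x : ℝ) (u v : V) : ℝ :=
  ∑ z, leafResponse G x u v z

/-- The charge which sends one unit of flow through the edge `u v`, distributed on either side in
proportion to the responses of the leaves. -/
noncomputable def centralCharge (G : SimpleGraph V) (x : ℝ) (u v z : V) : ℝ :=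
  leafResponse G x u v z / sideResponse G x u v - leafResponse G x v u z / sideResponse G x v u

theorem IsRooted.centralCharge_eq_or_eq (h : IsRooted G u p (G.dist u)) (huv : G.Adj u v) (x : ℝ)
    {y : V} (hyu : y ≠ u) :
    (∀ z, IsAncestor p y z → G.dist u z < G.dist v z ∧
      centralCharge G x u v z = leafResponse G x u v z / sideResponse G x u v) ∨
    (∀ z, IsAncestor p y z → G.dist v z < G.dist u z ∧
      centralCharge G x u v z = -(leafResponse G x v u z / sideResponse G x v u)) := by
  by_cases hvy : IsAncestor p v y
  · refine Or.inr fun z hyz => ?_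
    have hlt := (h.isAncestor_iff_dist_lt_dist huv).1 (hvy.trans hyz)
    exact ⟨hlt, by rw [centralCharge, leafResponse_of_le hlt.le, zero_div, zero_sub]⟩
  · refine Or.inl fun z hyz => ?_
    have hlt := (dist_lt_dist_or_dist_lt_dist h.isTree huv z).resolve_right
      (mt (h.isAncestor_iff_dist_lt_dist huv).2
        (mt (isAncestor_iff_of_isAncestor h huv hyu hyz).1 hvy))
    exact ⟨hlt, by rw [centralCharge, leafResponse_of_le hlt.le, zero_div, sub_zero]⟩

namespace IsCenterEdge

theorem sideResponse_eq (hc : IsCenterEdge G r u v x₀ y₀) (hG : G.IsTree) (x : ℝ) :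
    sideResponse G x u v
      = legResponse x r + ∑ z ∈ extraLeaves G x₀ y₀, leafResponse G x u v z := by
  have hsum : sideResponse G x u v = ∑ z with IsLeaf G z, leafResponse G x u v z := by
    rw [Finset.sum_filter]
    refine Finset.sum_congr rfl fun z _ => ?_
    split_ifs with hz
    · rfl
    · exact leafResponse_of_not_isLeaf hz
  have hx₀ : leafResponse G x u v x₀ = 0 :=
    leafResponse_of_le (by rw [hc.dist_ux, hc.dist_vx]; exact r.le_succ)
  have hy₀ : leafResponse G x u v y₀ = legResponse x r := by
    rw [leafResponse, if_pos ⟨hc.symm.isLeaf_right_end hG,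
      by rw [hc.dist_uy, hc.dist_vy]; exact r.lt_succ_self⟩, hc.dist_uy]
  rw [hsum, hc.sum_leaves hG, hx₀, hy₀, zero_add]

theorem sideResponse_pos (hc : IsCenterEdge G r u v x₀ y₀) (hG : G.IsTree)
    (hx : x ∈ rootInterval r) : 0 < sideResponse G x u v := by
  rw [hc.sideResponse_eq hG]
  exact add_pos_of_pos_of_nonneg (legResponse_pos hx le_rfl)
    (Finset.sum_nonneg fun z _ => hc.leafResponse_nonneg hx z)

theorem sum_centralCharge (hc : IsCenterEdge G r u v x₀ y₀) (hG : G.IsTree)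
    (hx : x ∈ rootInterval r) : ∑ z, centralCharge G x u v z = 0 := by
  simp only [centralCharge, Finset.sum_sub_distrib, ← Finset.sum_div]
  rw [← sideResponse, ← sideResponse, div_self (hc.sideResponse_pos hG hx).ne',
    div_self (hc.symm.sideResponse_pos hG hx).ne', sub_self]

theorem sum_centralCharge_sq (hc : IsCenterEdge G r u v x₀ y₀) (hG : G.IsTree)
    (hx : x ∈ rootInterval r) :
    ∑ z, centralCharge G x u v z ^ 2 = 1 / sideResponse G x u v + 1 / sideResponse G x v u
      + x * ∑ z, edgeDist G u v z * centralCharge G x u v z ^ 2 := by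
  set a := sideResponse G x u v with ha
  set b := sideResponse G x v u with hb
  have ha0 : a ≠ 0 := (hc.sideResponse_pos hG hx).ne'
  have hb0 : b ≠ 0 := (hc.symm.sideResponse_pos hG hx).ne'
  have hsq (z : V) : centralCharge G x u v z ^ 2
      = leafResponse G x u v z ^ 2 / a ^ 2 + leafResponse G x v u z ^ 2 / b ^ 2 := by
    rw [centralCharge, ← ha, ← hb]
    linear_combination (-2 / (a * b)) * leafResponse_mul_swap G x u v z
  have hterm (z : V) : centralCharge G x u v z ^ 2 = leafResponse G x u v z / a ^ 2
      + leafResponse G x v u z / b ^ 2 + x * (edgeDist G u v z * centralCharge G x u v z ^ 2) := by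
    have hu := hc.leafResponse_sq hx z
    have hv := hc.symm.leafResponse_sq hx z
    rw [edgeDist_comm] at hv
    rw [hsq]
    linear_combination hu / a ^ 2 + hv / b ^ 2
  rw [Finset.sum_congr rfl fun z _ => hterm z, Finset.sum_add_distrib, Finset.sum_add_distrib,
    ← Finset.sum_div, ← Finset.sum_div, ← Finset.mul_sum, ← sideResponse, ← sideResponse, ← ha,
    ← hb]
  field_simp

theorem flow_centralCharge (hc : IsCenterEdge G r u v x₀ y₀) (h : IsRooted G u p (G.dist u))
    (hx : x ∈ rootInterval r) : flow p (centralCharge G x u v) v = -1 := by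
  have hterm (z : V) : (if IsAncestor p v z then centralCharge G x u v z else 0)
      = -(leafResponse G x v u z / sideResponse G x v u) := by
    rw [h.isAncestor_iff_dist_lt_dist hc.adj]
    split_ifs with hz
    · rw [centralCharge, leafResponse_of_le hz.le, zero_div, zero_sub]
    · rw [leafResponse_of_le (not_lt.1 hz), zero_div, neg_zero]
  rw [flow, Finset.sum_filter, Finset.sum_congr rfl fun z _ => hterm z, Finset.sum_neg_distrib,
    ← Finset.sum_div, ← sideResponse, div_self (hc.symm.sideResponse_pos h.isTree hx).ne']

theorem centralCharge_mul_nonneg (hc : IsCenterEdge G r u v x₀ y₀) (h : IsRooted G u p (G.dist u))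
    (hx : x ∈ rootInterval r) {y z z' : V} (hyu : y ≠ u) (hz : IsAncestor p y z)
    (hz' : IsAncestor p y z') : 0 ≤ centralCharge G x u v z * centralCharge G x u v z' := by
  have ha := hc.sideResponse_pos h.isTree hx
  have hb := hc.symm.sideResponse_pos h.isTree hx
  rcases h.centralCharge_eq_or_eq hc.adj x hyu with hside | hside
  · rw [(hside z hz).2, (hside z' hz').2]
    exact mul_nonneg (div_nonneg (hc.leafResponse_nonneg hx z) ha.le)
      (div_nonneg (hc.leafResponse_nonneg hx z') ha.le)
  · rw [(hside z hz).2, (hside z' hz').2, neg_mul_neg]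
    exact mul_nonneg (div_nonneg (hc.symm.leafResponse_nonneg hx z) hb.le)
      (div_nonneg (hc.symm.leafResponse_nonneg hx z') hb.le)

theorem centralCharge_mul_pos (hc : IsCenterEdge G r u v x₀ y₀) (h : IsRooted G u p (G.dist u))
    (hx : x ∈ rootInterval r) {y z z' : V} (hyu : y ≠ u) (hz : IsAncestor p y z)
    (hz' : IsAncestor p y z') (hzleaf : IsLeaf G z) (hzleaf' : IsLeaf G z') :
    0 < centralCharge G x u v z * centralCharge G x u v z' := by
  have ha := hc.sideResponse_pos h.isTree hx
  have hb := hc.symm.sideResponse_pos h.isTree hx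
  rcases h.centralCharge_eq_or_eq hc.adj x hyu with hside | hside
  · rw [(hside z hz).2, (hside z' hz').2]
    exact mul_pos (div_pos (hc.leafResponse_pos hx hzleaf (hside z hz).1) ha)
      (div_pos (hc.leafResponse_pos hx hzleaf' (hside z' hz').1) ha)
  · rw [(hside z hz).2, (hside z' hz').2, neg_mul_neg]
    exact mul_pos (div_pos (hc.symm.leafResponse_pos hx hzleaf (hside z hz).1) hb)
      (div_pos (hc.symm.leafResponse_pos hx hzleaf' (hside z' hz').1) hb)

theorem flow_centralCharge_sq_le (hc : IsCenterEdge G r u v x₀ y₀) (h : IsRooted G u p (G.dist u))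
    (hx : x ∈ rootInterval r) {y : V} (hyu : y ≠ u) :
    flow p (fun z => centralCharge G x u v z ^ 2) y ≤ flow p (centralCharge G x u v) y ^ 2 :=
  sum_sq_le_sq_sum_of_mul_nonneg fun _ hz _ hz' => hc.centralCharge_mul_nonneg h hx hyu
    ((Finset.mem_filter_univ _).1 hz) ((Finset.mem_filter_univ _).1 hz')

theorem flow_centralCharge_sq_lt (hc : IsCenterEdge G r u v x₀ y₀) (h : IsRooted G u p (G.dist u))
    (hx : x ∈ rootInterval r) {y z z' : V} (hyu : y ≠ u) (hz : IsAncestor p y z)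
    (hz' : IsAncestor p y z') (hzleaf : IsLeaf G z) (hzleaf' : IsLeaf G z') (hne : z ≠ z') :
    flow p (fun z => centralCharge G x u v z ^ 2) y < flow p (centralCharge G x u v) y ^ 2 :=
  sum_sq_lt_sq_sum_of_mul_nonneg (fun _ hz _ hz' => hc.centralCharge_mul_nonneg h hx hyu
    ((Finset.mem_filter_univ _).1 hz) ((Finset.mem_filter_univ _).1 hz'))
    ((Finset.mem_filter_univ _).2 hz) ((Finset.mem_filter_univ _).2 hz') hne
    (hc.centralCharge_mul_pos h hx hyu hz hz' hzleaf hzleaf')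

theorem lambda2_mul_one_add_le (hc : IsCenterEdge G r u v x₀ y₀) (h : IsRooted G u p (G.dist u))
    (hx : x ∈ rootInterval r) :
    lambda2 G * (1 + ∑ y ∈ {u, v}ᶜ, flow p (centralCharge G x u v) y ^ 2)
      ≤ 1 / sideResponse G x u v + 1 / sideResponse G x v u
        + x * ∑ y ∈ {u, v}ᶜ, flow p (fun z => centralCharge G x u v z ^ 2) y := by
  have hsum := hc.sum_centralCharge h.isTree hx
  have hleaf (z : V) (hz : ¬ IsLeaf G z) : centralCharge G x u v z = 0 := by
    simp only [centralCharge, leafResponse_of_not_isLeaf hz, zero_div, sub_zero]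
  calc lambda2 G * (1 + ∑ y ∈ {u, v}ᶜ, flow p (centralCharge G x u v) y ^ 2)
      = lambda2 G * ∑ y, flow p (centralCharge G x u v) y ^ 2 := by
        rw [← Finset.sum_add_sum_compl {u, v}, Finset.sum_pair hc.adj.ne, h.flow_root, hsum,
          hc.flow_centralCharge h hx]
        norm_num
    _ ≤ ∑ z, centralCharge G x u v z ^ 2 := h.lambda2_mul_sum_flow_sq_le hleaf hsum
    _ = _ := by rw [hc.sum_centralCharge_sq h.isTree hx, h.sum_edgeDist_mul hc.adj]

theorem sum_flow_sq_le (hc : IsCenterEdge G r u v x₀ y₀) (h : IsRooted G u p (G.dist u))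
    (hx : x ∈ rootInterval r) :
    ∑ y ∈ {u, v}ᶜ, flow p (fun z => centralCharge G x u v z ^ 2) y
      ≤ ∑ y ∈ {u, v}ᶜ, flow p (centralCharge G x u v) y ^ 2 := by
  refine Finset.sum_le_sum fun y hy => hc.flow_centralCharge_sq_le h hx ?_
  rintro rfl
  simp at hy

theorem le_sideResponse_of_le_lambda2 (hc : IsCenterEdge G r u v x₀ y₀) (hG : G.IsTree)
    (hx : x ∈ rootInterval r) (hle : x ≤ lambda2 G) :
    x ≤ 1 / sideResponse G x u v + 1 / sideResponse G x v u := by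
  obtain ⟨p, h⟩ := exists_isRooted hG u
  have hmain := hc.lambda2_mul_one_add_le h hx
  have hflow := mul_le_mul_of_nonneg_left (hc.sum_flow_sq_le h hx) (pos_of_mem hx).le
  have := mul_le_mul_of_nonneg_right hle (by positivity :
    0 ≤ 1 + ∑ y ∈ {u, v}ᶜ, flow p (centralCharge G x u v) y ^ 2)
  linarith

theorem eq_of_isLeaf_of_le_lambda2 (hc : IsCenterEdge G r u v x₀ y₀)
    (h : IsRooted G u p (G.dist u)) (hx : x ∈ rootInterval r)
    (hside : 1 / sideResponse G x u v + 1 / sideResponse G x v u ≤ x) (hle : x ≤ lambda2 G)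
    {y z z' : V} (hyu : y ≠ u) (hyv : y ≠ v) (hz : IsAncestor p y z) (hz' : IsAncestor p y z')
    (hzleaf : IsLeaf G z) (hzleaf' : IsLeaf G z') : z = z' := by
  by_contra hne
  have hmain := hc.lambda2_mul_one_add_le h hx
  have hflow : ∑ y ∈ {u, v}ᶜ, flow p (fun z => centralCharge G x u v z ^ 2) y
      < ∑ y ∈ {u, v}ᶜ, flow p (centralCharge G x u v) y ^ 2 := by
    refine Finset.sum_lt_sum (fun y hy => hc.flow_centralCharge_sq_le h hx ?_)
      ⟨y, by simp [hyu, hyv], hc.flow_centralCharge_sq_lt h hx hyu hz hz' hzleaf hzleaf' hne⟩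
    rintro rfl
    simp at hy
  have := mul_lt_mul_of_pos_left hflow (pos_of_mem hx)
  have := mul_le_mul_of_nonneg_right hle (by positivity :
    0 ≤ 1 + ∑ y ∈ {u, v}ᶜ, flow p (centralCharge G x u v) y ^ 2)
  linarith

theorem sum_extraLengths_eq (hc : IsCenterEdge G r u v x₀ y₀) (hG : G.IsTree) (x : ℝ) :
    ((extraLengths G u v x₀ y₀).map (legResponse x)).sum
      = ∑ z ∈ extraLeaves G x₀ y₀, leafResponse G x u v z
        + ∑ z ∈ extraLeaves G x₀ y₀, leafResponse G x v u z := by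
  rw [extraLengths, Multiset.map_map, ← Finset.sum_add_distrib]
  refine Finset.sum_congr rfl fun z hz => ?_
  exact (leafResponse_add_swap hG hc.adj ((Finset.mem_filter_univ _).1 hz).1).symm

theorem one_div_sideResponse_add_le (hc : IsCenterEdge G r u v x₀ y₀) (hG : G.IsTree)
    (hx : x ∈ rootInterval r) (hopt : -(legResponse x (r + 1) + legResponse x r)
      ≤ ((extraLengths G u v x₀ y₀).map (legResponse x)).sum) :
    1 / sideResponse G x u v + 1 / sideResponse G x v u ≤ x := by
  rw [hc.sum_extraLengths_eq hG] at hopt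
  rw [hc.sideResponse_eq hG, hc.symm.sideResponse_eq hG, extraLeaves_comm G y₀ x₀]
  exact one_div_add_one_div_le_of_legResponse hx
    (Finset.sum_nonneg fun z _ => hc.leafResponse_nonneg hx z)
    (Finset.sum_nonneg fun z _ => hc.symm.leafResponse_nonneg hx z) hopt

theorem dist_lt_dist_of_sum_leafResponse_eq_zero (hc : IsCenterEdge G r u v x₀ y₀)
    (hG : G.IsTree) (hx : x ∈ rootInterval r)
    (hsum : ∑ z ∈ extraLeaves G x₀ y₀, leafResponse G x u v z = 0) {z : V}
    (hz : z ∈ extraLeaves G x₀ y₀) : G.dist v z < G.dist u z := by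
  refine (dist_lt_dist_or_dist_lt_dist hG hc.adj z).resolve_left fun hlt => ?_
  have hzero :=
    (Finset.sum_eq_zero_iff_of_nonneg fun z _ => hc.leafResponse_nonneg hx z).1 hsum z hz
  exact (hc.leafResponse_pos hx ((Finset.mem_filter_univ _).1 hz).1 hlt).ne' hzero

theorem extraLeaves_one_sided_of_le_lambda2 (hc : IsCenterEdge G r u v x₀ y₀) (hG : G.IsTree)
    (hx : x ∈ rootInterval r) (hopt : -(legResponse x (r + 1) + legResponse x r)
      ≤ ((extraLengths G u v x₀ y₀).map (legResponse x)).sum) (hle : x ≤ lambda2 G) :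
    ((∀ z ∈ extraLeaves G x₀ y₀, G.dist v z < G.dist u z) ∨
      ∀ z ∈ extraLeaves G x₀ y₀, G.dist u z < G.dist v z) ∧
    ((extraLengths G u v x₀ y₀).map (legResponse x)).sum
      = -(legResponse x (r + 1) + legResponse x r) := by
  have hside := hc.le_sideResponse_of_le_lambda2 hG hx hle
  rw [hc.sum_extraLengths_eq hG] at hopt ⊢
  rw [hc.sideResponse_eq hG, hc.symm.sideResponse_eq hG, extraLeaves_comm G y₀ x₀] at hside
  obtain ⟨hzero, heq⟩ := eq_zero_or_eq_zero_of_le_one_div_add_one_div hx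
    (Finset.sum_nonneg fun z _ => hc.leafResponse_nonneg hx z)
    (Finset.sum_nonneg fun z _ => hc.symm.leafResponse_nonneg hx z) hopt hside
  refine ⟨hzero.imp (fun hsum z hz => ?_) fun hsum z hz => ?_, heq⟩
  · exact hc.dist_lt_dist_of_sum_leafResponse_eq_zero hG hx hsum hz
  · rw [extraLeaves_comm] at hsum hz
    exact hc.symm.dist_lt_dist_of_sum_leafResponse_eq_zero hG hx hsum hz

end IsCenterEdge

end CentralCharge

section Iso

variable {V W : Type*} {G : SimpleGraph V} {H : SimpleGraph W}

theorem isLeaf_iso (e : G ≃g H) (v : V) : IsLeaf H (e v) ↔ IsLeaf G v := by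
  rw [IsLeaf, IsLeaf, ← Nat.card_coe_set_eq, ← Nat.card_coe_set_eq,
    Nat.card_congr (e.mapNeighborSet v)]

theorem dist_map_le (hG : G.Connected) (e : G ≃g H) (a b : V) :
    H.dist (e a) (e b) ≤ G.dist a b := by
  obtain ⟨w, hw⟩ := hG.exists_walk_length_eq_dist a b
  rw [← hw, ← SimpleGraph.Walk.length_map e.toHom w]
  exact SimpleGraph.dist_le _

theorem diam_le_of_iso [Finite V] (hG : G.Connected) (e : G ≃g H) : H.diam ≤ G.diam := by
  have := Finite.of_equiv V e.toEquiv
  have := hG.nonempty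
  have := this.map e
  obtain ⟨a, b, hab⟩ := H.exists_dist_eq_diam
  calc H.diam = H.dist (e (e.symm a)) (e (e.symm b)) := by simp only [RelIso.apply_symm_apply, hab]
    _ ≤ G.dist (e.symm a) (e.symm b) := dist_map_le hG e _ _
    _ ≤ G.diam := SimpleGraph.dist_le_diam (SimpleGraph.connected_iff_ediam_ne_top.1 hG)

variable [Fintype V] [Fintype W] {n D : ℕ}

theorem laplacian_iso (e : G ≃g H) (f : W → ℝ) (v : V) :
    laplacian H f (e v) = laplacian G (f ∘ e) v := by
  rw [laplacian, laplacian, ← Equiv.sum_comp e.toEquiv]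
  exact Finset.sum_congr rfl fun w _ => if_congr e.map_adj_iff rfl rfl

theorem IsSteklovEigenvalue.of_iso (e : G ≃g H) {μ : ℝ} (h : IsSteklovEigenvalue H μ) :
    IsSteklovEigenvalue G μ := by
  obtain ⟨hμ, f, hf, hharm, hleaf⟩ := h
  refine ⟨hμ, f ∘ e, fun hzero => hf ?_, fun v hv => ?_, fun ω ω' hω hadj => ?_⟩
  · ext w
    simpa using congrFun hzero (e.symm w)
  · rw [← laplacian_iso]
    exact hharm _ (by rwa [isLeaf_iso])
  · exact hleaf _ _ ((isLeaf_iso e ω).2 hω) (e.map_adj_iff.2 hadj)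

theorem lambda2_iso (e : G ≃g H) : lambda2 G = lambda2 H :=
  congrArg sInf (Set.ext fun _ =>
    and_congr_right fun _ => ⟨fun h => h.of_iso e.symm, fun h => h.of_iso e⟩)

theorem IsAdmissible.of_iso (e : G ≃g H) (h : IsAdmissible n D G) : IsAdmissible n D H := by
  obtain ⟨htree, hcard, hdiam⟩ := h
  have htree' : H.IsTree := e.isTree_iff.1 htree
  refine ⟨htree', by rw [← hcard, Fintype.card_congr e.toEquiv], ?_⟩
  rw [← hdiam]
  exact le_antisymm (diam_le_of_iso htree.connected e) (diam_le_of_iso htree'.connected e.symm)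

theorem IsExtremizer.of_iso (e : G ≃g H) (h : IsExtremizer n D G) : IsExtremizer n D H :=
  ⟨h.1.of_iso e, fun K hK => lambda2_iso e ▸ h.2 K hK⟩

theorem IsUniqueExtremizer.of_iso (e : G ≃g H) (h : IsUniqueExtremizer n D G) :
    IsUniqueExtremizer n D H :=
  ⟨h.1.of_iso e, fun K hK => (h.2 K hK).map fun e' => e'.trans e⟩

theorem IsExtremizer.lambda2_le (h : IsExtremizer n D G) (hH : IsAdmissible n D H) :
    lambda2 H ≤ lambda2 G := by
  let e : H ≃g H.map (Fintype.equivFinOfCardEq hH.2.1).toEmbedding := SimpleGraph.Iso.map _ H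
  rw [lambda2_iso e]
  exact h.2 _ (hH.of_iso e)

end Iso

theorem IsRooted.nonempty_iso {V W : Type*} {G : SimpleGraph V} {H : SimpleGraph W} {o : V}
    {p : V → V} {d : V → ℕ} {o' : W} {p' : W → W} {d' : W → ℕ} (h : IsRooted G o p d)
    (h' : IsRooted H o' p' d') (e : V ≃ W) (ho : e o = o') (hp : ∀ x, x ≠ o → e (p x) = p' (e x)) :
    Nonempty (G ≃g H) := by
  refine ⟨⟨e, fun {x y} => ?_⟩⟩
  rw [h.adj_iff, h'.adj_iff, ← ho, e.injective.ne_iff, e.injective.ne_iff]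
  refine or_congr (and_congr_right fun hx => ?_) (and_congr_right fun hy => ?_)
  · rw [← hp x hx, e.injective.eq_iff]
  · rw [← hp y hy, e.injective.eq_iff]

section Spider

variable {ι : Type*} {ℓ : ι → ℕ}

/-- The parent function of a spider rooted at its center. -/
def spiderParent (ℓ : ι → ℕ) : Option (Σ i, Fin (ℓ i)) → Option (Σ i, Fin (ℓ i))
  | none => none
  | some ⟨_, ⟨0, _⟩⟩ => none
  | some ⟨i, ⟨j + 1, hj⟩⟩ => some ⟨i, ⟨j, by omega⟩⟩

/-- The depth function of a spider rooted at its center. -/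
def spiderDepth (ℓ : ι → ℕ) : Option (Σ i, Fin (ℓ i)) → ℕ
  | none => 0
  | some v => v.2 + 1

theorem spider_eq_fromRel (ℓ : ι → ℕ) :
    spider ℓ = SimpleGraph.fromRel fun x y => y ≠ none ∧ spiderParent ℓ y = x := by
  refine congrArg _ (funext fun x => funext fun y => propext ?_)
  rcases x with _ | ⟨i, j, hj⟩ <;> rcases y with _ | ⟨i', _ | j', hj'⟩
  · simp
  · simp [spiderParent]
  · simp [spiderParent]
  · simp
  · simp [spiderParent]
  · simp only [spiderParent, ne_eq, reduceCtorEq, not_false_eq_true, true_and, Option.some.injEq,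
      Sigma.mk.injEq, Nat.add_right_cancel_iff]
    constructor
    · rintro ⟨rfl, rfl⟩
      exact ⟨rfl, HEq.rfl⟩
    · rintro ⟨rfl, h⟩
      exact ⟨rfl, (Fin.mk.inj (eq_of_heq h)).symm⟩

theorem spiderDepth_eq_succ {x : Option (Σ i, Fin (ℓ i))} (hx : x ≠ none) :
    spiderDepth ℓ x = spiderDepth ℓ (spiderParent ℓ x) + 1 := by
  rcases x with _ | ⟨i, _ | j, hj⟩
  · exact absurd rfl hx
  · rfl
  · rfl

theorem spider_isRooted (ℓ : ι → ℕ) :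
    IsRooted (spider ℓ) none (spiderParent ℓ) (spiderDepth ℓ) where
  adj_iff x y := by
    have parent_ne (z) (hz : z ≠ none) : spiderParent ℓ z ≠ z := fun h => by
      have := spiderDepth_eq_succ hz
      rw [h] at this
      omega
    rw [spider_eq_fromRel, SimpleGraph.fromRel_adj]
    constructor
    · rintro ⟨-, h | h⟩
      · exact Or.inr h
      · exact Or.inl h
    · rintro (⟨hx, rfl⟩ | ⟨hy, rfl⟩)
      · exact ⟨(parent_ne x hx).symm, Or.inr ⟨hx, rfl⟩⟩
      · exact ⟨parent_ne y hy, Or.inl ⟨hy, rfl⟩⟩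
  parent_root := rfl
  depth_root := rfl
  depth_parent _ := spiderDepth_eq_succ

theorem exists_equiv_of_map_eq {κ α : Type*} [Fintype ι] [Fintype κ] {f : ι → α} {g : κ → α}
    (h : Finset.univ.val.map f = Finset.univ.val.map g) : ∃ e : ι ≃ κ, ∀ i, g (e i) = f i := by
  have card_fiber (c : α) : Fintype.card {i // f i = c} = Fintype.card {j // g j = c} := by
    have := congrArg (Multiset.count c) h
    rw [Multiset.count_map, Multiset.count_map] at this
    rw [Fintype.card_subtype, Fintype.card_subtype]
    simpa [Finset.card, eq_comm] using this
  exact ⟨Equiv.ofFiberEquiv fun c => Fintype.equivOfCardEq (card_fiber c),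
    Equiv.ofFiberEquiv_map _⟩

theorem spider_iso_of_map_eq {κ : Type*} [Fintype ι] [Fintype κ] {ℓ' : κ → ℕ}
    (h : Finset.univ.val.map ℓ = Finset.univ.val.map ℓ') :
    Nonempty (spider ℓ ≃g spider ℓ') := by
  obtain ⟨e, he⟩ := exists_equiv_of_map_eq h
  let E : (Σ i, Fin (ℓ i)) ≃ Σ k, Fin (ℓ' k) :=
    Equiv.sigmaCongr e fun i => finCongr (he i).symm
  refine (spider_isRooted ℓ).nonempty_iso (spider_isRooted ℓ') (Equiv.optionCongr E) rfl ?_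
  rintro (_ | ⟨i, _ | j, hj⟩) hx
  · exact absurd rfl hx
  · rfl
  · rfl

section LegVertex

variable {V : Type*} {G : SimpleGraph V} {o : V} {p : V → V} {d : V → ℕ}

/-- In a tree rooted at `o`, the vertex at depth `j + 1` on the path from `o` to the leaf `z`, for
`some ⟨z, j⟩`, and `o` itself for `none`. -/
def legVertex (G : SimpleGraph V) (o : V) (p : V → V) (d : V → ℕ) :
    Option (Σ z : {z // IsLeaf G z}, Fin (d z)) → V
  | none => o
  | some ⟨z, j⟩ => p^[d z - (j + 1)] z

namespace IsRooted

theorem depth_legVertex (h : IsRooted G o p d) (a : Option (Σ z : {z // IsLeaf G z}, Fin (d z))) :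
    d (legVertex G o p d a) = spiderDepth (fun z : {z // IsLeaf G z} => d z) a := by
  rcases a with _ | ⟨z, j, hj⟩
  · exact h.depth_root
  · simp only [legVertex, spiderDepth, h.depth_iterate]
    omega

theorem legVertex_spiderParent (h : IsRooted G o p d)
    {a : Option (Σ z : {z // IsLeaf G z}, Fin (d z))} (ha : a ≠ none) :
    legVertex G o p d (spiderParent (fun z : {z // IsLeaf G z} => d z) a)
      = p (legVertex G o p d a) := by
  rcases a with _ | ⟨z, _ | j, hj⟩
  · exact absurd rfl ha
  · simp only [spiderParent, legVertex, ← Function.iterate_succ_apply' p]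
    refine (h.depth_eq_zero.1 ?_).symm
    rw [h.depth_iterate]
    omega
  · simp only [spiderParent, legVertex, ← Function.iterate_succ_apply' p]
    congr 1
    omega

theorem legVertex_surjective [Finite V] (h : IsRooted G o p d) :
    Function.Surjective (legVertex G o p d) := by
  intro y
  by_cases hy : y = o
  · exact ⟨none, hy.symm⟩
  · obtain ⟨z, -, hz, hyz⟩ := h.exists_isLeaf_of_ne_root hy
    obtain ⟨hle, hiter⟩ := h.isAncestor_iff.1 hyz
    have hdy : d y ≠ 0 := mt h.depth_eq_zero.1 hy
    refine ⟨some ⟨⟨z, hz⟩, ⟨d y - 1, by simp only; omega⟩⟩, ?_⟩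
    simp only [legVertex]
    rwa [Nat.sub_add_cancel (Nat.one_le_iff_ne_zero.2 hdy)]

theorem legVertex_injective (h : IsRooted G o p d)
    (huniq : ∀ y, y ≠ o → ∀ z z', IsAncestor p y z → IsAncestor p y z' → IsLeaf G z →
      IsLeaf G z' → z = z') : Function.Injective (legVertex G o p d) := by
  intro a b hab
  have hdepth := congrArg d hab
  rw [h.depth_legVertex, h.depth_legVertex] at hdepth
  rcases a with _ | ⟨z, j, hj⟩ <;> rcases b with _ | ⟨z', j', hj'⟩
  · rfl
  · exact absurd hdepth.symm (Nat.succ_ne_zero _)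
  · exact absurd hdepth (Nat.succ_ne_zero _)
  · have hne : legVertex G o p d (some ⟨z, j, hj⟩) ≠ o := h.ne_root_of_depth_pos (by
      rw [h.depth_legVertex]
      exact Nat.succ_pos _)
    obtain rfl : z = z' :=
      Subtype.ext (huniq _ hne z z' ⟨_, rfl⟩ (hab ▸ ⟨_, rfl⟩) z.2 z'.2)
    obtain rfl : j = j' := Nat.succ_injective hdepth
    rfl

theorem nonempty_iso_spider [Finite V] (h : IsRooted G o p d)
    (huniq : ∀ y, y ≠ o → ∀ z z', IsAncestor p y z → IsAncestor p y z' → IsLeaf G z →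
      IsLeaf G z' → z = z') :
    Nonempty (G ≃g spider fun z : {z // IsLeaf G z} => d z) :=
  ((spider_isRooted _).nonempty_iso h
    (Equiv.ofBijective _ ⟨h.legVertex_injective huniq, h.legVertex_surjective⟩) rfl
    fun _ => h.legVertex_spiderParent).map RelIso.symm

end IsRooted

end LegVertex

end Spider

section SpiderSpectrum

variable {ι : Type*} {ℓ : ι → ℕ}

theorem spider_isLeaf_iff (i : ι) (j : ℕ) (hj : j < ℓ i) :
    IsLeaf (spider ℓ) (some ⟨i, ⟨j, hj⟩⟩) ↔ j + 1 = ℓ i := by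
  rw [(spider_isRooted ℓ).isLeaf_iff (by simp)]
  constructor
  · intro h
    by_contra hne
    exact h (some ⟨i, ⟨j + 1, by omega⟩⟩) (by simp) rfl
  · rintro h (_ | ⟨i', _ | j', hj'⟩) hc
    · exact absurd rfl hc
    · simp [spiderParent]
    · simp only [spiderParent, ne_eq, Option.some.injEq, Sigma.mk.injEq, not_and]
      rintro rfl h'
      rw [heq_eq_eq, Fin.mk.injEq] at h'
      omega

theorem isAncestor_spiderParent (i : ι) (j : ℕ) (hj : j < ℓ i) :
    IsAncestor (spiderParent ℓ) (some ⟨i, ⟨0, by omega⟩⟩) (some ⟨i, ⟨j, hj⟩⟩) := by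
  induction j with
  | zero => exact .refl _ _
  | succ j ih =>
    exact (ih (by omega)).trans (isAncestor_parent (spiderParent ℓ) (some ⟨i, ⟨j + 1, hj⟩⟩))

theorem laplacian_spider_leg [Fintype ι] (f : Option (Σ i, Fin (ℓ i)) → ℝ) (i : ι) (j : ℕ)
    (hj : j + 1 < ℓ i) :
    laplacian (spider ℓ) f (some ⟨i, ⟨j, by omega⟩⟩)
      = (f (some ⟨i, ⟨j, by omega⟩⟩) - f (spiderParent ℓ (some ⟨i, ⟨j, by omega⟩⟩)))
        - (f (some ⟨i, ⟨j + 1, hj⟩⟩) - f (some ⟨i, ⟨j, by omega⟩⟩)) := by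
  have child_iff (c : Option (Σ i, Fin (ℓ i))) :
      (c ≠ none ∧ spiderParent ℓ c = some ⟨i, ⟨j, by omega⟩⟩) ↔ c = some ⟨i, ⟨j + 1, hj⟩⟩ := by
    constructor
    · rcases c with _ | ⟨i', _ | j', hj'⟩
      · rintro ⟨h, -⟩
        exact absurd rfl h
      · rintro ⟨-, h⟩
        exact absurd h.symm (by simp [spiderParent])
      · rintro ⟨-, h⟩
        simp only [spiderParent, Option.some.injEq, Sigma.mk.injEq] at h
        obtain ⟨rfl, h⟩ := h
        rw [heq_eq_eq, Fin.mk.injEq] at h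
        subst h
        rfl
    · rintro rfl
      exact ⟨by simp, rfl⟩
  rw [(spider_isRooted ℓ).laplacian_eq, Finset.sum_filter]
  simp only [child_iff, Finset.sum_ite_eq', Finset.mem_univ, if_true]
  rfl

theorem laplacian_spider_center [Fintype ι] (hℓ : ∀ i, 1 ≤ ℓ i)
    (f : Option (Σ i, Fin (ℓ i)) → ℝ) :
    laplacian (spider ℓ) f none = - ∑ i, (f (some ⟨i, ⟨0, hℓ i⟩⟩) - f none) := by
  rw [(spider_isRooted ℓ).laplacian_eq, Finset.sum_filter, Fintype.sum_option, Fintype.sum_sigma,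
    if_neg (by simp), zero_add]
  rw [show f none - f (spiderParent ℓ none) = 0 from sub_self _, zero_sub, neg_inj]
  refine Finset.sum_congr rfl fun i _ => ?_
  rw [Finset.sum_eq_single ⟨0, hℓ i⟩, if_pos ⟨by simp, rfl⟩]
  · rfl
  · rintro ⟨_ | j, hj⟩ - hne
    · exact absurd rfl hne
    · simp [spiderParent]
  · simp

theorem spider_affine_of_harmonic [Fintype ι] (hℓ : ∀ i, 1 ≤ ℓ i)
    {f : Option (Σ i, Fin (ℓ i)) → ℝ}
    (hf : ∀ v, ¬ IsLeaf (spider ℓ) v → laplacian (spider ℓ) f v = 0) (i : ι) (j : ℕ)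
    (hj : j < ℓ i) :
    f (some ⟨i, ⟨j, hj⟩⟩) - f (spiderParent ℓ (some ⟨i, ⟨j, hj⟩⟩))
        = f (some ⟨i, ⟨0, hℓ i⟩⟩) - f none ∧
      f (some ⟨i, ⟨j, hj⟩⟩) = f none + (j + 1) * (f (some ⟨i, ⟨0, hℓ i⟩⟩) - f none) := by
  induction j with
  | zero =>
    refine ⟨rfl, ?_⟩
    push_cast
    ring
  | succ j ih =>
    obtain ⟨hstep, hval⟩ := ih (by omega)
    have hj0 := hf (some ⟨i, ⟨j, by omega⟩⟩) (by rw [spider_isLeaf_iff]; omega)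
    rw [laplacian_spider_leg f i j hj, hstep] at hj0
    refine ⟨?_, ?_⟩
    · simp only [spiderParent]
      linarith
    · push_cast
      linarith

/-- The Steklov eigenfunction of a spider for a root `x` of `∑ i, legResponse x (ℓ i) = 0`,
normalized to be `1` at the center: it is affine on each leg and equals `legResponse x (ℓ i)` at the
end of leg `i`. -/
noncomputable def spiderEigenfunction (ℓ : ι → ℕ) (x : ℝ) (z : Option (Σ i, Fin (ℓ i))) : ℝ :=
  z.elim 1 fun w => 1 + ((w.2 : ℕ) + 1 : ℝ) * (x * legResponse x (ℓ w.1))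

theorem spiderEigenfunction_sub_parent (x : ℝ) (i : ι) (j : Fin (ℓ i)) :
    spiderEigenfunction ℓ x (some ⟨i, j⟩)
      - spiderEigenfunction ℓ x (spiderParent ℓ (some ⟨i, j⟩)) = x * legResponse x (ℓ i) := by
  rcases j with ⟨_ | j, hj⟩
  · simp [spiderEigenfunction, spiderParent]
  · simp only [spiderEigenfunction, spiderParent, Option.elim_some]
    push_cast
    ring

theorem laplacian_spiderEigenfunction [Fintype ι] (hℓ : ∀ i, 1 ≤ ℓ i) {x : ℝ}
    (h0 : ∑ i, legResponse x (ℓ i) = 0) {z : Option (Σ i, Fin (ℓ i))}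
    (hz : ¬ IsLeaf (spider ℓ) z) : laplacian (spider ℓ) (spiderEigenfunction ℓ x) z = 0 := by
  rcases z with _ | ⟨i, j, hj⟩
  · rw [laplacian_spider_center hℓ, neg_eq_zero]
    calc ∑ i, (spiderEigenfunction ℓ x (some ⟨i, ⟨0, hℓ i⟩⟩) - spiderEigenfunction ℓ x none)
        = ∑ i, x * legResponse x (ℓ i) :=
          Finset.sum_congr rfl fun i _ => spiderEigenfunction_sub_parent x i ⟨0, hℓ i⟩
      _ = 0 := by rw [← Finset.mul_sum, h0, mul_zero]
  · rw [spider_isLeaf_iff] at hz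
    have hj' : j + 1 < ℓ i := by omega
    rw [laplacian_spider_leg _ i j hj', spiderEigenfunction_sub_parent, sub_eq_zero]
    exact (spiderEigenfunction_sub_parent x i ⟨j + 1, hj'⟩).symm

end SpiderSpectrum

section SeesawLike

/-- The spiders whose eigenvalue is governed by `rootInterval r`: one leg of length `r + 1`, all
others of length at most `r`, and one of those of length exactly `r`. -/
structure IsSeesawLike {ι : Type*} (r : ℕ) (ℓ : ι → ℕ) (i₀ i₁ : ι) : Prop where
  ne : i₁ ≠ i₀
  long : ℓ i₀ = r + 1
  short : ℓ i₁ = r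
  le : ∀ i, i ≠ i₀ → ℓ i ≤ r
  pos : ∀ i, 1 ≤ ℓ i

theorem legResponse_lt {ℓ : ℕ} {x y : ℝ} (hℓ : 1 ≤ ℓ) (hxy : x < y)
    (h : 0 < (1 - (ℓ : ℝ) * x) * (1 - (ℓ : ℝ) * y)) : legResponse x ℓ < legResponse y ℓ := by
  have hsub : legResponse y ℓ - legResponse x ℓ
      = ℓ * (y - x) / ((1 - (ℓ : ℝ) * x) * (1 - (ℓ : ℝ) * y)) := by
    obtain ⟨hx, hy⟩ := mul_ne_zero_iff.1 h.ne'
    unfold legResponse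
    field_simp
    ring
  have hnum : 0 < (ℓ : ℝ) * (y - x) := mul_pos (by exact_mod_cast hℓ) (by linarith)
  linarith [div_pos hnum h]

theorem legResponse_le_legResponse {ℓ r : ℕ} {x : ℝ} (hx : x ∈ rootInterval r) (hℓ : ℓ ≤ r) :
    legResponse x ℓ ≤ legResponse x r := by
  refine one_div_le_one_div_of_le (one_sub_pos_of_mem hx le_rfl) ?_
  have := (pos_of_mem hx).le
  gcongr

theorem two_div_mem_rootInterval {r : ℕ} (hr : 1 ≤ r) :
    2 / (2 * (r : ℝ) + 1) ∈ rootInterval r := by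
  have : (0 : ℝ) < r := by exact_mod_cast hr
  constructor <;> rw [div_lt_div_iff₀ (by positivity) (by positivity)] <;> linarith

theorem legResponse_add_legResponse_two_div {r : ℕ} (hr : 1 ≤ r) :
    legResponse (2 / (2 * (r : ℝ) + 1)) (r + 1) + legResponse (2 / (2 * (r : ℝ) + 1)) r = 0 := by
  have hI := two_div_mem_rootInterval hr
  have hshort := (one_sub_pos_of_mem hI le_rfl).ne'
  have hlong := (one_sub_succ_neg hI).ne
  unfold legResponse
  rw [Nat.cast_succ, div_add_div _ _ hlong hshort, div_eq_zero_iff]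
  left
  field_simp
  ring

namespace IsSeesawLike

variable {ι : Type*} {r : ℕ} {ℓ : ι → ℕ} {i₀ i₁ : ι}

theorem one_sub_mul_long_neg (h : IsSeesawLike r ℓ i₀ i₁) {x : ℝ} (hx : x ∈ rootInterval r) :
    1 - (ℓ i₀ : ℝ) * x < 0 := by
  rw [h.long, Nat.cast_succ]
  exact one_sub_succ_neg hx

theorem one_sub_mul_ne_zero (h : IsSeesawLike r ℓ i₀ i₁) {x : ℝ} (hx : x ∈ rootInterval r)
    (i : ι) : 1 - (ℓ i : ℝ) * x ≠ 0 := by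
  by_cases hi : i = i₀
  · exact hi ▸ (h.one_sub_mul_long_neg hx).ne
  · exact (one_sub_pos_of_mem hx (h.le i hi)).ne'

theorem not_isLeaf_center (h : IsSeesawLike r ℓ i₀ i₁) : ¬ IsLeaf (spider ℓ) none := by
  intro hl
  obtain ⟨a, ha⟩ := Set.ncard_eq_one.1 hl
  have hm (i : ι) : some ⟨i, ⟨0, h.pos i⟩⟩ ∈ (spider ℓ).neighborSet none :=
    ((spider_isRooted ℓ).adj_iff _ _).2 (Or.inr ⟨by simp, rfl⟩)
  rw [ha] at hm
  have := (hm i₀).trans (hm i₁).symm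
  simp only [Option.some.injEq, Sigma.mk.injEq] at this
  exact h.ne this.1.symm

section Diam

theorem spiderDepth_le (h : IsSeesawLike r ℓ i₀ i₁) (z : Option (Σ i, Fin (ℓ i))) :
    spiderDepth ℓ z ≤ r + 1 := by
  rcases z with _ | ⟨i, j, hj⟩
  · exact Nat.zero_le _
  · have : ℓ i ≤ r + 1 := by
      by_cases hi : i = i₀
      · rw [hi, h.long]
      · exact (h.le i hi).trans (Nat.le_succ r)
    simp only [spiderDepth]
    omega

theorem eq_of_spiderDepth_eq (h : IsSeesawLike r ℓ i₀ i₁) {z : Option (Σ i, Fin (ℓ i))}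
    (hz : spiderDepth ℓ z = r + 1) : z = some ⟨i₀, ⟨r, by rw [h.long]; omega⟩⟩ := by
  rcases z with _ | ⟨i, j, hj⟩
  · exact absurd hz (by simp [spiderDepth])
  · simp only [spiderDepth] at hz
    obtain rfl : i = i₀ := by
      by_contra hi
      have := h.le i hi
      omega
    obtain rfl : j = r := by omega
    rfl

theorem diam_le (h : IsSeesawLike r ℓ i₀ i₁) : (spider ℓ).diam ≤ 2 * r + 1 := by
  have hR := spider_isRooted ℓ
  obtain ⟨z, w, hzw⟩ := (spider ℓ).exists_dist_eq_diam
  rw [← hzw]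
  by_contra! hlt
  have htri := hR.connected.dist_triangle (u := z) (v := none) (w := w)
  rw [SimpleGraph.dist_comm (u := z) (v := none), hR.dist_root, hR.dist_root] at htri
  have hz := h.spiderDepth_le z
  have hw := h.spiderDepth_le w
  have : z = w := (h.eq_of_spiderDepth_eq (by omega)).trans (h.eq_of_spiderDepth_eq (by omega)).symm
  rw [this, SimpleGraph.dist_self] at hlt
  omega

theorem le_diam (h : IsSeesawLike r ℓ i₀ i₁) [Finite ι] : 2 * r + 1 ≤ (spider ℓ).diam := by
  have hR := spider_isRooted ℓ
  have hlong := h.long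
  have hshort := h.short
  have hr := h.pos i₁
  let z : Option (Σ i, Fin (ℓ i)) := some ⟨i₀, ⟨r, by omega⟩⟩
  let w : Option (Σ i, Fin (ℓ i)) := some ⟨i₁, ⟨r - 1, by omega⟩⟩
  have hw : ¬ IsAncestor (spiderParent ℓ) (some ⟨i₀, ⟨0, h.pos i₀⟩⟩) w := fun hw => by
    have := hR.eq_of_isAncestor_of_depth_eq hw (isAncestor_spiderParent i₁ (r - 1) _) rfl
    simp only [Option.some.injEq, Sigma.mk.injEq] at this
    exact h.ne this.1.symm
  have hdist := hR.add_le_dist_of_separated (v := some ⟨i₀, ⟨0, h.pos i₀⟩⟩) rfl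
    (isAncestor_spiderParent i₀ r (by omega)) hw
  have hdz : spiderDepth ℓ z = r + 1 := rfl
  have hdw : spiderDepth ℓ w = r - 1 + 1 := rfl
  have : (spider ℓ).dist z w ≤ (spider ℓ).diam :=
    SimpleGraph.dist_le_diam (SimpleGraph.connected_iff_ediam_ne_top.1 hR.connected)
  change spiderDepth ℓ z + _ ≤ (spider ℓ).dist z w at hdist
  omega

theorem diam_spider (h : IsSeesawLike r ℓ i₀ i₁) [Finite ι] : (spider ℓ).diam = 2 * r + 1 :=
  le_antisymm h.diam_le h.le_diam

end Diam

variable [Fintype ι]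

theorem isAdmissible (h : IsSeesawLike r ℓ i₀ i₁) {n : ℕ} (hn : n = 1 + ∑ i, ℓ i) :
    IsAdmissible n (2 * r + 1) (spider ℓ) := by
  refine ⟨(spider_isRooted ℓ).isTree, ?_, h.diam_spider⟩
  rw [Fintype.card_option, Fintype.card_sigma, hn]
  simp only [Fintype.card_fin, add_comm]

theorem strictMonoOn_sum_legResponse (h : IsSeesawLike r ℓ i₀ i₁) :
    StrictMonoOn (fun x => ∑ i, legResponse x (ℓ i)) (rootInterval r) := by
  intro x hx y hy hxy
  refine Finset.sum_lt_sum_of_nonempty ⟨i₀, Finset.mem_univ _⟩ fun i _ => ?_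
  refine legResponse_lt (h.pos i) hxy ?_
  by_cases hi : i = i₀
  · rw [hi]
    exact mul_pos_of_neg_of_neg (h.one_sub_mul_long_neg hx) (h.one_sub_mul_long_neg hy)
  · exact mul_pos (one_sub_pos_of_mem hx (h.le i hi)) (one_sub_pos_of_mem hy (h.le i hi))

theorem sum_legResponse_eq (h : IsSeesawLike r ℓ i₀ i₁) (x : ℝ) :
    ∑ i, legResponse x (ℓ i) = legResponse x (r + 1)
      + ∑ i ∈ Finset.univ.erase i₀, legResponse x (ℓ i) := by
  rw [← Finset.add_sum_erase _ _ (Finset.mem_univ i₀), h.long]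

theorem continuousOn_sum_legResponse (h : IsSeesawLike r ℓ i₀ i₁) :
    ContinuousOn (fun x => ∑ i, legResponse x (ℓ i)) (rootInterval r) :=
  continuousOn_finsetSum _ fun i _ =>
    ContinuousOn.div continuousOn_const (by fun_prop) fun _ hx => h.one_sub_mul_ne_zero hx i

theorem exists_sum_legResponse_nonpos (h : IsSeesawLike r ℓ i₀ i₁) :
    ∃ a ∈ rootInterval r, a ≤ 2 / (2 * r + 1) ∧ ∑ i, legResponse a (ℓ i) ≤ 0 := by
  obtain ⟨N, hN⟩ : ∃ N : ℝ, N = (Finset.univ.erase i₀).card := ⟨_, rfl⟩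
  have hN1 : 1 ≤ N := by
    rw [hN]
    exact_mod_cast Finset.card_pos.2 ⟨i₁, Finset.mem_erase.2 ⟨h.ne, Finset.mem_univ _⟩⟩
  have hr : (0 : ℝ) < r := by exact_mod_cast h.short ▸ h.pos i₁
  have hD : 0 < N * (r + 1) + r := by positivity
  -- `a` is the zero of the sum after lengthening every leg other than `i₀` to length `r`.
  obtain ⟨a, ha⟩ : ∃ a : ℝ, a = (N + 1) / (N * (r + 1) + r) := ⟨_, rfl⟩
  have haI : a ∈ rootInterval r := by
    constructor <;> rw [ha, div_lt_div_iff₀ (by positivity) (by positivity)] <;> nlinarith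
  refine ⟨a, haI, ?_, ?_⟩
  · rw [ha, div_le_div_iff₀ hD (by positivity)]
    nlinarith
  · have hbound : ∑ i ∈ Finset.univ.erase i₀, legResponse a (ℓ i) ≤ N * legResponse a r := by
      rw [hN, ← nsmul_eq_mul]
      exact Finset.sum_le_card_nsmul _ _ _ fun i hi =>
        legResponse_le_legResponse haI (h.le i (Finset.ne_of_mem_erase hi))
    have hzero : legResponse a (r + 1) + N * legResponse a r = 0 := by
      have hshort := one_sub_pos_of_mem haI le_rfl
      unfold legResponse
      rw [Nat.cast_succ]
      field_simp
      rw [ha]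
      field_simp
      ring
    rw [h.sum_legResponse_eq]
    linarith

theorem sum_legResponse_two_div_nonneg (h : IsSeesawLike r ℓ i₀ i₁) :
    0 ≤ ∑ i, legResponse (2 / (2 * (r : ℝ) + 1)) (ℓ i) := by
  have hr : 1 ≤ r := h.short ▸ h.pos i₁
  have hI := two_div_mem_rootInterval hr
  have hle : legResponse (2 / (2 * (r : ℝ) + 1)) (ℓ i₁)
      ≤ ∑ i ∈ Finset.univ.erase i₀, legResponse (2 / (2 * (r : ℝ) + 1)) (ℓ i) :=
    Finset.single_le_sum (f := fun i => legResponse (2 / (2 * (r : ℝ) + 1)) (ℓ i))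
      (fun i hi => (legResponse_pos hI (h.le i (Finset.ne_of_mem_erase hi))).le)
      (Finset.mem_erase.2 ⟨h.ne, Finset.mem_univ _⟩)
  rw [h.short] at hle
  rw [h.sum_legResponse_eq]
  linarith [legResponse_add_legResponse_two_div hr]

theorem exists_root (h : IsSeesawLike r ℓ i₀ i₁) :
    ∃ x ∈ rootInterval r, ∑ i, legResponse x (ℓ i) = 0 := by
  obtain ⟨a, ha, hab, hlow⟩ := h.exists_sum_legResponse_nonpos
  have hb := two_div_mem_rootInterval (h.short ▸ h.pos i₁ : 1 ≤ r)
  have hsub : Set.Icc a (2 / (2 * (r : ℝ) + 1)) ⊆ rootInterval r := Set.ordConnected_Ioo.out ha hb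
  obtain ⟨x, hx, hx0⟩ := intermediate_value_Icc hab (h.continuousOn_sum_legResponse.mono hsub)
    ⟨hlow, h.sum_legResponse_two_div_nonneg⟩
  exact ⟨x, hsub hx, hx0⟩

theorem isUniqueRoot (h : IsSeesawLike r ℓ i₀ i₁) {x : ℝ} (hx : x ∈ rootInterval r)
    (h0 : ∑ i, legResponse x (ℓ i) = 0) :
    IsUniqueRoot (fun y => ∑ i, legResponse y (ℓ i)) (rootInterval r) x :=
  ⟨hx, h0, fun _ hy hy0 => h.strictMonoOn_sum_legResponse.injOn hy hx (hy0.trans h0.symm)⟩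

theorem isSteklovEigenvalue (h : IsSeesawLike r ℓ i₀ i₁) {x : ℝ} (hx : x ∈ rootInterval r)
    (h0 : ∑ i, legResponse x (ℓ i) = 0) : IsSteklovEigenvalue (spider ℓ) x := by
  refine ⟨(pos_of_mem hx).le, spiderEigenfunction ℓ x, fun hzero => ?_,
    fun z hz => laplacian_spiderEigenfunction h.pos h0 hz, ?_⟩
  · exact one_ne_zero (congrFun hzero none)
  · rintro (_ | ⟨i, j, hj⟩) ω' hω hadj
    · exact absurd hω h.not_isLeaf_center
    · rw [← laplacian_eq_sub_of_isLeaf _ hω hadj,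
        laplacian_eq_sub_of_isLeaf _ hω ((spider_isRooted ℓ).adj_parent (by simp)),
        spiderEigenfunction_sub_parent]
      rw [spider_isLeaf_iff] at hω
      have hresp : legResponse x (ℓ i) * (1 - ℓ i * x) = 1 :=
        one_div_mul_cancel (h.one_sub_mul_ne_zero hx i)
      have hcast : (j : ℝ) + 1 = ℓ i := by exact_mod_cast hω
      simp only [spiderEigenfunction, Option.elim_some, hcast]
      linear_combination x * hresp

theorem slope_mul_one_sub (h : IsSeesawLike r ℓ i₀ i₁) {μ : ℝ}
    {f : Option (Σ i, Fin (ℓ i)) → ℝ}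
    (hlap : ∀ v, ¬ IsLeaf (spider ℓ) v → laplacian (spider ℓ) f v = 0)
    (hbd : ∀ ω ω', IsLeaf (spider ℓ) ω → (spider ℓ).Adj ω ω' → f ω - f ω' = μ * f ω) (i : ι) :
    (f (some ⟨i, ⟨0, h.pos i⟩⟩) - f none) * (1 - ℓ i * μ) = μ * f none := by
  have hi := h.pos i
  have hj : ℓ i - 1 < ℓ i := by omega
  have hl : IsLeaf (spider ℓ) (some ⟨i, ⟨ℓ i - 1, hj⟩⟩) := by
    rw [spider_isLeaf_iff]
    omega
  have hend := hbd _ _ hl ((spider_isRooted ℓ).adj_parent (by simp))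
  obtain ⟨hstep, hval⟩ := spider_affine_of_harmonic h.pos hlap i (ℓ i - 1) hj
  rw [hstep, hval, Nat.cast_sub hi, Nat.cast_one, sub_add_cancel] at hend
  linarith

theorem sum_legResponse_eq_zero_of_isSteklovEigenvalue (h : IsSeesawLike r ℓ i₀ i₁) {μ : ℝ}
    (hμ : 0 < μ) (hpos : ∀ i, i ≠ i₀ → 0 < 1 - (ℓ i : ℝ) * μ)
    (hev : IsSteklovEigenvalue (spider ℓ) μ) :
    (∀ i, 1 - (ℓ i : ℝ) * μ ≠ 0) ∧ ∑ i, legResponse μ (ℓ i) = 0 := by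
  obtain ⟨-, f, hf, hlap, hbd⟩ := hev
  have hslope := h.slope_mul_one_sub hlap hbd
  have hsum := hlap none h.not_isLeaf_center
  rw [laplacian_spider_center h.pos, neg_eq_zero] at hsum
  have hcenter : f none ≠ 0 := by
    intro hzero
    have hother (i : ι) (hi : i ≠ i₀) : f (some ⟨i, ⟨0, h.pos i⟩⟩) - f none = 0 := by
      refine (mul_eq_zero.1 ?_).resolve_right (hpos i hi).ne'
      rw [hslope i, hzero, mul_zero]
    have hall (i : ι) : f (some ⟨i, ⟨0, h.pos i⟩⟩) - f none = 0 := by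
      by_cases hi : i = i₀
      · rwa [hi, ← Finset.sum_eq_single (f := fun i => f (some ⟨i, ⟨0, h.pos i⟩⟩) - f none) i₀
          (fun i _ hi => hother i hi) fun h => absurd (Finset.mem_univ _) h]
      · exact hother i hi
    refine hf (funext fun z => ?_)
    rcases z with _ | ⟨i, j, hj⟩
    · exact hzero
    · rw [(spider_affine_of_harmonic h.pos hlap i j hj).2, hall i, hzero, mul_zero, add_zero]
      rfl
  have hne (i : ι) : 1 - (ℓ i : ℝ) * μ ≠ 0 := fun hi =>
    mul_ne_zero hμ.ne' hcenter (by rw [← hslope i, hi, mul_zero])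
  refine ⟨hne, (mul_eq_zero.1 ?_).resolve_left (mul_ne_zero hμ.ne' hcenter)⟩
  rw [Finset.mul_sum, ← hsum]
  refine Finset.sum_congr rfl fun i _ => ?_
  rw [legResponse, mul_one_div, div_eq_iff (hne i), hslope i]

theorem le_of_isSteklovEigenvalue (h : IsSeesawLike r ℓ i₀ i₁) {x μ : ℝ}
    (hx : x ∈ rootInterval r) (h0 : ∑ i, legResponse x (ℓ i) = 0) (hμ : μ ≠ 0)
    (hev : IsSteklovEigenvalue (spider ℓ) μ) : x ≤ μ := by
  by_contra! hlt
  have hpos (i : ι) (hi : i ≠ i₀) : 0 < 1 - (ℓ i : ℝ) * μ := by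
    have : (ℓ i : ℝ) * μ ≤ ℓ i * x := by gcongr
    linarith [one_sub_pos_of_mem hx (h.le i hi)]
  obtain ⟨hne, hsum⟩ := h.sum_legResponse_eq_zero_of_isSteklovEigenvalue
    (lt_of_le_of_ne hev.1 hμ.symm) hpos hev
  have hlong : 1 - ((r : ℝ) + 1) * μ < 0 := by
    by_contra! hge
    have hresp (i : ι) : 0 < legResponse μ (ℓ i) := by
      refine one_div_pos.2 ?_
      by_cases hi : i = i₀
      · refine lt_of_le_of_ne ?_ (hne i).symm
        rwa [hi, h.long, Nat.cast_succ]
      · exact hpos i hi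
    exact (Finset.sum_pos (fun i _ => hresp i) ⟨i₀, Finset.mem_univ _⟩).ne' hsum
  have hμI : μ ∈ rootInterval r := by
    refine ⟨?_, hlt.trans hx.2⟩
    rw [div_lt_iff₀ (by positivity)]
    linarith
  exact (h.strictMonoOn_sum_legResponse hμI hx hlt).ne (hsum.trans h0.symm)

theorem lambda2_eq (h : IsSeesawLike r ℓ i₀ i₁) {x : ℝ} (hx : x ∈ rootInterval r)
    (h0 : ∑ i, legResponse x (ℓ i) = 0) : lambda2 (spider ℓ) = x :=
  le_antisymm (lambda2_le_of_isSteklovEigenvalue (h.isSteklovEigenvalue hx h0) (pos_of_mem hx).ne')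
    (le_csInf ⟨x, (pos_of_mem hx).ne', h.isSteklovEigenvalue hx h0⟩ fun _ ⟨hμ, hev⟩ =>
      h.le_of_isSteklovEigenvalue hx h0 hμ hev)

end IsSeesawLike

end SeesawLike

section Comparison

variable {V : Type*} [Fintype V] {G : SimpleGraph V} {r : ℕ} {u v x₀ y₀ : V} {p : V → V} {x : ℝ}

namespace IsCenterEdge

theorem map_dist_leaves (hc : IsCenterEdge G r u v x₀ y₀) (hG : G.IsTree)
    (hside : ∀ z ∈ extraLeaves G x₀ y₀, G.dist u z < G.dist v z) :
    Finset.univ.val.map (fun z : {z // IsLeaf G z} => G.dist u z)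
      = (r + 1) ::ₘ r ::ₘ extraLengths G u v x₀ y₀ := by
  calc Finset.univ.val.map (fun z : {z // IsLeaf G z} => G.dist u z)
      = ({z | IsLeaf G z} : Finset V).val.map (G.dist u) :=
        Finset.univ_val_map_subtype_restrict (G.dist u) (IsLeaf G)
    _ = (r + 1) ::ₘ r ::ₘ (extraLeaves G x₀ y₀).val.map (G.dist u) := by
        rw [hc.leaves_val hG, Multiset.map_cons, Multiset.map_cons, hc.dist_ux, hc.dist_uy]
    _ = (r + 1) ::ₘ r ::ₘ extraLengths G u v x₀ y₀ := by
        rw [extraLengths, Multiset.map_congr rfl fun z hz => (edgeDist_of_lt (hside z hz)).symm]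

theorem eq_right_end_of_isAncestor (hc : IsCenterEdge G r u v x₀ y₀)
    (h : IsRooted G u p (G.dist u)) (hside : ∀ z ∈ extraLeaves G x₀ y₀, G.dist u z < G.dist v z)
    {z : V} (hz : IsLeaf G z) (hvz : IsAncestor p v z) : z = x₀ := by
  by_contra hne
  have hlt := (h.isAncestor_iff_dist_lt_dist hc.adj).1 hvz
  by_cases hzy : z = y₀
  · rw [hzy, hc.dist_uy, hc.dist_vy] at hlt
    omega
  · exact hlt.not_gt (hside z (by simp [extraLeaves, hz, hne, hzy]))

theorem nonempty_iso_spider (hc : IsCenterEdge G r u v x₀ y₀) (hG : G.IsTree)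
    (hx : x ∈ rootInterval r)
    (hopt : -(legResponse x (r + 1) + legResponse x r)
      ≤ ((extraLengths G u v x₀ y₀).map (legResponse x)).sum) (hle : x ≤ lambda2 G)
    (hside : ∀ z ∈ extraLeaves G x₀ y₀, G.dist u z < G.dist v z)
    {κ : Type*} [Fintype κ] {ℓ : κ → ℕ}
    (hℓ : Finset.univ.val.map ℓ = (r + 1) ::ₘ r ::ₘ extraLengths G u v x₀ y₀) :
    Nonempty (G ≃g spider ℓ) := by
  obtain ⟨p, h⟩ := exists_isRooted hG u
  obtain ⟨e⟩ := h.nonempty_iso_spider fun y hyu z z' hz hz' hzleaf hzleaf' => by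
    by_cases hyv : y = v
    · subst hyv
      rw [hc.eq_right_end_of_isAncestor h hside hzleaf hz,
        hc.eq_right_end_of_isAncestor h hside hzleaf' hz']
    · exact hc.eq_of_isLeaf_of_le_lambda2 h hx (hc.one_div_sideResponse_add_le hG hx hopt) hle
        hyu hyv hz hz' hzleaf hzleaf'
  obtain ⟨e'⟩ := spider_iso_of_map_eq ((hc.map_dist_leaves hG hside).trans hℓ.symm)
  exact ⟨e.trans e'⟩

end IsCenterEdge

namespace IsAdmissible

theorem exists_isCenterEdge {n M : ℕ} (hG : IsAdmissible n (2 * r + 1) G)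
    (hn : n = 2 * r + 2 + M) (hr : 1 ≤ r) :
    ∃ u v x₀ y₀, IsCenterEdge G r u v x₀ y₀ ∧
      (∀ ℓ ∈ extraLengths G u v x₀ y₀, 1 ≤ ℓ ∧ ℓ ≤ r) ∧ M ≤ (extraLengths G u v x₀ y₀).sum := by
  obtain ⟨hT, hcard, hdiam⟩ := hG
  obtain ⟨u, v, x₀, y₀, hc⟩ := SteklovTree.exists_isCenterEdge hT hdiam
  refine ⟨u, v, x₀, y₀, hc, fun ℓ hℓ => ?_, hc.le_sum_extraLengths hT (hcard.trans hn)⟩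
  obtain ⟨z, hz, rfl⟩ := Multiset.mem_map.1 hℓ
  exact ⟨hc.edgeDist_pos hT hr ((Finset.mem_filter_univ z).1 hz).1, hc.edgeDist_le hT z⟩

theorem exists_nonempty_iso_spider_of_le_lambda2 {n M : ℕ} (hG : IsAdmissible n (2 * r + 1) G)
    (hn : n = 2 * r + 2 + M) (hx : x ∈ rootInterval r)
    (hopt : ∀ L : Multiset ℕ, (∀ ℓ ∈ L, 1 ≤ ℓ ∧ ℓ ≤ r) → M ≤ L.sum →
      -(legResponse x (r + 1) + legResponse x r) ≤ (L.map (legResponse x)).sum)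
    (hle : x ≤ lambda2 G) :
    ∃ L : Multiset ℕ, (∀ ℓ ∈ L, 1 ≤ ℓ ∧ ℓ ≤ r) ∧ M ≤ L.sum ∧
      (L.map (legResponse x)).sum = -(legResponse x (r + 1) + legResponse x r) ∧
      ∀ {κ : Type} [Fintype κ] {ℓ : κ → ℕ},
        Finset.univ.val.map ℓ = (r + 1) ::ₘ r ::ₘ L → Nonempty (G ≃g spider ℓ) := by
  obtain ⟨u, v, x₀, y₀, hc, hL, hM⟩ := hG.exists_isCenterEdge hn (one_le_of_mem hx)
  have hopt' := hopt _ hL hM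
  obtain ⟨hside, hsum⟩ := hc.extraLeaves_one_sided_of_le_lambda2 hG.1 hx hopt' hle
  refine ⟨extraLengths G u v x₀ y₀, hL, hM, hsum, fun {κ _ ℓ} hℓ => ?_⟩
  rcases hside with hside | hside
  · rw [extraLengths_comm] at hopt' hℓ
    rw [extraLeaves_comm] at hside
    exact hc.symm.nonempty_iso_spider hG.1 hx hopt' hle hside hℓ
  · exact hc.nonempty_iso_spider hG.1 hx hopt' hle hside hℓ

end IsAdmissible

end Comparison

section Balanced

/-- The lengths of `q` branches of total length `q * c + t` that differ by at most one: `t` copies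
of `c + 1` and `q - t` copies of `c`. -/
def balanced (q c t : ℕ) : Multiset ℕ :=
  Multiset.replicate t (c + 1) + Multiset.replicate (q - t) c

variable {r q c t ℓ : ℕ} {x : ℝ}

theorem card_balanced (ht : t ≤ q) : (balanced q c t).card = q := by
  simp only [balanced, Multiset.card_add, Multiset.card_replicate]
  omega

theorem sum_balanced (ht : t ≤ q) : (balanced q c t).sum = q * c + t := by
  obtain ⟨k, rfl⟩ := Nat.exists_eq_add_of_le ht
  simp only [balanced, Multiset.sum_add, Multiset.sum_replicate, smul_eq_mul,
    Nat.add_sub_cancel_left]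
  ring

theorem eq_or_eq_succ_of_mem_balanced (hℓ : ℓ ∈ balanced q c t) : ℓ = c ∨ ℓ = c + 1 :=
  (Multiset.mem_add.1 hℓ).symm.imp Multiset.eq_of_mem_replicate Multiset.eq_of_mem_replicate

theorem eq_balanced {L : Multiset ℕ} (hmem : ∀ ℓ ∈ L, ℓ = c ∨ ℓ = c + 1) (hcard : L.card = q)
    (hsum : L.sum = q * c + t) : L = balanced q c t := by
  have hlong : L.filter (· = c + 1) = Multiset.replicate (L.count (c + 1)) (c + 1) := by
    rw [← Multiset.filter_eq']
  have hshort : L.filter (¬ · = c + 1)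
      = Multiset.replicate (L.filter (¬ · = c + 1)).card c :=
    Multiset.eq_replicate_card.2 fun ℓ hℓ =>
      (hmem ℓ (Multiset.mem_filter.1 hℓ).1).resolve_right (Multiset.mem_filter.1 hℓ).2
  have hL := Multiset.filter_add_not (· = c + 1) L
  rw [hlong, hshort] at hL
  generalize L.count (c + 1) = a at hL
  generalize (L.filter (¬ · = c + 1)).card = b at hL
  subst hL
  simp only [Multiset.card_add, Multiset.card_replicate, Multiset.sum_add,
    Multiset.sum_replicate, smul_eq_mul] at hcard hsum
  obtain rfl : a = t := by
    subst hcard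
    linarith
  rw [balanced, ← hcard, Nat.add_sub_cancel_left]

theorem map_asLengths (ht : t ≤ q) :
    Finset.univ.val.map (asLengths r (q + 2) c t) = (r + 1) ::ₘ r ::ₘ balanced q c t := by
  rw [Fin.univ_succ, Finset.cons_val, Multiset.map_cons, Finset.map_val, Multiset.map_map,
    Fin.univ_succ, Finset.cons_val, Multiset.map_cons, Finset.map_val, Multiset.map_map]
  have hlateral (i : Fin q) :
      asLengths r (q + 2) c t i.succ.succ = c + if (i : ℕ) < t then 1 else 0 := by
    rw [asLengths, if_neg (by simp), if_neg (by simp), Fin.val_succ, Fin.val_succ]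
    split_ifs <;> omega
  simp only [Function.comp_def, Function.Embedding.coeFn_mk, hlateral]
  congr 2
  refine eq_balanced (fun ℓ hℓ => ?_) (by simp) ?_
  · obtain ⟨i, -, rfl⟩ := Multiset.mem_map.1 hℓ
    split_ifs <;> simp
  · change ∑ i : Fin q, (c + if (i : ℕ) < t then 1 else 0) = _
    rw [Finset.sum_add_distrib, Finset.sum_boole, Fin.card_filter_val_lt, min_eq_right ht]
    simp

theorem sum_asLengths (ht : t ≤ q) :
    1 + ∑ i, asLengths r (q + 2) c t i = 2 * r + 2 + (q * c + t) := by
  change 1 + (Finset.univ.val.map (asLengths r (q + 2) c t)).sum = _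
  rw [map_asLengths ht, Multiset.sum_cons, Multiset.sum_cons, sum_balanced ht]
  ring

theorem sum_legResponse_asLengths (ht : t ≤ q) (x : ℝ) :
    ∑ i, legResponse x (asLengths r (q + 2) c t i) = legResponse x (r + 1) + legResponse x r
      + ((balanced q c t).map (legResponse x)).sum := by
  have : ∑ i, legResponse x (asLengths r (q + 2) c t i)
      = ((Finset.univ.val.map (asLengths r (q + 2) c t)).map (legResponse x)).sum := by
    rw [Multiset.map_map]
    rfl
  rw [this, map_asLengths ht]
  simp only [Multiset.map_cons, Multiset.sum_cons, add_assoc]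

theorem rootFunction_eq (ht : t ≤ q) (x : ℝ) :
    rootFunction r q c t x = ∑ i, legResponse x (asLengths r (q + 2) c t i) := by
  rw [sum_legResponse_asLengths ht]
  simp only [balanced, Multiset.map_add, Multiset.map_replicate, Multiset.sum_add,
    Multiset.sum_replicate, nsmul_eq_mul, Nat.cast_sub ht, rootFunction, legResponse,
    Nat.cast_add_one]
  ring

theorem asLengths_isSeesawLike (hr : 1 ≤ r) (hc : q = 0 ∨ 1 ≤ c ∧ c ≤ r)
    (ht : t = 0 ∨ c + 1 ≤ r) : IsSeesawLike r (asLengths r (q + 2) c t) 0 1 where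
  ne := by simp
  long := by simp [asLengths]
  short := by simp [asLengths]
  le i hi := by
    have hi0 : (i : ℕ) ≠ 0 := fun h => hi (Fin.ext h)
    have := i.2
    simp only [asLengths, hi0, if_false]
    split_ifs <;> omega
  pos i := by
    have := i.2
    simp only [asLengths]
    split_ifs <;> omega

/-- The affine function of `ℓ` that agrees with `legResponse x` at `c` and at `c + 1`. -/
noncomputable def responseChord (x : ℝ) (c ℓ : ℕ) : ℝ :=
  legResponse x c + ((ℓ : ℝ) - c) * (legResponse x (c + 1) - legResponse x c)

theorem responseChord_eq_legResponse (h : ℓ = c ∨ ℓ = c + 1) :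
    responseChord x c ℓ = legResponse x ℓ := by
  rcases h with rfl | rfl <;> simp [responseChord]

theorem legResponse_sub_legResponse {ℓ' : ℕ} (hx : x ∈ rootInterval r) (hℓ : ℓ ≤ r)
    (hℓ' : ℓ' ≤ r) : legResponse x ℓ - legResponse x ℓ'
      = ((ℓ : ℝ) - ℓ') * x * legResponse x ℓ * legResponse x ℓ' := by
  have h : legResponse x ℓ * (1 - ℓ * x) = 1 :=
    one_div_mul_cancel (one_sub_pos_of_mem hx hℓ).ne'
  have h' : legResponse x ℓ' * (1 - ℓ' * x) = 1 :=
    one_div_mul_cancel (one_sub_pos_of_mem hx hℓ').ne'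
  linear_combination legResponse x ℓ' * h - legResponse x ℓ * h'

theorem legResponse_sub_responseChord (hx : x ∈ rootInterval r) (hc : c + 1 ≤ r) (hℓ : ℓ ≤ r) :
    legResponse x ℓ - responseChord x c ℓ = ((ℓ : ℝ) - c) * ((ℓ : ℝ) - c - 1)
      * (x ^ 2 * legResponse x ℓ * legResponse x c * legResponse x (c + 1)) := by
  have hc' := Nat.le_of_succ_le hc
  have hℓc := legResponse_sub_legResponse hx hℓ hc'
  have hℓc' := legResponse_sub_legResponse hx hℓ hc
  have hcc' := legResponse_sub_legResponse hx hc hc'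
  push_cast at hℓc' hcc'
  rw [responseChord, hcc']
  linear_combination hℓc + ((ℓ : ℝ) - c) * x * legResponse x c * hℓc'

theorem responseChord_zero (hx : x ∈ rootInterval r) (hc : c + 1 ≤ r) :
    responseChord x c 0
      = (1 - (2 * (c : ℝ) + 1) * x) * (legResponse x c * legResponse x (c + 1)) := by
  have hslope := legResponse_sub_legResponse hx hc (Nat.le_of_succ_le hc)
  have hinv : legResponse x (c + 1) * (1 - ((c + 1 : ℕ) : ℝ) * x) = 1 :=
    one_div_mul_cancel (one_sub_pos_of_mem hx hc).ne'
  push_cast at hslope hinv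
  rw [responseChord, hslope]
  push_cast
  linear_combination -legResponse x c * hinv

theorem responseChord_lt_or_eq (hx : x ∈ rootInterval r) (hc : c + 1 ≤ r) (hℓ : ℓ ≤ r) :
    responseChord x c ℓ < legResponse x ℓ ∨ ℓ = c ∨ ℓ = c + 1 := by
  by_cases h : ℓ = c ∨ ℓ = c + 1
  · exact Or.inr h
  · left
    have hpos : (0 : ℝ) < ((ℓ : ℝ) - c) * ((ℓ : ℝ) - c - 1) := by
      rcases (by omega : ℓ + 1 ≤ c ∨ c + 2 ≤ ℓ) with h | h
      · have : (ℓ : ℝ) + 1 ≤ c := by exact_mod_cast h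
        exact mul_pos_of_neg_of_neg (by linarith) (by linarith)
      · have : (c : ℝ) + 2 ≤ ℓ := by exact_mod_cast h
        exact mul_pos (by linarith) (by linarith)
    rw [← sub_pos, legResponse_sub_responseChord hx hc hℓ]
    have := pos_of_mem hx
    have := legResponse_pos hx hℓ
    have := legResponse_pos hx hc
    have := legResponse_pos hx (Nat.le_of_succ_le hc)
    positivity

theorem sum_map_responseChord (L : Multiset ℕ) :
    (L.map (responseChord x c)).sum = L.card * responseChord x c 0
      + L.sum * (legResponse x (c + 1) - legResponse x c) := by
  induction L using Multiset.induction_on with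
  | empty => simp
  | cons ℓ L ih =>
    rw [Multiset.map_cons, Multiset.sum_cons, ih, Multiset.card_cons, Multiset.sum_cons]
    simp only [responseChord]
    push_cast
    ring

theorem sum_map_legResponse_balanced (ht : t ≤ q) :
    ((balanced q c t).map (legResponse x)).sum = q * responseChord x c 0
      + (q * c + t : ℕ) * (legResponse x (c + 1) - legResponse x c) := by
  have : (balanced q c t).map (legResponse x) = (balanced q c t).map (responseChord x c) :=
    Multiset.map_congr rfl fun ℓ hℓ =>
      (responseChord_eq_legResponse (eq_or_eq_succ_of_mem_balanced hℓ)).symm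
  rw [this, sum_map_responseChord, card_balanced ht, sum_balanced ht]

/-- At `x`, a choice `L` of lateral branches is either the balanced choice of `q` branches of total
length `q * c + t` or worse than it, that is, it has a larger sum of leg responses. -/
def BalancedOrWorse (x : ℝ) (q c t : ℕ) (L : Multiset ℕ) : Prop :=
  L = balanced q c t ∨ ((balanced q c t).map (legResponse x)).sum < (L.map (legResponse x)).sum

theorem BalancedOrWorse.le {L : Multiset ℕ} (h : BalancedOrWorse x q c t L) :
    ((balanced q c t).map (legResponse x)).sum ≤ (L.map (legResponse x)).sum :=
  h.elim (fun h => by rw [h]) le_of_lt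

theorem BalancedOrWorse.succ {L : Multiset ℕ} (h : BalancedOrWorse x q c q L) :
    BalancedOrWorse x q (c + 1) 0 L := by
  have : balanced q c q = balanced q (c + 1) 0 := by simp [balanced]
  rwa [BalancedOrWorse, ← this]

-- The sum of the leg responses is at least that of the chord, which only depends on the number of
-- legs, with a coefficient of the sign of `1 - (2 * c + 1) * x`, and on their total length.
theorem balancedOrWorse_of_card (hx : x ∈ rootInterval r) (hc : c + 1 ≤ r) (ht : t ≤ q)
    {L : Multiset ℕ} (hL : ∀ ℓ ∈ L, ℓ ≤ r) (hsum : q * c + t ≤ L.sum)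
    (hcard : L.card = q ∨ 0 < ((L.card : ℝ) - q) * (1 - (2 * (c : ℝ) + 1) * x)) :
    BalancedOrWorse x q c t L := by
  by_contra! h
  obtain ⟨hne, hle⟩ := not_or.1 h
  rw [not_lt] at hle
  have hslope : 0 < legResponse x (c + 1) - legResponse x c :=
    sub_pos.2 (one_div_lt_one_div_of_lt (one_sub_pos_of_mem hx hc)
      (by push_cast; linarith [pos_of_mem hx]))
  have hchord : (L.map (responseChord x c)).sum ≤ (L.map (legResponse x)).sum :=
    Multiset.sum_map_le_sum_map _ _ fun ℓ hℓ =>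
      (responseChord_lt_or_eq hx hc (hL ℓ hℓ)).elim le_of_lt
        fun h => (responseChord_eq_legResponse h).le
  have hlength := mul_le_mul_of_nonneg_right (Nat.cast_le (α := ℝ).2 hsum) hslope.le
  have hnumber : L.card = q ∨ (q : ℝ) * responseChord x c 0 < L.card * responseChord x c 0 := by
    refine hcard.imp_right fun h => ?_
    have := mul_pos h (mul_pos (legResponse_pos hx (Nat.le_of_succ_le hc)) (legResponse_pos hx hc))
    rw [mul_assoc, ← responseChord_zero hx hc] at this
    linarith
  rw [sum_map_legResponse_balanced ht] at hle
  rw [sum_map_responseChord] at hchord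
  have hcard_eq : L.card = q := hnumber.resolve_right fun h => by linarith
  rw [hcard_eq] at hchord
  refine hne (eq_balanced (fun ℓ hℓ => ?_) hcard_eq (hsum.antisymm' ?_))
  · refine (responseChord_lt_or_eq hx hc (hL ℓ hℓ)).resolve_left fun hlt => ?_
    have := Multiset.sum_lt_sum (fun ℓ' hℓ' => (responseChord_lt_or_eq hx hc (hL ℓ' hℓ')).elim
      le_of_lt fun h => (responseChord_eq_legResponse h).le) ⟨ℓ, hℓ, hlt⟩
    rw [sum_map_responseChord, hcard_eq] at this
    linarith
  · exact Nat.cast_le.1 (le_of_mul_le_mul_right (by linarith) hslope)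

theorem balancedOrWorse_of_card_ge (hx : x ∈ rootInterval r) (hc : 2 * c + 1 ≤ r) (ht : t ≤ q)
    {L : Multiset ℕ} (hL : ∀ ℓ ∈ L, ℓ ≤ r) (hsum : q * c + t ≤ L.sum) (hcard : q ≤ L.card) :
    BalancedOrWorse x q c t L := by
  refine balancedOrWorse_of_card hx (by omega) ht hL hsum ?_
  rcases hcard.eq_or_lt with h | h
  · exact Or.inl h.symm
  · have hcoeff := one_sub_pos_of_mem hx hc
    push_cast at hcoeff
    exact Or.inr (mul_pos (sub_pos.2 (Nat.cast_lt.2 h)) hcoeff)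

theorem balancedOrWorse_of_card_le (hx : x ∈ rootInterval r) (hc : r ≤ 2 * c) (hcr : c + 1 ≤ r)
    (ht : t ≤ q) {L : Multiset ℕ} (hL : ∀ ℓ ∈ L, ℓ ≤ r) (hsum : q * c + t ≤ L.sum)
    (hcard : L.card ≤ q) : BalancedOrWorse x q c t L := by
  refine balancedOrWorse_of_card hx hcr ht hL hsum (hcard.eq_or_lt.imp_right fun h => ?_)
  have hcoeff : 1 - (2 * (c : ℝ) + 1) * x < 0 := by
    have : (r : ℝ) ≤ 2 * c := by exact_mod_cast hc
    nlinarith [one_sub_succ_neg hx, pos_of_mem hx]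
  exact mul_pos_of_neg_of_neg (sub_neg.2 (Nat.cast_lt.2 h)) hcoeff

end Balanced

section PathGraph

theorem pathGraph_isRooted (r : ℕ) :
    IsRooted (SimpleGraph.pathGraph (2 * r + 2)) ⟨r, by omega⟩
      (fun i => ⟨if (i : ℕ) < r then i + 1 else if (i : ℕ) = r then r else i - 1, by
        have := i.2
        split_ifs <;> omega⟩)
      (fun i => (i - r) + (r - i)) where
  adj_iff x y := by
    rw [SimpleGraph.pathGraph_adj]
    simp only [ne_eq, Fin.ext_iff]
    split_ifs <;> omega
  parent_root := by simp
  depth_root := by simp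
  depth_parent x hx := by
    simp only [ne_eq, Fin.ext_iff] at hx ⊢
    split_ifs <;> omega

/-- The position on the path with `2 * r + 2` vertices of each vertex of the spider with legs of
lengths `r + 1` (mapped to the right of the center `r`) and `r` (mapped to the left). -/
def pathPosition (r : ℕ) : Option (Σ b : Bool, Fin (cond b (r + 1) r)) → Fin (2 * r + 2)
  | none => ⟨r, by omega⟩
  | some ⟨true, j⟩ => ⟨r + 1 + j, by have : (j : ℕ) < r + 1 := j.2; omega⟩
  | some ⟨false, j⟩ => ⟨r - 1 - j, by omega⟩

theorem pathPosition_bijective (r : ℕ) : Function.Bijective (pathPosition r) := by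
  rw [Fintype.bijective_iff_surjective_and_card]
  refine ⟨fun i => ?_, ?_⟩
  · rcases lt_trichotomy (i : ℕ) r with hi | hi | hi
    · exact ⟨some ⟨false, ⟨r - 1 - i, by simp only [cond_false]; omega⟩⟩,
        Fin.ext (by simp only [pathPosition]; omega)⟩
    · exact ⟨none, Fin.ext hi.symm⟩
    · exact ⟨some ⟨true, ⟨i - (r + 1), by simp only [cond_true]; omega⟩⟩,
        Fin.ext (by simp only [pathPosition]; omega)⟩
  · simp only [Fintype.card_option, Fintype.card_sigma, Fintype.card_fin, Fintype.sum_bool,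
      cond_true, cond_false]
    omega

theorem nonempty_spider_iso_pathGraph (r : ℕ) :
    Nonempty (spider (fun b : Bool => cond b (r + 1) r) ≃g SimpleGraph.pathGraph (2 * r + 2)) := by
  refine (spider_isRooted _).nonempty_iso (pathGraph_isRooted r)
    (Equiv.ofBijective _ (pathPosition_bijective r)) rfl ?_
  rintro (_ | ⟨_ | _, ⟨_ | j, hj⟩⟩) hx
  · exact absurd rfl hx
  all_goals
    simp only [cond_true, cond_false] at hj
    simp only [Equiv.ofBijective_apply, pathPosition, spiderParent, Fin.mk.injEq]
    split_ifs <;> omega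

theorem nonempty_almostSeesaw_iso_pathGraph (r : ℕ) :
    Nonempty (almostSeesaw r 2 0 0 ≃g SimpleGraph.pathGraph (2 * r + 2)) := by
  obtain ⟨e⟩ := nonempty_spider_iso_pathGraph r
  obtain ⟨e'⟩ : Nonempty (almostSeesaw r 2 0 0 ≃g spider fun b : Bool => cond b (r + 1) r) := by
    refine spider_iso_of_map_eq ?_
    rw [map_asLengths le_rfl]
    simp [balanced]
  exact ⟨e'.trans e⟩

end PathGraph

section Candidates

/-- `AS(r, q + 2, c, t)` is a spider of diameter `2 * r + 1` with `2 * r + 2 + M` vertices, that is,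
it has `q` lateral branches of total length `M`. -/
structure IsCandidate (r M q c t : ℕ) : Prop where
  isSeesawLike : IsSeesawLike r (asLengths r (q + 2) c t) 0 1
  le : t ≤ q
  eq : M = q * c + t

namespace IsCandidate

variable {r M q c t : ℕ} {x : ℝ}

theorem isAdmissible (h : IsCandidate r M q c t) :
    IsAdmissible (2 * r + 2 + M) (2 * r + 1) (almostSeesaw r (q + 2) c t) :=
  h.isSeesawLike.isAdmissible (by rw [sum_asLengths h.le, h.eq])

theorem strictMonoOn_rootFunction (h : IsCandidate r M q c t) :
    StrictMonoOn (rootFunction r q c t) (rootInterval r) := by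
  rw [funext (rootFunction_eq h.le)]
  exact h.isSeesawLike.strictMonoOn_sum_legResponse

theorem isUniqueRoot_lambda2 (h : IsCandidate r M q c t) :
    IsUniqueRoot (rootFunction r q c t) (rootInterval r)
      (lambda2 (almostSeesaw r (q + 2) c t)) := by
  rw [funext (rootFunction_eq h.le)]
  obtain ⟨x, hx, h0⟩ := h.isSeesawLike.exists_root
  rw [h.isSeesawLike.lambda2_eq hx h0]
  exact h.isSeesawLike.isUniqueRoot hx h0

theorem lambda2_mem (h : IsCandidate r M q c t) :
    lambda2 (almostSeesaw r (q + 2) c t) ∈ rootInterval r :=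
  h.isUniqueRoot_lambda2.1

theorem lambda2_le_iff (h : IsCandidate r M q c t) (hx : x ∈ rootInterval r) :
    lambda2 (almostSeesaw r (q + 2) c t) ≤ x ↔ 0 ≤ rootFunction r q c t x := by
  rw [← h.strictMonoOn_rootFunction.le_iff_le h.lambda2_mem hx, h.isUniqueRoot_lambda2.2.1]

theorem lambda2_lt_iff (h : IsCandidate r M q c t) (hx : x ∈ rootInterval r) :
    lambda2 (almostSeesaw r (q + 2) c t) < x ↔ 0 < rootFunction r q c t x := by
  rw [← h.strictMonoOn_rootFunction.lt_iff_lt h.lambda2_mem hx, h.isUniqueRoot_lambda2.2.1]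

theorem lt_lambda2_iff (h : IsCandidate r M q c t) (hx : x ∈ rootInterval r) :
    x < lambda2 (almostSeesaw r (q + 2) c t) ↔ rootFunction r q c t x < 0 := by
  rw [← h.strictMonoOn_rootFunction.lt_iff_lt hx h.lambda2_mem, h.isUniqueRoot_lambda2.2.1]

theorem neg_le_sum_legResponse (h : IsCandidate r M q c t) (hx : x ∈ rootInterval r)
    (hle : lambda2 (almostSeesaw r (q + 2) c t) ≤ x) :
    -(legResponse x (r + 1) + legResponse x r) ≤ ((balanced q c t).map (legResponse x)).sum := by
  rw [h.lambda2_le_iff hx, rootFunction_eq h.le, sum_legResponse_asLengths h.le] at hle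
  linarith

end IsCandidate

/-- Every tree of order `n` and diameter `D` other than `A` and `B` has smaller `lambda2` than the
better one of `A` and `B`. -/
structure IsExtremizingPair {V W : Type*} [Fintype V] [Fintype W] (n D : ℕ) (A : SimpleGraph V)
    (B : SimpleGraph W) : Prop where
  left : IsAdmissible n D A
  right : IsAdmissible n D B
  iso_or_iso_or_lt (G : SimpleGraph (Fin n)) : IsAdmissible n D G →
    Nonempty (G ≃g A) ∨ Nonempty (G ≃g B) ∨ lambda2 G < max (lambda2 A) (lambda2 B)

namespace IsExtremizingPair

variable {V W : Type*} [Fintype V] [Fintype W] {n D : ℕ} {A : SimpleGraph V} {B : SimpleGraph W}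

theorem symm (h : IsExtremizingPair n D A B) : IsExtremizingPair n D B A where
  left := h.right
  right := h.left
  iso_or_iso_or_lt G hG := by
    rw [max_comm, or_left_comm]
    exact h.iso_or_iso_or_lt G hG

theorem onlyCandidates (h : IsExtremizingPair n D A B) : OnlyCandidates n D A B := fun G hG => by
  rcases h.iso_or_iso_or_lt G hG.1 with hA | hB | hlt
  · exact Or.inl hA
  · exact Or.inr hB
  · exact absurd hlt (max_le (hG.lambda2_le h.left) (hG.lambda2_le h.right)).not_gt

theorem isExtremizer_left (h : IsExtremizingPair n D A B) (hle : lambda2 B ≤ lambda2 A) :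
    IsExtremizer n D A := by
  refine ⟨h.left, fun G hG => ?_⟩
  rcases h.iso_or_iso_or_lt G hG with ⟨⟨e⟩⟩ | ⟨⟨e⟩⟩ | hlt
  · exact (lambda2_iso e).le
  · exact (lambda2_iso e).trans_le hle
  · exact (hlt.trans_eq (max_eq_left hle)).le

theorem isUniqueExtremizer_left (h : IsExtremizingPair n D A B) (hlt : lambda2 B < lambda2 A) :
    IsUniqueExtremizer n D A := by
  refine ⟨h.isExtremizer_left hlt.le, fun G hG => (h.onlyCandidates G hG).resolve_right ?_⟩
  rintro ⟨e⟩
  exact (hG.lambda2_le h.left).not_gt ((lambda2_iso e).trans_lt hlt)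

theorem isUniqueExtremizer (h : IsExtremizingPair n D A A) : IsUniqueExtremizer n D A :=
  ⟨h.isExtremizer_left le_rfl, fun G hG => or_self_iff.1 (h.onlyCandidates G hG)⟩

end IsExtremizingPair

namespace IsCandidate

variable {r M q c t q₁ c₁ t₁ q₂ c₂ t₂ : ℕ}

theorem nonempty_iso_or_lambda2_lt {V : Type*} [Fintype V] {G : SimpleGraph V} {z : ℝ}
    (h₁ : IsCandidate r M q₁ c₁ t₁) (h₂ : IsCandidate r M q₂ c₂ t₂)
    (hG : IsAdmissible (2 * r + 2 + M) (2 * r + 1) G) (hz : z ∈ rootInterval r)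
    (hle₁ : lambda2 (almostSeesaw r (q₁ + 2) c₁ t₁) ≤ z)
    (hle₂ : lambda2 (almostSeesaw r (q₂ + 2) c₂ t₂) ≤ z)
    (hopt : ∀ L : Multiset ℕ, (∀ ℓ ∈ L, 1 ≤ ℓ ∧ ℓ ≤ r) → M ≤ L.sum →
      BalancedOrWorse z q₁ c₁ t₁ L ∨ BalancedOrWorse z q₂ c₂ t₂ L) :
    Nonempty (G ≃g almostSeesaw r (q₁ + 2) c₁ t₁) ∨
      Nonempty (G ≃g almostSeesaw r (q₂ + 2) c₂ t₂) ∨ lambda2 G < z := by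
  have hsum₁ := h₁.neg_le_sum_legResponse hz hle₁
  have hsum₂ := h₂.neg_le_sum_legResponse hz hle₂
  have hopt' (L : Multiset ℕ) (hL : ∀ ℓ ∈ L, 1 ≤ ℓ ∧ ℓ ≤ r) (hLM : M ≤ L.sum) :
      -(legResponse z (r + 1) + legResponse z r) ≤ (L.map (legResponse z)).sum :=
    (hopt L hL hLM).elim (hsum₁.trans ·.le) (hsum₂.trans ·.le)
  rcases lt_or_ge (lambda2 G) z with hlt | hge
  · exact Or.inr (Or.inr hlt)
  · obtain ⟨L, hL, hLM, hsum, hiso⟩ :=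
      hG.exists_nonempty_iso_spider_of_le_lambda2 rfl hz hopt' hge
    rcases hopt L hL hLM with (rfl | hlt) | (rfl | hlt)
    · exact Or.inl (hiso (map_asLengths h₁.le))
    · exact absurd (hsum₁.trans_lt hlt) hsum.not_gt
    · exact Or.inr (Or.inl (hiso (map_asLengths h₂.le)))
    · exact absurd (hsum₂.trans_lt hlt) hsum.not_gt

theorem isExtremizingPair (h₁ : IsCandidate r M q₁ c₁ t₁) (h₂ : IsCandidate r M q₂ c₂ t₂)
    (hopt : ∀ z ∈ rootInterval r, ∀ L : Multiset ℕ, (∀ ℓ ∈ L, 1 ≤ ℓ ∧ ℓ ≤ r) → M ≤ L.sum →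
      BalancedOrWorse z q₁ c₁ t₁ L ∨ BalancedOrWorse z q₂ c₂ t₂ L) :
    IsExtremizingPair (2 * r + 2 + M) (2 * r + 1) (almostSeesaw r (q₁ + 2) c₁ t₁)
      (almostSeesaw r (q₂ + 2) c₂ t₂) where
  left := h₁.isAdmissible
  right := h₂.isAdmissible
  iso_or_iso_or_lt G hG := by
    have hz : max (lambda2 (almostSeesaw r (q₁ + 2) c₁ t₁))
        (lambda2 (almostSeesaw r (q₂ + 2) c₂ t₂)) ∈ rootInterval r :=
      max_rec' (· ∈ rootInterval r) h₁.lambda2_mem h₂.lambda2_mem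
    exact h₁.nonempty_iso_or_lambda2_lt h₂ hG hz (le_max_left _ _) (le_max_right _ _) (hopt _ hz)

theorem isUniqueExtremizer (h : IsCandidate r M q c t)
    (hopt : ∀ z ∈ rootInterval r, ∀ L : Multiset ℕ, (∀ ℓ ∈ L, 1 ≤ ℓ ∧ ℓ ≤ r) → M ≤ L.sum →
      BalancedOrWorse z q c t L) :
    IsUniqueExtremizer (2 * r + 2 + M) (2 * r + 1) (almostSeesaw r (q + 2) c t) :=
  (h.isExtremizingPair h fun z hz L hL hLM => Or.inl (hopt z hz L hL hLM)).isUniqueExtremizer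

end IsCandidate

end Candidates

section Threshold

variable {r s t k : ℕ} {x y ζ : ℝ}

theorem thresholdPoly_div_sq (s t : ℕ) (hx : x ≠ 0) :
    thresholdPoly s t x / x ^ 2
      = x⁻¹ ^ 2 - 3 * s * x⁻¹ + (2 * (s : ℝ) ^ 2 + s - 2 * t - 1) := by
  unfold thresholdPoly
  field_simp

theorem thresholdPoly_one_div_div_sq (s t : ℕ) (hx : x ≠ 0) :
    thresholdPoly s t (1 / x) / (1 / x) ^ 2
      = x ^ 2 - 3 * s * x + (2 * (s : ℝ) ^ 2 + s - 2 * t - 1) := by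
  rw [thresholdPoly_div_sq s t (one_div_ne_zero hx), one_div, inv_inv]

theorem strictAntiOn_thresholdPoly_div_sq (hr : 1 ≤ r) (hsr : 3 * s ≤ 2 * r) :
    StrictAntiOn (fun x => thresholdPoly s t x / x ^ 2) (Set.Icc (1 / ((r : ℝ) + 1)) (1 / r)) := by
  intro x hx y hy hxy
  have hr0 : (0 : ℝ) < r := by exact_mod_cast hr
  have hx0 : 0 < x := lt_of_lt_of_le (by positivity) hx.1
  have hyr : (r : ℝ) ≤ y⁻¹ := by
    rw [le_inv_comm₀ hr0 (hx0.trans hxy), ← one_div]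
    exact hy.2
  have hyx : y⁻¹ < x⁻¹ := inv_strictAnti₀ hx0 hxy
  have hsr' : 3 * (s : ℝ) ≤ 2 * r := by exact_mod_cast hsr
  simp only [thresholdPoly_div_sq s t hx0.ne', thresholdPoly_div_sq s t (hx0.trans hxy).ne']
  nlinarith

theorem rootInterval_subset_Icc (r : ℕ) :
    rootInterval r ⊆ Set.Icc (1 / ((r : ℝ) + 1)) (1 / r) :=
  Set.Ioo_subset_Icc_self

theorem thresholdPoly_pos (hr : r = 2 * s) (ht : 2 * t + 1 ≤ s) (hx : x ∈ rootInterval r) :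
    0 < thresholdPoly s t x := by
  have hr1 := one_le_of_mem hx
  have hlt := strictAntiOn_thresholdPoly_div_sq (s := s) (t := t) hr1 (by omega)
    (rootInterval_subset_Icc r hx) (Set.right_mem_Icc.2 (hx.1.trans hx.2).le) hx.2
  have hend : 0 ≤ thresholdPoly s t (1 / r) / (1 / (r : ℝ)) ^ 2 := by
    have ht' : 2 * (t : ℝ) + 1 ≤ s := by exact_mod_cast ht
    rw [thresholdPoly_one_div_div_sq s t (by positivity), hr, Nat.cast_mul, Nat.cast_two]
    linarith
  exact (div_pos_iff_of_pos_right (pow_pos (pos_of_mem hx) 2)).1 (hend.trans_lt hlt)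

theorem thresholdPoly_neg (hr : r + 1 = 2 * s) (hs : 2 ≤ s) (ht : s ≤ 2 * t + 1)
    (hx : x ∈ rootInterval r) : thresholdPoly s t x < 0 := by
  have hlt := strictAntiOn_thresholdPoly_div_sq (s := s) (t := t) (one_le_of_mem hx) (by omega)
    (Set.left_mem_Icc.2 (hx.1.trans hx.2).le) (rootInterval_subset_Icc r hx) hx.1
  have hend : thresholdPoly s t (1 / ((r : ℝ) + 1)) / (1 / ((r : ℝ) + 1)) ^ 2 ≤ 0 := by
    have hr' : (r : ℝ) + 1 = 2 * s := by exact_mod_cast hr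
    have ht' : (s : ℝ) ≤ 2 * t + 1 := by exact_mod_cast ht
    rw [thresholdPoly_one_div_div_sq s t (by positivity), hr']
    linarith
  simpa using (div_lt_iff₀ (pow_pos (pos_of_mem hx) 2)).1 (hlt.trans_le hend)

theorem thresholdPoly_left_end_pos (hts : t + 1 ≤ s)
    (h : r = 2 * s ∨ r + 1 = 2 * s ∧ 2 * t + 2 ≤ s) :
    0 < thresholdPoly s t (1 / ((r : ℝ) + 1)) := by
  rw [← div_pos_iff_of_pos_right (pow_pos (one_div_pos.2 r.cast_add_one_pos) 2),
    thresholdPoly_one_div_div_sq s t (by positivity)]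
  rcases h with rfl | ⟨hr, ht⟩
  · have hts' : (t : ℝ) + 1 ≤ s := by exact_mod_cast hts
    push_cast
    linarith
  · have hr' : (r : ℝ) + 1 = 2 * s := by exact_mod_cast hr
    have ht' : 2 * (t : ℝ) + 2 ≤ s := by exact_mod_cast ht
    rw [hr']
    linarith

theorem thresholdPoly_right_end_neg (hr : 1 ≤ r) (ht : 1 ≤ t)
    (h : r = 2 * s ∧ s ≤ 2 * t ∨ r + 1 = 2 * s) : thresholdPoly s t (1 / (r : ℝ)) < 0 := by
  have ht' : (1 : ℝ) ≤ t := by exact_mod_cast ht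
  have hneg : thresholdPoly s t (1 / (r : ℝ)) / (1 / (r : ℝ)) ^ 2 < 0 := by
    rw [thresholdPoly_one_div_div_sq s t (by positivity)]
    rcases h with ⟨rfl, hst⟩ | h
    · have hst' : (s : ℝ) ≤ 2 * t := by exact_mod_cast hst
      push_cast
      linarith
    · have hr' : (r : ℝ) = 2 * s - 1 := eq_sub_of_add_eq (by exact_mod_cast h)
      rw [hr']
      linarith
  simpa using (div_lt_iff₀ (by positivity)).1 hneg

theorem exists_isUniqueRoot_thresholdPoly (hs : 2 ≤ s) (ht : 1 ≤ t) (hts : t + 1 ≤ s)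
    (h : r = 2 * s ∧ s ≤ 2 * t ∨ r + 1 = 2 * s ∧ 2 * t + 2 ≤ s) :
    ∃ ζ, IsUniqueRoot (thresholdPoly s t) (rootInterval r) ζ := by
  have hr : 1 ≤ r := by omega
  have hle : 1 / ((r : ℝ) + 1) ≤ 1 / r := by gcongr; linarith
  have hcont : Continuous (thresholdPoly s t) := by unfold thresholdPoly; fun_prop
  obtain ⟨ζ, hζ, h0⟩ := intermediate_value_Ioo' hle hcont.continuousOn
    ⟨thresholdPoly_right_end_neg hr ht (h.imp_right And.left),
      thresholdPoly_left_end_pos hts (h.imp_left And.left)⟩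
  refine ⟨ζ, hζ, h0, fun y hy hy0 =>
    (strictAntiOn_thresholdPoly_div_sq (s := s) (t := t) hr (by omega)).injOn
      (rootInterval_subset_Icc r hy) (rootInterval_subset_Icc r hζ) ?_⟩
  simp only [h0, hy0, zero_div]

theorem thresholdPoly_pos_iff (hsr : 3 * s ≤ 2 * r)
    (hζ : IsUniqueRoot (thresholdPoly s t) (rootInterval r) ζ) (hy : y ∈ rootInterval r) :
    0 < thresholdPoly s t y ↔ y < ζ := by
  rw [← (strictAntiOn_thresholdPoly_div_sq (s := s) (t := t) (one_le_of_mem hy) hsr).lt_iff_gt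
    (rootInterval_subset_Icc r hζ.1) (rootInterval_subset_Icc r hy), hζ.2.1, zero_div,
    div_pos_iff_of_pos_right (pow_pos (pos_of_mem hy) 2)]

theorem thresholdPoly_neg_iff (hsr : 3 * s ≤ 2 * r)
    (hζ : IsUniqueRoot (thresholdPoly s t) (rootInterval r) ζ) (hy : y ∈ rootInterval r) :
    thresholdPoly s t y < 0 ↔ ζ < y := by
  rw [← (strictAntiOn_thresholdPoly_div_sq (s := s) (t := t) (one_le_of_mem hy) hsr).lt_iff_gt
    (rootInterval_subset_Icc r hy) (rootInterval_subset_Icc r hζ.1), hζ.2.1, zero_div,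
    div_lt_iff₀ (pow_pos (pos_of_mem hy) 2), zero_mul]

theorem rootFunction_treeB_eq (hs : 1 ≤ s) (hk : s ≤ k) (x : ℝ) :
    rootFunction r (k + 1) (s - 1) (k + t + 1 - s) x
      = 1 / (1 - ((r : ℝ) + 1) * x) + 1 / (1 - (r : ℝ) * x)
        + ((k : ℝ) + t + 1 - s) / (1 - (s : ℝ) * x)
        + ((s : ℝ) - t) / (1 - ((s : ℝ) - 1) * x) := by
  rw [rootFunction, Nat.cast_sub (by omega : s ≤ k + t + 1), Nat.cast_sub hs]
  push_cast
  rw [sub_add_cancel]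
  ring

theorem rootFunction_treeA_sub_treeB (hs : 1 ≤ s) (hsr : s + 1 ≤ r) (hk : s ≤ k)
    (hx : x ∈ rootInterval r) :
    rootFunction r k s t x - rootFunction r (k + 1) (s - 1) (k + t + 1 - s) x
      = -thresholdPoly s t x
        * (legResponse x (s - 1) * legResponse x s * legResponse x (s + 1)) := by
  have hpred := one_sub_pos_of_mem hx (by omega : s - 1 ≤ r)
  have hmid := one_sub_pos_of_mem hx (by omega : s ≤ r)
  have hsucc := one_sub_pos_of_mem hx hsr
  rw [Nat.cast_sub hs, Nat.cast_one] at hpred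
  rw [Nat.cast_add_one] at hsucc
  have hprod : (1 - ((s : ℝ) - 1) * x) * (1 - s * x) * (1 - ((s : ℝ) + 1) * x) ≠ 0 := by
    positivity
  rw [rootFunction_treeB_eq hs hk, rootFunction, thresholdPoly, legResponse, legResponse,
    legResponse, Nat.cast_sub hs, Nat.cast_one, Nat.cast_add_one, one_div_mul_one_div,
    one_div_mul_one_div, mul_one_div, eq_div_iff hprod]
  linear_combination
    t * (1 - ((s : ℝ) - 1) * x) * (1 - s * x) * one_div_mul_cancel hsucc.ne'
      + (s - 2 * t - 1) * (1 - ((s : ℝ) - 1) * x) * (1 - (s + 1) * x)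
        * one_div_mul_cancel hmid.ne'
      - (s - t) * (1 - s * x) * (1 - (s + 1) * x) * one_div_mul_cancel hpred.ne'

theorem legResponse_mul_pos (hsr : s + 1 ≤ r) (hx : x ∈ rootInterval r) :
    0 < legResponse x (s - 1) * legResponse x s * legResponse x (s + 1) :=
  mul_pos (mul_pos (legResponse_pos hx (by omega)) (legResponse_pos hx (by omega)))
    (legResponse_pos hx hsr)

theorem rootFunction_treeA_lt_iff (hs : 1 ≤ s) (hsr : s + 1 ≤ r) (hk : s ≤ k)
    (hx : x ∈ rootInterval r) :
    rootFunction r k s t x < rootFunction r (k + 1) (s - 1) (k + t + 1 - s) x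
      ↔ 0 < thresholdPoly s t x := by
  rw [← sub_neg, rootFunction_treeA_sub_treeB hs hsr hk hx, neg_mul, neg_lt_zero,
    mul_pos_iff_of_pos_right (legResponse_mul_pos hsr hx)]

theorem rootFunction_treeB_lt_iff (hs : 1 ≤ s) (hsr : s + 1 ≤ r) (hk : s ≤ k)
    (hx : x ∈ rootInterval r) :
    rootFunction r (k + 1) (s - 1) (k + t + 1 - s) x < rootFunction r k s t x
      ↔ thresholdPoly s t x < 0 := by
  rw [← sub_pos, rootFunction_treeA_sub_treeB hs hsr hk hx,
    mul_pos_iff_of_pos_right (legResponse_mul_pos hsr hx), neg_pos]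

theorem sub_kappa (hs : 1 ≤ s) (hsr : s ≤ r) (hk : s ≤ k) (hx : x ∈ rootInterval r) :
    (k : ℝ) - kappa r s t x
      = (1 - s * x) * rootFunction r (k + 1) (s - 1) (k + t + 1 - s) x := by
  have hmid := one_sub_pos_of_mem hx hsr
  rw [rootFunction_treeB_eq hs hk, kappa]
  linear_combination (-(k : ℝ)) * one_div_mul_cancel hmid.ne'

end Threshold

section Cases

variable {r s k t M : ℕ}

theorem two_mul_ceil_half_le_and_le (hs : s = ⌈(r : ℚ) / 2⌉₊) : 2 * s ≤ r + 1 ∧ r ≤ 2 * s := by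
  have hle : (r : ℚ) / 2 ≤ s := hs ▸ Nat.le_ceil _
  have hlt : (s : ℚ) < r / 2 + 1 := hs ▸ Nat.ceil_lt_add_one (by positivity)
  have hle' : (r : ℚ) ≤ 2 * s := by linarith
  have hlt' : (2 : ℚ) * s < r + 2 := by linarith
  norm_cast at hle' hlt'
  omega

theorem qMinus_eq (hk : 1 ≤ k) (hts : t + 1 ≤ s) : qMinus s (k * s + t) = k := by
  rw [qMinus, Nat.div_eq_of_lt_le (k := k) (by omega) (by linarith), max_eq_right hk]

theorem qPlus_eq (ht : 1 ≤ t) (hts : t ≤ s) : qPlus s (k * s + t) = k + 1 := by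
  have hs0 : (0 : ℚ) < s := by exact_mod_cast (by omega : 0 < s)
  have ht' : (1 : ℚ) ≤ t := by exact_mod_cast ht
  have hts' : (t : ℚ) ≤ s := by exact_mod_cast hts
  rw [qPlus, Nat.ceil_eq_iff (by omega), lt_div_iff₀ hs0, div_le_iff₀ hs0]
  push_cast
  constructor <;> linarith

theorem qMinus_mul {q : ℕ} (hs : 1 ≤ s) (hq : 1 ≤ q) : qMinus s (s * q) = q := by
  rw [qMinus, Nat.mul_div_cancel_left q hs, max_eq_right hq]

theorem qPlus_mul (hs : 1 ≤ s) (q : ℕ) : qPlus s (s * q) = q := by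
  rw [qPlus, Nat.cast_mul, mul_div_cancel_left₀ _ (by positivity), Nat.ceil_natCast]

theorem isUniqueExtremizer_pathGraph (hr : 1 ≤ r) :
    IsUniqueExtremizer (2 * r + 2) (2 * r + 1) (SimpleGraph.pathGraph (2 * r + 2)) := by
  obtain ⟨e⟩ := nonempty_almostSeesaw_iso_pathGraph r
  have hcand : IsCandidate r 0 0 0 0 :=
    ⟨asLengths_isSeesawLike hr (.inl rfl) (.inl rfl), le_rfl, rfl⟩
  refine IsUniqueExtremizer.of_iso e (hcand.isUniqueExtremizer fun z hz L hL _ => ?_)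
  exact balancedOrWorse_of_card_ge hz (by omega) le_rfl (fun ℓ hℓ => (hL ℓ hℓ).2) (Nat.zero_le _)
    (Nat.zero_le _)

theorem isUniqueExtremizer_of_lt (hM : 1 ≤ M) (hMr : 2 * M + 1 ≤ r) :
    IsUniqueExtremizer (2 * r + 2 + M) (2 * r + 1) (almostSeesaw r 3 M 0) := by
  have hcand : IsCandidate r M 1 M 0 :=
    ⟨asLengths_isSeesawLike (by omega) (.inr (by omega)) (.inl rfl), by omega, by simp⟩
  refine hcand.isUniqueExtremizer fun z hz L hL hLM => ?_
  refine balancedOrWorse_of_card_ge hz hMr (by omega) (fun ℓ hℓ => (hL ℓ hℓ).2) (by omega)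
    (Multiset.card_pos.2 ?_)
  rintro rfl
  rw [Multiset.sum_zero] at hLM
  omega

theorem isUniqueExtremizer_of_eq_mul {q : ℕ} (hs : 1 ≤ s) (hsr : s + 1 ≤ r) (hs2 : 2 * s ≤ r + 1)
    (hrs : r ≤ 2 * s) :
    IsUniqueExtremizer (2 * r + 2 + s * q) (2 * r + 1) (almostSeesaw r (q + 2) s 0) := by
  have hcand : IsCandidate r (s * q) q s 0 :=
    ⟨asLengths_isSeesawLike (by omega) (.inr (by omega)) (.inl rfl), by omega, by ring⟩
  refine hcand.isUniqueExtremizer fun z hz L hL hLM => ?_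
  have hLr : ∀ ℓ ∈ L, ℓ ≤ r := fun ℓ hℓ => (hL ℓ hℓ).2
  rcases le_total q L.card with hcard | hcard
  · obtain ⟨c, rfl⟩ := Nat.exists_eq_add_of_le' hs
    exact (balancedOrWorse_of_card_ge hz (by omega) le_rfl hLr (by linarith) hcard).succ
  · exact balancedOrWorse_of_card_le hz hrs hsr (by omega) hLr (by linarith) hcard

-- Branches of length at least `r / 2` are not worth merging, and shorter ones not worth splitting.
theorem IsCandidate.isExtremizingPair_succ {c₁ t₁ c₂ t₂ : ℕ} (h₁ : IsCandidate r M k c₁ t₁)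
    (h₂ : IsCandidate r M (k + 1) c₂ t₂)
    (hc₁ : r ≤ 2 * c₁ ∧ c₁ + 1 ≤ r ∨ t₁ = 0 ∧ r + 2 ≤ 2 * c₁ ∧ c₁ ≤ r) (hc₂ : 2 * c₂ + 1 ≤ r) :
    IsExtremizingPair (2 * r + 2 + M) (2 * r + 1) (almostSeesaw r (k + 2) c₁ t₁)
      (almostSeesaw r (k + 1 + 2) c₂ t₂) := by
  refine h₁.isExtremizingPair h₂ fun z hz L hL hLM => ?_
  have hLr : ∀ ℓ ∈ L, ℓ ≤ r := fun ℓ hℓ => (hL ℓ hℓ).2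
  rcases Nat.lt_or_ge k L.card with hcard | hcard
  · exact Or.inr (balancedOrWorse_of_card_ge hz hc₂ h₂.le hLr (h₂.eq.symm.trans_le hLM) hcard)
  · have hsum := h₁.eq.symm.trans_le hLM
    rcases hc₁ with ⟨hrc, hcr⟩ | ⟨rfl, hrc, hcr⟩
    · exact Or.inl (balancedOrWorse_of_card_le hz hrc hcr h₁.le hLr hsum hcard)
    · obtain ⟨c, rfl⟩ : ∃ c, c₁ = c + 1 := Nat.exists_eq_add_of_le' (by omega)
      exact Or.inl
        (balancedOrWorse_of_card_le hz (by omega) hcr le_rfl hLr (by linarith) hcard).succ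

theorem div_add_one_le (hk : 2 ≤ k) (ht : 1 ≤ t) (hts : t + 1 ≤ s) (hs2 : 2 * s ≤ r + 1) :
    (k * s + t) / k + 1 ≤ r := by
  have : t / k ≤ t / 2 := Nat.div_le_div_left hk two_pos
  rw [Nat.mul_add_div (by omega)]
  omega

theorem isCandidate_div (hk : 1 ≤ k) (ht : 1 ≤ t) (hts : t + 1 ≤ s) (hs2 : 2 * s ≤ r + 1) :
    IsCandidate r (k * s + t) k ((k * s + t) / k) ((k * s + t) % k) := by
  refine ⟨?_, (Nat.mod_lt _ hk).le, (Nat.div_add_mod _ _).symm⟩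
  rcases hk.eq_or_lt with rfl | hk2
  · rw [Nat.div_one, Nat.mod_one]
    exact asLengths_isSeesawLike (by omega) (.inr (by omega)) (.inl rfl)
  · have hle := div_add_one_le hk2 ht hts hs2
    have hpos : 1 ≤ (k * s + t) / k := (Nat.one_le_div_iff hk).2 (by nlinarith)
    exact asLengths_isSeesawLike (by omega) (.inr (by omega)) (.inr hle)

theorem div_succ_lt (hts : t + 1 ≤ s) : (k * s + t) / (k + 1) < s := by
  rw [Nat.div_lt_iff_lt_mul (by omega)]
  linarith

theorem isCandidate_div_succ (hts : t + 1 ≤ s) (hs : 2 ≤ s) (hk : 1 ≤ k) (hs2 : 2 * s ≤ r + 1) :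
    IsCandidate r (k * s + t) (k + 1) ((k * s + t) / (k + 1)) ((k * s + t) % (k + 1)) := by
  have hlt := div_succ_lt (k := k) hts
  have hpos : 1 ≤ (k * s + t) / (k + 1) := (Nat.one_le_div_iff (by omega)).2 (by nlinarith)
  exact ⟨asLengths_isSeesawLike (by omega) (.inr (by omega)) (.inr (by omega)),
    (Nat.mod_lt _ (by omega)).le, (Nat.div_add_mod _ _).symm⟩

theorem isExtremizingPair_candidate (hk : 1 ≤ k) (ht : 1 ≤ t) (hts : t + 1 ≤ s)
    (hs2 : 2 * s ≤ r + 1) (hrs : r ≤ 2 * s) :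
    IsExtremizingPair (2 * r + 2 + (k * s + t)) (2 * r + 1) (candidate r (k * s + t) k)
      (candidate r (k * s + t) (k + 1)) := by
  have hlt := div_succ_lt (k := k) hts
  refine (isCandidate_div hk ht hts hs2).isExtremizingPair_succ
    (isCandidate_div_succ hts (by omega) hk hs2) ?_ (by omega)
  rcases hk.eq_or_lt with rfl | hk2
  · rw [Nat.div_one, Nat.mod_one]
    omega
  · have hle : s ≤ (k * s + t) / k := (Nat.le_div_iff_mul_le hk).2 (by linarith)
    exact Or.inl ⟨by omega, div_add_one_le hk2 ht hts hs2⟩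

section LargeQuotient

theorem isCandidate_treeA (hs : 1 ≤ s) (hsr : s + 1 ≤ r) (htk : t ≤ k) :
    IsCandidate r (k * s + t) k s t :=
  ⟨asLengths_isSeesawLike (by omega) (.inr (by omega)) (.inr hsr), htk, rfl⟩

theorem isCandidate_treeB (hs : 2 ≤ s) (hsr : s ≤ r) (hts : t ≤ s) (hsk : s ≤ k) :
    IsCandidate r (k * s + t) (k + 1) (s - 1) (k + t + 1 - s) := by
  refine ⟨asLengths_isSeesawLike (by omega) (.inr (by omega)) (.inr (by omega)), by omega, ?_⟩
  obtain ⟨c, rfl⟩ := Nat.exists_eq_add_of_le' (one_le_two.trans hs)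
  obtain ⟨d, rfl⟩ := Nat.exists_eq_add_of_le hsk
  rw [Nat.add_sub_cancel, show c + 1 + d + t + 1 - (c + 1) = d + t + 1 by omega]
  ring

theorem isExtremizingPair_treeA_treeB (ht : 1 ≤ t) (hts : t + 1 ≤ s) (hsk : s ≤ k)
    (hs2 : 2 * s ≤ r + 1) (hrs : r ≤ 2 * s) :
    IsExtremizingPair (2 * r + 2 + (k * s + t)) (2 * r + 1) (treeA r s k t) (treeB r s k t) :=
  (isCandidate_treeA (by omega) (by omega) (by omega)).isExtremizingPair_succ
    (isCandidate_treeB (by omega) (by omega) (by omega) hsk) (by omega) (by omega)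

theorem lambda2_treeB_lt_iff (hs : 2 ≤ s) (hts : t ≤ s) (hsk : s ≤ k) (hsr : s + 1 ≤ r) :
    lambda2 (treeB r s k t) < lambda2 (treeA r s k t)
      ↔ 0 < thresholdPoly s t (lambda2 (treeB r s k t)) := by
  have hA := isCandidate_treeA (by omega) hsr (hts.trans hsk)
  have hB := isCandidate_treeB hs (by omega : s ≤ r) hts hsk
  rw [hA.lt_lambda2_iff hB.lambda2_mem,
    ← rootFunction_treeA_lt_iff (k := k) (by omega) hsr hsk hB.lambda2_mem,
    hB.isUniqueRoot_lambda2.2.1]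

theorem lambda2_treeA_lt_iff (hs : 2 ≤ s) (hts : t ≤ s) (hsk : s ≤ k) (hsr : s + 1 ≤ r) :
    lambda2 (treeA r s k t) < lambda2 (treeB r s k t)
      ↔ thresholdPoly s t (lambda2 (treeB r s k t)) < 0 := by
  have hA := isCandidate_treeA (by omega) hsr (hts.trans hsk)
  have hB := isCandidate_treeB hs (by omega : s ≤ r) hts hsk
  rw [hA.lambda2_lt_iff hB.lambda2_mem,
    ← rootFunction_treeB_lt_iff (k := k) (by omega) hsr hsk hB.lambda2_mem,
    hB.isUniqueRoot_lambda2.2.1]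

variable {ζ : ℝ}

theorem kappa_lt_iff (hs : 2 ≤ s) (hts : t ≤ s) (hsk : s ≤ k) (hsr : 3 * s ≤ 2 * r)
    (hζ : IsUniqueRoot (thresholdPoly s t) (rootInterval r) ζ) :
    kappa r s t ζ < k ↔ lambda2 (treeB r s k t) < lambda2 (treeA r s k t) := by
  have hB := isCandidate_treeB hs (by omega : s ≤ r) hts hsk
  rw [lambda2_treeB_lt_iff hs hts hsk (by omega), thresholdPoly_pos_iff hsr hζ hB.lambda2_mem,
    hB.lambda2_lt_iff hζ.1, ← sub_pos, sub_kappa (by omega) (by omega) hsk hζ.1,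
    mul_pos_iff_of_pos_left (one_sub_pos_of_mem hζ.1 (by omega))]

theorem lt_kappa_iff (hs : 2 ≤ s) (hts : t ≤ s) (hsk : s ≤ k) (hsr : 3 * s ≤ 2 * r)
    (hζ : IsUniqueRoot (thresholdPoly s t) (rootInterval r) ζ) :
    k < kappa r s t ζ ↔ lambda2 (treeA r s k t) < lambda2 (treeB r s k t) := by
  have hB := isCandidate_treeB hs (by omega : s ≤ r) hts hsk
  rw [lambda2_treeA_lt_iff hs hts hsk (by omega), thresholdPoly_neg_iff hsr hζ hB.lambda2_mem,
    hB.lt_lambda2_iff hζ.1, ← sub_neg, sub_kappa (by omega) (by omega) hsk hζ.1]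
  exact smul_neg_iff_of_pos_left (one_sub_pos_of_mem hζ.1 (by omega))

theorem isUniqueExtremizer_treeA (hr : r = 2 * s) (ht : 1 ≤ t) (hts : 2 * t + 1 ≤ s)
    (hsk : s ≤ k) :
    IsUniqueExtremizer (2 * r + 2 + (k * s + t)) (2 * r + 1) (treeA r s k t) :=
  (isExtremizingPair_treeA_treeB ht (by omega) hsk (by omega) (by omega)).isUniqueExtremizer_left <|
    (lambda2_treeB_lt_iff (by omega) (by omega) hsk (by omega)).2 <| thresholdPoly_pos hr hts
      (isCandidate_treeB (by omega) (by omega) (by omega) hsk).lambda2_mem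

theorem isUniqueExtremizer_treeB (hr : r + 1 = 2 * s) (ht : 1 ≤ t) (hts : t + 1 ≤ s)
    (hst : s ≤ 2 * t + 1) (hsk : s ≤ k) :
    IsUniqueExtremizer (2 * r + 2 + (k * s + t)) (2 * r + 1) (treeB r s k t) :=
  (isExtremizingPair_treeA_treeB ht hts hsk (by omega) (by omega)).symm.isUniqueExtremizer_left <|
    (lambda2_treeA_lt_iff (by omega) (by omega) hsk (by omega)).2 <| thresholdPoly_neg hr (by omega)
      hst (isCandidate_treeB (by omega) (by omega) (by omega) hsk).lambda2_mem

theorem exists_threshold_treeA_treeB (ht : 1 ≤ t) (hts : t + 1 ≤ s) (hsk : s ≤ k)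
    (h : r = 2 * s ∧ s ≤ 2 * t ∨ r + 1 = 2 * s ∧ 2 * t + 2 ≤ s) :
    ∃ ζ : ℝ, IsUniqueRoot (thresholdPoly s t) (rootInterval r) ζ ∧
      (kappa r s t ζ < k →
        IsUniqueExtremizer (2 * r + 2 + (k * s + t)) (2 * r + 1) (treeA r s k t)) ∧
      (k < kappa r s t ζ →
        IsUniqueExtremizer (2 * r + 2 + (k * s + t)) (2 * r + 1) (treeB r s k t)) ∧
      (k = kappa r s t ζ →
        IsExtremizer (2 * r + 2 + (k * s + t)) (2 * r + 1) (treeA r s k t) ∧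
          IsExtremizer (2 * r + 2 + (k * s + t)) (2 * r + 1) (treeB r s k t)) := by
  obtain ⟨ζ, hζ⟩ := exists_isUniqueRoot_thresholdPoly (by omega) ht hts h
  have hpair := isExtremizingPair_treeA_treeB (r := r) ht hts hsk (by omega) (by omega)
  have hA := kappa_lt_iff (by omega) (by omega) hsk (by omega) hζ
  have hB := lt_kappa_iff (by omega) (by omega) hsk (by omega) hζ
  exact ⟨ζ, hζ, fun hk => hpair.isUniqueExtremizer_left (hA.1 hk),
    fun hk => hpair.symm.isUniqueExtremizer_left (hB.1 hk),
    fun hk => ⟨hpair.isExtremizer_left (not_lt.1 (hB.not.1 hk.not_lt)),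
      hpair.symm.isExtremizer_left (not_lt.1 (hA.not.1 hk.not_gt))⟩⟩

end LargeQuotient

theorem nonempty_almostSeesaw_three_iso (r M : ℕ) :
    Nonempty (almostSeesaw r 3 M 0 ≃g spider ![r + 1, r, M]) := by
  have h : asLengths r 3 M 0 = ![r + 1, r, M] := by
    ext i
    fin_cases i <;> simp [asLengths]
  exact spider_iso_of_map_eq (by rw [h])

theorem finite_setOf_order_quotient_lt (r s : ℕ) :
    {m : ℕ | ∃ k t : ℕ, m = 2 * r + 2 + (k * s + t) ∧
      1 ≤ k ∧ k + 1 ≤ s ∧ 1 ≤ t ∧ t + 1 ≤ s}.Finite := by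
  refine (Set.finite_Iic (2 * r + 2 + (s * s + s))).subset ?_
  rintro m ⟨k, t, rfl, -, hk, -, ht⟩
  have : k * s ≤ s * s := Nat.mul_le_mul_right s (by omega)
  simp only [Set.mem_Iic]
  omega

end Cases

end SteklovTree

theorem theorem4p3 (r s n M : ℕ) (hr : 2 ≤ r) (hs : s = ⌈(r : ℚ) / 2⌉₊)
    (hn : 2 * r + 2 ≤ n) (hM : M = n - (2 * r + 2)) :
    -- order 2 r + 2
    (M = 0 → IsUniqueExtremizer n (2 * r + 1) (SimpleGraph.pathGraph (2 * r + 2))) ∧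
    -- few extra vertices
    (1 ≤ M → M < s →
      qMinus s M = 1 ∧ qPlus s M = 1 ∧
      IsUniqueExtremizer n (2 * r + 1) (almostSeesaw r 3 M 0) ∧
      Nonempty (almostSeesaw r 3 M 0 ≃g spider ![r + 1, r, M])) ∧
    -- s divides M
    (1 ≤ M → s ∣ M →
      qMinus s M = M / s ∧ qPlus s M = M / s ∧
      IsUniqueExtremizer n (2 * r + 1) (almostSeesaw r (M / s + 2) s 0)) ∧
    -- M not divisible by s, large quotient
    (∀ k t : ℕ, M = k * s + t → 1 ≤ t → t + 1 ≤ s → s ≤ k →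
      OnlyCandidates n (2 * r + 1) (treeA r s k t) (treeB r s k t) ∧
      (r = 2 * s → 2 * t + 1 ≤ s → IsUniqueExtremizer n (2 * r + 1) (treeA r s k t)) ∧
      (r + 1 = 2 * s → s ≤ 2 * t + 1 → IsUniqueExtremizer n (2 * r + 1) (treeB r s k t)) ∧
      ((r = 2 * s ∧ s ≤ 2 * t) ∨ (r + 1 = 2 * s ∧ 2 * t + 2 ≤ s) →
        ∃ ζ : ℝ, IsUniqueRoot (thresholdPoly s t) (rootInterval r) ζ ∧
          (kappa r s t ζ < (k : ℝ) →
            IsUniqueExtremizer n (2 * r + 1) (treeA r s k t)) ∧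
          ((k : ℝ) < kappa r s t ζ →
            IsUniqueExtremizer n (2 * r + 1) (treeB r s k t)) ∧
          ((k : ℝ) = kappa r s t ζ →
            IsExtremizer n (2 * r + 1) (treeA r s k t) ∧
            IsExtremizer n (2 * r + 1) (treeB r s k t)))) ∧
    -- the remaining orders
    (∀ k t : ℕ, M = k * s + t → 1 ≤ k → k + 1 ≤ s → 1 ≤ t → t + 1 ≤ s →
      OnlyCandidates n (2 * r + 1) (candidate r M (qMinus s M)) (candidate r M (qPlus s M)) ∧
      ∃ x y : ℝ,
        IsUniqueRoot (rootFunction r (qMinus s M) (M / qMinus s M) (M % qMinus s M))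
          (rootInterval r) x ∧
        IsUniqueRoot (rootFunction r (qPlus s M) (M / qPlus s M) (M % qPlus s M))
          (rootInterval r) y ∧
        lambda2 (candidate r M (qMinus s M)) = x ∧
        lambda2 (candidate r M (qPlus s M)) = y ∧
        (y < x → IsUniqueExtremizer n (2 * r + 1) (candidate r M (qMinus s M))) ∧
        (x < y → IsUniqueExtremizer n (2 * r + 1) (candidate r M (qPlus s M))) ∧
        (x = y → IsExtremizer n (2 * r + 1) (candidate r M (qMinus s M)) ∧
          IsExtremizer n (2 * r + 1) (candidate r M (qPlus s M)))) ∧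
    {m : ℕ | ∃ k t : ℕ, m = 2 * r + 2 + (k * s + t) ∧
      1 ≤ k ∧ k + 1 ≤ s ∧ 1 ≤ t ∧ t + 1 ≤ s}.Finite := by
  obtain ⟨hs2, hrs⟩ := two_mul_ceil_half_le_and_le hs
  obtain rfl : n = 2 * r + 2 + M := by omega
  refine ⟨?_, fun hM1 hMs => ⟨?_, ?_, isUniqueExtremizer_of_lt hM1 (by omega),
    nonempty_almostSeesaw_three_iso r M⟩, ?_, ?_, ?_, finite_setOf_order_quotient_lt r s⟩
  · rintro rfl
    exact isUniqueExtremizer_pathGraph (by omega)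
  · rw [qMinus, Nat.div_eq_of_lt hMs, max_eq_left zero_le_one]
  · simpa only [zero_mul, zero_add] using qPlus_eq (k := 0) hM1 hMs.le
  · rintro hM1 ⟨q, rfl⟩
    rw [Nat.mul_div_cancel_left q (by omega)]
    exact ⟨qMinus_mul (by omega) (Nat.pos_of_mul_pos_left hM1), qPlus_mul (by omega) q,
      isUniqueExtremizer_of_eq_mul (by omega) (by omega) hs2 hrs⟩
  · rintro k t rfl ht hts hsk
    exact ⟨(isExtremizingPair_treeA_treeB ht hts hsk hs2 hrs).onlyCandidates,
      fun hr hts => isUniqueExtremizer_treeA hr ht hts hsk,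
      fun hr hst => isUniqueExtremizer_treeB hr ht hts hst hsk,
      exists_threshold_treeA_treeB ht hts hsk⟩
  · rintro k t rfl hk hks ht hts
    have hpair := isExtremizingPair_candidate hk ht hts hs2 hrs
    rw [qMinus_eq hk hts, qPlus_eq ht (by omega)]
    exact ⟨hpair.onlyCandidates, _, _, (isCandidate_div hk ht hts hs2).isUniqueRoot_lambda2,
      (isCandidate_div_succ hts (by omega) hk hs2).isUniqueRoot_lambda2, rfl, rfl,
      hpair.isUniqueExtremizer_left, hpair.symm.isUniqueExtremizer_left,
      fun h => ⟨hpair.isExtremizer_left h.ge, hpair.symm.isExtremizer_left h.le⟩⟩
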